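/- **Model.** There are $m\ge 2$ machines with private speeds $s_1,\dots,s_m>0$ and $n$ jobs with private sizes $p_1,\dots,p_n>0$. The machines first report speeds; then the jobs arrive one by one, each reports a size and is immediately and irrevocably assigned (at random) to a machine and charged a fee $Q_j$; at the end each machine $i$ receives a payment $P_i$. If $L_i$ is the total size assigned to machine $i$, its utility is $P_i-L_i/s_i$. A job of size $t$ assigned to machine $i$ whose current completion time is $C_i$ has utility $-(C_i+t/s_i)-Q_j$. A mechanism is *two-sided truthful* if, whatever the others report, reporting the true speed maximizes each machine's expected utility, and reporting the true size maximizes each arriving job's expected utility, given the published speeds, the earlier reports and assignments, and the current completion times. For an assignment, the makespan is $\max_i L_i/s_i$, and $\mathrm{OPT}$ is the least makespan of an assignment of all jobs. **Allocation.** Let $\bar s_i$ be $s_i$ rounded down to an integer power of $2$, $K=\lfloor\log_2 m\rfloor+1$, $r_k=\max_i\bar s_i/2^{k-1}$, $\mathcal M_k=\{i:\bar s_i=r_k\}$ and $\mathcal M_{\le k}=\mathcal M_1\cup\dots\cup\mathcal M_k$ for $1\le k\le K$ (the remaining machines are never used). The first job gets fractions $x_{i1}=1/|\mathcal M_1|$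 for $i\in\mathcal M_1$ and $x_{i1}=0$ otherwise, and one sets $\Lambda=p_1/r_1$ and $T_k=0$ for all $k$. For each later job $j$, let $k(j)=\max\big(\{k\in\{1,\dots,K\}: p_j\le r_k\Lambda\}\cup\{1\}\big)$, set $x_{ij}=\bar s_i/\sum_{t\in\mathcal M_{\le k(j)}}\bar s_t$ for $i\in\mathcal M_{\le k(j)}$ and $x_{ij}=0$ otherwise, and add $p_j/\sum_{t\in\mathcal M_{\le k(j)}}\bar s_t$ to $T_{k(j)}$. Then, if $k(j)\le K-1$: if $p_j/r_1>\Lambda$, double $\Lambda$ until $\Lambda\ge p_j/r_1$; otherwise, if $T_{k(j)}>\Lambda$, double $\Lambda$ once. Whenever $\Lambda$ was doubled, reset all $T_k$ to $0$. Job $j$ is assigned to machine $i$ with probability $x_{ij}$, independently of the other jobs. **Fees and payments.** With $x_{ij}(x)$ the fraction if job $j$ reports $x$, and $C_i$ the completion time of machine $i$ at the arrival of $j$, a job that reports $p$ is charged $$Q_j(p)=-\sum_{i}\Big(C_i\,(x_{ij}(p)-x_{ij}(0))+\tfrac1{s_i}\Big(p\,x_{ij}(p)-\int_0^p x_{ij}(t)\,dt\Big)\Big).$$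 With $L_i(t)=\sum_j x_{ij}p_j$ the expected load of machine $i$ if it reports the speed $1/t$ (all other reports being fixed), a machine that reports $s_i=1/b$ is paid $P_i=b\,L_i(b)+\int_b^\infty L_i(t)\,dt$. **Theorem.** For every $m\ge2$ this mechanism is two-sided truthful. It runs in polynomial time: on rational inputs, the random assignment of each arriving job (from one uniformly random integer in a computed range $\{0,\dots,N-1\}$), its fee, and the payment to each machine are computed exactly in time polynomial in the binary length of the input. There is a universal constant $c>0$ such that, for all $m\ge2$, all $n$, all speeds and all job sizes, the makespan of the random assignment (with truthful reports) has expectation at most $c\log m\cdot\mathrm{OPT}$, and it is at most $c\log m\cdot\mathrm{OPT}$ with probability at least $1-1/m^2$. -/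

import Mathlib

noncomputable section

namespace TwoSidedScheduling

/-! ### Online scheduling on related machines

There are `m` machines with speeds `s : Fin m → ℝ` and `n` jobs with sizes `p : Fin n → ℝ`, arriving
in the order `0, 1, …, n - 1`.  An assignment is a map `a : Fin n → Fin m`. -/

/-- Total size of the jobs that the assignment `a` puts on machine `i`. -/
def load {m n : ℕ} (p : Fin n → ℝ) (a : Fin n → Fin m) (i : Fin m) : ℝ :=
  ∑ j, if a j = i then p j else 0

/-- The makespan: the largest completion time of a machine. -/
def makespan {m n : ℕ} (s : Fin m → ℝ) (p : Fin n → ℝ) (a : Fin n → Fin m) : ℝ :=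
  ⨆ i, load p a i / s i

/-- The offline optimum: the least makespan of an assignment. -/
def opt {m n : ℕ} (s : Fin m → ℝ) (p : Fin n → ℝ) : ℝ :=
  ⨅ a : Fin n → Fin m, makespan s p a

/-- A history lists, in order of arrival, the reported size of each job so far and the machine that
the job was assigned to. -/
abbrev History (m : ℕ) : Type := List (ℝ × Fin m)

/-- A randomized online mechanism for `m` machines.

* `prob s h x i` is the probability that an arriving job which reports size `x`, given the reported
  speeds `s` and the history `h`, is immediately assigned to machine `i`.
* `fee s h C x` is the fee charged to that job when it arrives; it may also depend on the current
  completion times `C` of the machines, which are observable.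
* `pay s h i` is the payment to machine `i` after all jobs (recorded in `h`) have been assigned. -/
structure OnlineMechanism (m : ℕ) where
  prob : (Fin m → ℝ) → History m → ℝ → Fin m → ℝ
  prob_nonneg : ∀ s h x i, 0 ≤ prob s h x i
  prob_sum : ∀ s h x, ∑ i, prob s h x i = 1
  fee : (Fin m → ℝ) → History m → (Fin m → ℝ) → ℝ → ℝ
  pay : (Fin m → ℝ) → History m → Fin m → ℝ

/-- The complete history of a run with job reports `p` and realized assignment `a`. -/
def fullHistory {m n : ℕ} (p : Fin n → ℝ) (a : Fin n → Fin m) : History m :=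
  List.ofFn fun j => (p j, a j)

namespace OnlineMechanism

variable {m : ℕ} (M : OnlineMechanism m)

/-- The probability that the run on reported speeds `s` and reported sizes `p` realizes `a`. -/
def runProb {n : ℕ} (s : Fin m → ℝ) (p : Fin n → ℝ) (a : Fin n → Fin m) : ℝ :=
  ∏ j : Fin n, M.prob s ((fullHistory p a).take j) (p j) (a j)

/-- Expectation over the random assignment. -/
def expect {n : ℕ} (s : Fin m → ℝ) (p : Fin n → ℝ) (f : (Fin n → Fin m) → ℝ) : ℝ :=
  ∑ a, M.runProb s p a * f a

/-- Probability of an event on the random assignment. -/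
def probOf {n : ℕ} (s : Fin m → ℝ) (p : Fin n → ℝ) (E : Set (Fin n → Fin m)) : ℝ :=
  M.expect s p (E.indicator fun _ => 1)

/-- Expected utility (payment minus total completion time) of machine `i` whose true speed is `v`,
when the reported speeds are `s` and the job sizes are `p`. -/
def machineUtility {n : ℕ} (s : Fin m → ℝ) (p : Fin n → ℝ) (i : Fin m) (v : ℝ) : ℝ :=
  M.expect s p fun a => M.pay s (fullHistory p a) i - load p a i / v

/-- Reporting the true speed (here `s i`) maximizes the expected utility of every machine `i`,
whatever the other machines and the jobs report. -/
def MachineTruthful : Prop :=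
  ∀ (n : ℕ) (s : Fin m → ℝ) (p : Fin n → ℝ), (∀ i, 0 < s i) → (∀ j, 0 < p j) →
    ∀ (i : Fin m) (w : ℝ), 0 < w →
      M.machineUtility (Function.update s i w) p i (s i) ≤ M.machineUtility s p i (s i)

/-- Expected utility `- E[F + Q]` of an arriving job of true size `t` that reports size `x`: on
machine `i` its completion time is `C i + t / s i`. -/
def jobUtility (s : Fin m → ℝ) (h : History m) (C : Fin m → ℝ) (t x : ℝ) : ℝ :=
  -(∑ i, M.prob s h x i * (C i + t / s i) + M.fee s h C x)

/-- Reporting the true size maximizes the expected utility of every arriving job, for all machine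
speeds, all earlier reports and realized assignments, and all current completion times. -/
def JobTruthful : Prop :=
  ∀ (s : Fin m → ℝ) (h : History m) (C : Fin m → ℝ), (∀ i, 0 < s i) → (∀ e ∈ h, 0 < e.1) →
    (∀ i, 0 ≤ C i) → ∀ t x : ℝ, 0 < t → 0 < x →
      M.jobUtility s h C t x ≤ M.jobUtility s h C t t

/-- Truthful on both sides. -/
def TwoSidedTruthful : Prop :=
  M.MachineTruthful ∧ M.JobTruthful

end OnlineMechanism

/-! ### Level-based proportional allocation -/

section Level

variable {m : ℕ}

/-- A speed rounded down to the nearest integer power of two. -/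
def roundSpeed (v : ℝ) : ℝ :=
  (2 : ℝ) ^ Int.log 2 v

/-- The largest rounded speed. -/
def topSpeed (s : Fin m → ℝ) : ℝ :=
  ⨆ i, roundSpeed (s i)

/-- The number `K = ⌊log₂ m⌋ + 1` of groups; the groups are numbered `1, …, K`. -/
def numLevels (m : ℕ) : ℕ :=
  Nat.log 2 m + 1

/-- The speed `r k` of group `k`, for `k ≥ 1`. -/
def levelSpeed (s : Fin m → ℝ) (k : ℕ) : ℝ :=
  topSpeed s / 2 ^ (k - 1)

/-- Group `k`: the machines of rounded speed `r k`.  Machines that belong to none of the groups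
`1, …, K` are ignored by the algorithm. -/
def group (s : Fin m → ℝ) (k : ℕ) : Finset (Fin m) :=
  Finset.univ.filter fun i => roundSpeed (s i) = levelSpeed s k

/-- The union of the groups `1, …, k`. -/
def groupsUpTo (s : Fin m → ℝ) (k : ℕ) : Finset (Fin m) :=
  (Finset.Icc 1 k).biUnion (group s)

/-- The total rounded speed of the groups `1, …, k`. -/
def capacity (s : Fin m → ℝ) (k : ℕ) : ℝ :=
  ∑ i ∈ groupsUpTo s k, roundSpeed (s i)

/-- The level of a job of size `x` when the guess is `Λ`: the index of the slowest group that can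
accept it, and `1` if there is none. -/
def jobLevel (s : Fin m → ℝ) (Λ x : ℝ) : ℕ :=
  (insert 1 ((Finset.Icc 1 (numLevels m)).filter fun k => x ≤ levelSpeed s k * Λ)).sup id

/-- The result of doubling `Λ` until it is at least `y`. -/
def doubleUntil (Λ y : ℝ) : ℝ :=
  2 ^ sInf {z : ℕ | y ≤ 2 ^ z * Λ} * Λ

/-- The state between two jobs: the guessed optimum `Λ`, and for each level `k` the processing time
on a fastest machine of the level-`k` jobs of the current phase (which is also the processing time
of those jobs on every other machine in the groups `1, …, k`, in terms of rounded speeds). -/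
structure LevelState where
  guess : ℝ
  time : ℕ → ℝ

/-- The state update for a job of size `x` other than the first job.  The job is allocated with the
old guess.  A job of the last level never changes the guess. -/
def nextState (s : Fin m → ℝ) (S : LevelState) (x : ℝ) : LevelState :=
  let k := jobLevel s S.guess x
  let T := Function.update S.time k (S.time k + x / capacity s k)
  if k ≤ numLevels m - 1 then
    if S.guess < x / levelSpeed s 1 then ⟨doubleUntil S.guess (x / levelSpeed s 1), fun _ => 0⟩
    else if S.guess < T k then ⟨2 * S.guess, fun _ => 0⟩
    else ⟨S.guess, T⟩
  else ⟨S.guess, T⟩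

/-- The fraction of an arriving job of size `x` that is put on machine `i`, where `l` lists the
sizes of the earlier jobs in order of arrival. -/
def fraction (s : Fin m → ℝ) (l : List ℝ) (x : ℝ) (i : Fin m) : ℝ :=
  match l with
  | [] => if i ∈ group s 1 then 1 / ((group s 1).card : ℝ) else 0
  | y :: l' =>
    let S := l'.foldl (nextState s) ⟨y / levelSpeed s 1, fun _ => 0⟩
    let k := jobLevel s S.guess x
    if i ∈ groupsUpTo s k then roundSpeed (s i) / capacity s k else 0

/-- The load of machine `i` in the fractional allocation of the jobs in `l`, which is the expected
load after independent rounding. -/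
def fractionalLoad (s : Fin m → ℝ) (l : List ℝ) (i : Fin m) : ℝ :=
  ∑ j : Fin l.length, fraction s (l.take j) l[j] i * l[j]

/-- The fee formula for jobs, normalized to `0` for the report `0`, where `C` lists the current
completion times of the machines. -/
def levelFee (s : Fin m → ℝ) (l : List ℝ) (C : Fin m → ℝ) (x : ℝ) : ℝ :=
  -∑ i, (C i * (fraction s l x i - fraction s l 0 i) +
    1 / s i * (x * fraction s l x i - ∫ t in (0 : ℝ)..x, fraction s l t i))

/-- The Archer–Tardos payment `b * L b + ∫_b^∞ L t dt` of machine `i`, where `b` is its reported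
inverse speed and `L t` its expected load if it reports the inverse speed `t`. -/
def levelPay (s : Fin m → ℝ) (l : List ℝ) (i : Fin m) : ℝ :=
  let L : ℝ → ℝ := fun t => fractionalLoad (Function.update s i (1 / t)) l i
  1 / s i * L (1 / s i) + ∫ t in Set.Ioi (1 / s i), L t

theorem roundSpeed_pos (v : ℝ) : 0 < roundSpeed v :=
  zpow_pos two_pos _

theorem group_one_nonempty (hm : 0 < m) (s : Fin m → ℝ) : (group s 1).Nonempty := by
  have : Nonempty (Fin m) := ⟨⟨0, hm⟩⟩
  obtain ⟨i, hi⟩ := exists_eq_ciSup_of_finite (f := fun i => roundSpeed (s i))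
  exact ⟨i, by simp [group, levelSpeed, topSpeed, hi]⟩

theorem capacity_pos (hm : 0 < m) (s : Fin m → ℝ) {k : ℕ} (hk : 1 ≤ k) : 0 < capacity s k := by
  obtain ⟨i, hi⟩ := group_one_nonempty hm s
  refine Finset.sum_pos (fun i _ => roundSpeed_pos _) ⟨i, ?_⟩
  exact Finset.mem_biUnion.2 ⟨1, Finset.mem_Icc.2 ⟨le_rfl, hk⟩, hi⟩

theorem one_le_jobLevel (s : Fin m → ℝ) (Λ x : ℝ) : 1 ≤ jobLevel s Λ x :=
  Finset.le_sup (f := id) (Finset.mem_insert_self 1 _)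

theorem fraction_nonneg (s : Fin m → ℝ) (l : List ℝ) (x : ℝ) (i : Fin m) :
    0 ≤ fraction s l x i := by
  cases l with
  | nil => simp only [fraction]; split_ifs <;> positivity
  | cons y l' =>
    simp only [fraction]
    split_ifs
    · exact div_nonneg (roundSpeed_pos _).le (Finset.sum_nonneg fun i _ => (roundSpeed_pos _).le)
    · exact le_rfl

theorem fraction_sum (hm : 0 < m) (s : Fin m → ℝ) (l : List ℝ) (x : ℝ) :
    ∑ i, fraction s l x i = 1 := by
  cases l with
  | nil =>
    have h : ((group s 1).card : ℝ) ≠ 0 := by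
      exact_mod_cast (Finset.card_pos.2 (group_one_nonempty hm s)).ne'
    simp [fraction, Finset.sum_ite_mem, h]
  | cons y l' =>
    simp only [fraction, Finset.sum_ite_mem, Finset.univ_inter, ← Finset.sum_div]
    exact div_self (capacity_pos hm s (one_le_jobLevel _ _ _)).ne'

/-- The mechanism: every job is independently assigned to machine `i` with probability equal to its
fraction on `i` in the level-based proportional allocation, with the above fees and payments. -/
def levelMechanism (m : ℕ) (hm : 2 ≤ m) : OnlineMechanism m where
  prob s h x i := fraction s (h.map Prod.fst) x i
  prob_nonneg s h x i := fraction_nonneg s _ x i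
  prob_sum s h x := fraction_sum (by omega) s _ x
  fee s h C x := levelFee s (h.map Prod.fst) C x
  pay s h i := levelPay s (h.map Prod.fst) i

end Level

/-! ### Polynomial time: a random access machine with logarithmic cost

The memory consists of arrays, addressed by natural numbers, of rational numbers.  Every elementary
step (reading or writing a cell, an arithmetic operation, a comparison) costs at least the binary
lengths of the numbers involved. -/

/-- Binary length of a rational number in lowest terms. -/
def bitSize (q : ℚ) : ℕ :=
  Nat.size q.num.natAbs + Nat.size q.den + 1

/-- Contents of the memory: cell `i` of array `b` holds `σ b i`. -/
abbrev Memory : Type := ℕ → ℕ → ℚ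

/-- Expressions.  `cell b e` reads array `b` at the index given by `e`. -/
inductive Expr : Type where
  | const (q : ℚ)
  | cell (b : ℕ) (e : Expr)
  | add (e₁ e₂ : Expr)
  | sub (e₁ e₂ : Expr)
  | mul (e₁ e₂ : Expr)
  | div (e₁ e₂ : Expr)
  | le (e₁ e₂ : Expr)

/-- The value of an expression; comparisons give `1` or `0`. -/
def Expr.eval (σ : Memory) : Expr → ℚ
  | .const q => q
  | .cell b e => σ b ⌊e.eval σ⌋₊
  | .add e₁ e₂ => e₁.eval σ + e₂.eval σ
  | .sub e₁ e₂ => e₁.eval σ - e₂.eval σ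
  | .mul e₁ e₂ => e₁.eval σ * e₂.eval σ
  | .div e₁ e₂ => e₁.eval σ / e₂.eval σ
  | .le e₁ e₂ => if e₁.eval σ ≤ e₂.eval σ then 1 else 0

/-- The cost of evaluating an expression: the binary lengths of the values of all subexpressions. -/
def Expr.cost (σ : Memory) : Expr → ℕ
  | .const q => bitSize q
  | .cell b e => e.cost σ + bitSize ((Expr.cell b e).eval σ)
  | .add e₁ e₂ => e₁.cost σ + e₂.cost σ + bitSize ((Expr.add e₁ e₂).eval σ)
  | .sub e₁ e₂ => e₁.cost σ + e₂.cost σ + bitSize ((Expr.sub e₁ e₂).eval σ)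
  | .mul e₁ e₂ => e₁.cost σ + e₂.cost σ + bitSize ((Expr.mul e₁ e₂).eval σ)
  | .div e₁ e₂ => e₁.cost σ + e₂.cost σ + bitSize ((Expr.div e₁ e₂).eval σ)
  | .le e₁ e₂ => e₁.cost σ + e₂.cost σ + bitSize ((Expr.le e₁ e₂).eval σ)

/-- Programs.  `write b e₁ e₂` stores the value of `e₂` in array `b` at the index given by `e₁`. -/
inductive Program : Type where
  | skip
  | write (b : ℕ) (e₁ e₂ : Expr)
  | seq (P Q : Program)
  | branch (e : Expr) (P Q : Program)
  | loop (e : Expr) (P : Program)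

/-- `Exec P σ τ c`: the program `P`, started in memory `σ`, halts in memory `τ` at total cost `c`.
Tests succeed when the value is nonzero; `loop e P` repeats `P` while `e` is nonzero. -/
inductive Exec : Program → Memory → Memory → ℕ → Prop where
  | skip (σ : Memory) : Exec .skip σ σ 1
  | write (σ : Memory) (b : ℕ) (e₁ e₂ : Expr) :
      Exec (.write b e₁ e₂) σ
        (Function.update σ b (Function.update (σ b) ⌊e₁.eval σ⌋₊ (e₂.eval σ)))
        (e₁.cost σ + e₂.cost σ + 1)
  | seq {P Q : Program} {σ τ υ : Memory} {c d : ℕ} :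
      Exec P σ τ c → Exec Q τ υ d → Exec (.seq P Q) σ υ (c + d + 1)
  | branch_true {e : Expr} {P Q : Program} {σ τ : Memory} {c : ℕ} :
      e.eval σ ≠ 0 → Exec P σ τ c → Exec (.branch e P Q) σ τ (e.cost σ + c + 1)
  | branch_false {e : Expr} {P Q : Program} {σ τ : Memory} {c : ℕ} :
      e.eval σ = 0 → Exec Q σ τ c → Exec (.branch e P Q) σ τ (e.cost σ + c + 1)
  | loop_true {e : Expr} {P : Program} {σ τ υ : Memory} {c d : ℕ} :
      e.eval σ ≠ 0 → Exec P σ τ c → Exec (.loop e P) τ υ d →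
        Exec (.loop e P) σ υ (e.cost σ + c + d + 1)
  | loop_false {e : Expr} {P : Program} {σ : Memory} :
      e.eval σ = 0 → Exec (.loop e P) σ σ (e.cost σ + 1)

/-- The initial memory: the `b`-th input list is stored in array `b`, all other cells are `0`. -/
def initialMemory (inp : List (List ℚ)) : Memory :=
  fun b i => (inp.getD b []).getD i 0

/-- The total binary length of the input. -/
def inputSize (inp : List (List ℚ)) : ℕ :=
  (inp.map fun l => (l.map bitSize).sum).sum

/-- One program computes `f` exactly (the result is left in cell `0` of array `0`) on every instance
in `I`, in time polynomial in the binary length of the encoded instance. -/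
def PolyTimeComputable {I : Type} (enc : I → List (List ℚ)) (f : I → ℝ) : Prop :=
  ∃ (P : Program) (B : Polynomial ℕ), ∀ x : I, ∃ (τ : Memory) (c : ℕ),
    Exec P (initialMemory (enc x)) τ c ∧ ((τ 0 0 : ℚ) : ℝ) = f x ∧ c ≤ B.eval (inputSize (enc x))

/-- What the mechanism knows when a job arrives and reports its size (all data rational). -/
structure JobQuery : Type where
  m : ℕ
  two_le : 2 ≤ m
  speed : Fin m → ℚ
  speed_pos : ∀ i, 0 < speed i
  hist : List (ℚ × Fin m)
  hist_pos : ∀ e ∈ hist, 0 < e.1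
  time : Fin m → ℚ
  time_nonneg : ∀ i, 0 ≤ time i
  size : ℚ
  size_pos : 0 < size

/-- What the mechanism knows when it computes the payment to machine `i` (all data rational). -/
structure PayQuery : Type where
  m : ℕ
  two_le : 2 ≤ m
  speed : Fin m → ℚ
  speed_pos : ∀ i, 0 < speed i
  hist : List (ℚ × Fin m)
  hist_pos : ∀ e ∈ hist, 0 < e.1
  i : Fin m

/-- A vector of rational numbers as a real vector. -/
def realVec {m : ℕ} (v : Fin m → ℚ) : Fin m → ℝ :=
  fun i => (v i : ℝ)

/-- A history with rational sizes as a history. -/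
def realHistory {m : ℕ} (h : List (ℚ × Fin m)) : History m :=
  h.map fun e => ((e.1 : ℝ), e.2)

/-- Input lists for a job query. -/
def JobQuery.encode (q : JobQuery) : List (List ℚ) :=
  [[(q.m : ℚ), (q.hist.length : ℚ), q.size], List.ofFn q.speed, q.hist.map Prod.fst,
    q.hist.map fun e => ((e.2 : ℕ) : ℚ), List.ofFn q.time]

/-- Input lists for a payment query. -/
def PayQuery.encode (q : PayQuery) : List (List ℚ) :=
  [[(q.m : ℚ), (q.hist.length : ℚ), ((q.i : ℕ) : ℚ)], List.ofFn q.speed, q.hist.map Prod.fst,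
    q.hist.map fun e => ((e.2 : ℕ) : ℚ)]

/-- A family of mechanisms (one for each number of machines) runs in polynomial time: uniformly over
all rational instances, polynomial-time programs

* assign an arriving job, by first computing a range `N`, then drawing a uniformly random
  `u ∈ {0, …, N - 1}`, and then computing from `u` the machine,
* compute the fee of the arriving job,
* compute the payment to each machine. -/
def RunsInPolyTime (M : ∀ m : ℕ, 2 ≤ m → OnlineMechanism m) : Prop :=
  (∃ (N : JobQuery → ℕ) (pick : (q : JobQuery) → ℕ → Fin q.m),
    PolyTimeComputable JobQuery.encode (fun q => (N q : ℝ)) ∧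
    PolyTimeComputable
      (fun x : {x : JobQuery × ℕ // x.2 < N x.1} => x.1.1.encode ++ [[(x.1.2 : ℚ)]])
      (fun x => ((pick x.1.1 x.1.2 : ℕ) : ℝ)) ∧
    ∀ q : JobQuery, 0 < N q ∧ ∀ i : Fin q.m,
      (M q.m q.two_le).prob (realVec q.speed) (realHistory q.hist) (q.size : ℝ) i =
        (((Finset.range (N q)).filter fun u => pick q u = i).card : ℝ) / (N q : ℝ)) ∧
  PolyTimeComputable JobQuery.encode (fun q =>
    (M q.m q.two_le).fee (realVec q.speed) (realHistory q.hist) (realVec q.time) (q.size : ℝ)) ∧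
  PolyTimeComputable PayQuery.encode (fun q =>
    (M q.m q.two_le).pay (realVec q.speed) (realHistory q.hist) q.i)

end TwoSidedScheduling

end

open TwoSidedScheduling

/-! Multiplied by the largest rounded speed R, the allocation becomes a recursion (`scaledStep`) on
a guess g and on level times. This recursion sees the speeds only through the number K of levels and
the weights capacity/R. A job of level k < K has size more than g/2^k, and one of level k > 1 has
size at most g/2^(k-1).

Jobs. Let g(x) be the mean inverse speed met by a job that reports x. A larger report gives a lower
level, hence faster machines, so g is antitone. With the fee, a job of true size t has expected
utility const + (x - t) g(x) - ∫_0^x g, which is largest at x = t (`integral_sub_le_of_antitone`).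

Machines. The fractions depend on the sizes but not on the realized assignments, so the payment is
deterministic and the expected load is the fractional load. By the Archer–Tardos argument it
suffices that this load is antitone in the reported inverse speed and is eventually 0. It depends
only on the rounded speed, so it is enough to halve one rounded speed. The difficulty is that this
changes the whole run. If the weights A, B satisfy B k ≤ A k ≤ 2 B (k+1), then the B-run never falls
behind and never leads by more than one doubling (`Sim.step`), so the levels of a job differ by at
most one. When another machine is at least as fast as the unhalved one, the halved run leads. When
the machine is the unique fastest, all thresholds shift and the unhalved run leads. In both cases
the fraction of the halved machine does not grow (`fraction_update_le`).

Competitiveness. Put G = OPT · R. Jobs larger than G/2^(k-1) must run in the first k groups in an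
optimal schedule, so their work is at most 2G times the weight of level k (`bigWork_le`). If g > 2G,
the level times therefore cannot overflow, and g ≤ 4G always (`StateBound.step`). The guess grows
geometrically, so all finished phases together cost O(K g), while the last level is bounded by the
total volume. This gives a fractional load of O(log m) times OPT. A job can reach machine i only if
its size is at most 4 OPT times the rounded speed, so exponential moments under independent rounding
(`expect_exp_load_le`) and a union bound give both makespan bounds.

Polynomial time. The predicates `Ctx.PT` and `Ctx.PTA` express computability of a number or an array
with polynomially bounded bit length. They are closed under arithmetic, tests, sums and loops whose
states stay short. The mechanism is rewritten on rational data: the guess is always 2^z p_0 with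
small z, each level time is a sum of few quotients, the fee integral is a finite sum because the
fraction is a step function, and the payment integral is a finite sum over powers of two. The
fractions have integer numerators over a common denominator, so one uniform integer selects the
machine. -/

noncomputable section

namespace TwoSidedScheduling

/-! ### The allocation recursion, scaled by the top speed, over an ordered field -/

section Scaled

variable {𝕜 : Type*} [Field 𝕜] [LinearOrder 𝕜]

/-- The level of a job of size `x` when the guess times the top speed is `g`. -/
def scaledLevel (K : ℕ) (g x : 𝕜) : ℕ :=
  (insert 1 ((Finset.Icc 1 K).filter fun k => x ≤ g / 2 ^ (k - 1))).sup id

/-- Doubling `g` until it is at least `y`. -/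
def doubling (g y : 𝕜) : 𝕜 :=
  2 ^ sInf {z : ℕ | y ≤ 2 ^ z * g} * g

/-- The state update of the level-based allocation, with the guess and the times scaled by the top
speed and the capacities divided by it. -/
def scaledStep (K : ℕ) (w : ℕ → 𝕜) (S : 𝕜 × (ℕ → 𝕜)) (x : 𝕜) : 𝕜 × (ℕ → 𝕜) :=
  let k := scaledLevel K S.1 x
  let τ := Function.update S.2 k (S.2 k + x / w k)
  if k ≤ K - 1 then
    if S.1 < x then (doubling S.1 x, fun _ => 0)
    else if S.1 < τ k then (2 * S.1, fun _ => 0)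
    else (S.1, τ)
  else (S.1, τ)

theorem one_le_scaledLevel (K : ℕ) (g x : 𝕜) : 1 ≤ scaledLevel K g x :=
  Finset.le_sup (f := id) (Finset.mem_insert_self 1 _)

theorem scaledLevel_le {K : ℕ} (hK : 1 ≤ K) (g x : 𝕜) : scaledLevel K g x ≤ K := by
  refine Finset.sup_le fun k hk => ?_
  simp only [Finset.mem_insert, Finset.mem_filter, Finset.mem_Icc] at hk
  rcases hk with rfl | h
  · exact hK
  · exact h.1.2

theorem scaledLevel_mem (K : ℕ) (g x : 𝕜) :
    scaledLevel K g x = 1 ∨ x ≤ g / 2 ^ (scaledLevel K g x - 1) := by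
  have h := Finset.exists_mem_eq_sup
    (insert 1 ((Finset.Icc 1 K).filter fun k => x ≤ g / 2 ^ (k - 1))) ⟨1, by simp⟩ id
  obtain ⟨k, hk, he⟩ := h
  have he' : scaledLevel K g x = k := he
  simp only [Finset.mem_insert, Finset.mem_filter, Finset.mem_Icc] at hk
  rw [he']
  tauto

theorem le_scaledLevel {K k : ℕ} {g x : 𝕜} (h1 : 1 ≤ k) (h2 : k ≤ K)
    (h : x ≤ g / 2 ^ (k - 1)) : k ≤ scaledLevel K g x :=
  Finset.le_sup (f := id) (by simp [h1, h2, h])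

theorem le_div_of_scaledLevel {K : ℕ} {g x : 𝕜} (h : x ≤ g ∨ scaledLevel K g x ≠ 1) :
    x ≤ g / 2 ^ (scaledLevel K g x - 1) := by
  rcases scaledLevel_mem K g x with h1 | h1
  · rcases h with h | h
    · simpa [h1] using h
    · exact absurd h1 h
  · exact h1

/-- Level k + 1 has refused the job, and its threshold is g/2^k. This lower bound on sizes is what
limits the work that can accumulate at a level below the last. -/
theorem lt_of_scaledLevel_lt {K : ℕ} {g x : 𝕜} (h : scaledLevel K g x < K) :
    g / 2 ^ scaledLevel K g x < x := by
  by_contra hc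
  have := le_scaledLevel (k := scaledLevel K g x + 1) (by omega) h (by simpa using not_lt.1 hc)
  omega

theorem scaledLevel_antitone (K : ℕ) (g : 𝕜) : Antitone (scaledLevel K g) := by
  intro x y hxy
  rcases scaledLevel_mem K g y with h | h
  · rw [h]; exact one_le_scaledLevel _ _ _
  · by_cases hK : scaledLevel K g y ≤ K
    · exact le_scaledLevel (one_le_scaledLevel _ _ _) hK (hxy.trans h)
    -- Only K = 0 gets here, and then no level other than the default 1 exists.
    · have : scaledLevel K g y = 1 := by
        rcases Nat.lt_or_ge K 1 with h0 | h0
        · have : K = 0 := by omega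
          subst this
          simp [scaledLevel]
        · exact absurd (scaledLevel_le h0 g y) hK
      rw [this]; exact one_le_scaledLevel _ _ _

variable [IsStrictOrderedRing 𝕜]

theorem div_two_pow_le {g : 𝕜} (hg : 0 ≤ g) {a b : ℕ} (h : a ≤ b) : g / 2 ^ b ≤ g / 2 ^ a := by
  gcongr
  norm_num

theorem scaledLevel_eq {K k : ℕ} {g x : 𝕜} (hg : 0 ≤ g) (h1 : 1 ≤ k) (h2 : k ≤ K)
    (h3 : k = 1 ∨ x ≤ g / 2 ^ (k - 1)) (h4 : k < K → g / 2 ^ k < x) :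
    scaledLevel K g x = k := by
  apply le_antisymm
  · by_contra hc
    push Not at hc
    have hK := scaledLevel_le (h1.trans h2) g x
    have := le_div_of_scaledLevel (K := K) (g := g) (x := x) (Or.inr (by omega))
    have h5 := div_two_pow_le hg (a := k) (b := scaledLevel K g x - 1) (by omega)
    exact absurd (h4 (by omega)) (not_lt.2 (this.trans h5))
  · rcases h3 with rfl | h3
    · exact one_le_scaledLevel _ _ _
    · exact le_scaledLevel h1 h2 h3

/-- When the guess doubles, the level of a job that is not too large for the guess increases by one,
unless it is the last level. -/
theorem scaledLevel_two_mul {K : ℕ} (hK : 1 ≤ K) {g x : 𝕜} (hg : 0 < g) (hx : x ≤ g) :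
    scaledLevel K (2 * g) x = min K (scaledLevel K g x + 1) := by
  have h1 := one_le_scaledLevel K g x
  have h2 := scaledLevel_le hK g x
  have h3 := le_div_of_scaledLevel (K := K) (Or.inl hx)
  have key : 2 * g / 2 ^ scaledLevel K g x = g / 2 ^ (scaledLevel K g x - 1) := by
    obtain ⟨j, hj⟩ : ∃ j, scaledLevel K g x = j + 1 := ⟨_, (Nat.sub_add_cancel h1).symm⟩
    rw [hj, Nat.add_sub_cancel, pow_succ]; field_simp
  rcases h2.lt_or_eq with h | h
  · rw [min_eq_right (by omega)]
    refine scaledLevel_eq (by positivity) (by omega) h (Or.inr ?_) fun _ => ?_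
    · rw [Nat.add_sub_cancel, key]; exact h3
    · have := lt_of_scaledLevel_lt h
      rw [pow_succ]
      convert this using 1
      field_simp
  · rw [min_eq_left (by omega)]
    refine scaledLevel_eq (by positivity) hK le_rfl (Or.inr ?_) fun h => absurd h (lt_irrefl _)
    have := h3
    rw [h] at this
    refine this.trans ?_
    gcongr
    linarith

theorem scaledLevel_eq_one {K : ℕ} (hK : 1 ≤ K) {g x : 𝕜} (hg : 0 ≤ g) (hx : g / 2 < x) :
    scaledLevel K g x = 1 :=
  scaledLevel_eq hg le_rfl hK (Or.inl rfl) fun _ => by simpa using hx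

variable [Archimedean 𝕜]

theorem doubling_spec {g y : 𝕜} (hg : 0 < g) :
    y ≤ doubling g y := by
  have hne : {z : ℕ | y ≤ 2 ^ z * g}.Nonempty := by
    obtain ⟨z, hz⟩ := pow_unbounded_of_one_lt (y / g) (one_lt_two (α := 𝕜))
    exact ⟨z, by rw [Set.mem_ofPred_eq, ← div_le_iff₀ hg]; exact hz.le⟩
  exact Nat.sInf_mem hne

theorem doubling_eq {g y : 𝕜} {z : ℕ} (hg : 0 < g) (h1 : y ≤ 2 ^ (z + 1) * g)
    (h2 : 2 ^ z * g < y) : doubling g y = 2 ^ (z + 1) * g := by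
  have : sInf {z : ℕ | y ≤ 2 ^ z * g} = z + 1 := by
    apply le_antisymm
    · exact Nat.sInf_le h1
    · by_contra hc
      have h3 : sInf {z : ℕ | y ≤ 2 ^ z * g} ≤ z := by omega
      have h4 := doubling_spec (y := y) hg
      have : doubling g y ≤ 2 ^ z * g := by
        unfold doubling; gcongr; norm_num
      linarith
  rw [doubling, this]

/-- If `g` is smaller than `y`, then `doubling g y` is the first `2 ^ (z + 1) * g` that is at least
`y`. -/
theorem exists_doubling_eq {g y : 𝕜} (hg : 0 < g) (hy : g < y) :
    ∃ z : ℕ, doubling g y = 2 ^ (z + 1) * g ∧ y ≤ 2 ^ (z + 1) * g ∧ 2 ^ z * g < y := by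
  have h0 : sInf {z : ℕ | y ≤ 2 ^ z * g} ≠ 0 := by
    intro h
    have := doubling_spec (y := y) hg
    rw [doubling, h] at this
    simp at this
    exact absurd hy (not_lt.2 this)
  obtain ⟨z, hz⟩ := Nat.exists_eq_succ_of_ne_zero h0
  refine ⟨z, by rw [doubling, hz], ?_, ?_⟩
  · have := doubling_spec (y := y) hg
    rwa [doubling, hz] at this
  · have := Nat.notMem_of_lt_sInf (m := z) (s := {z : ℕ | y ≤ 2 ^ z * g}) (by omega)
    simpa using this

/-- Both starting points run through the same multiples of g. Hence a run that lags by one doubling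
catches up when a job exceeds both guesses. -/
theorem doubling_two_mul {g y : 𝕜} (hg : 0 < g) (hy : 2 * g < y) :
    doubling (2 * g) y = doubling g y := by
  obtain ⟨z, h1, h2, h3⟩ := exists_doubling_eq (by linarith : 0 < 2 * g) hy
  rw [h1, doubling_eq (z := z + 1) hg]
  · ring
  · rw [pow_succ]; linarith
  · rw [pow_succ]; linarith

theorem doubling_le_two_mul {g y : 𝕜} (hg : 0 < g) (hy : g < y) (hy2 : y ≤ 2 * g) :
    doubling g y = 2 * g := by
  rw [doubling_eq (z := 0) hg] <;> simp [hy, hy2]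

theorem le_doubling {g y : 𝕜} (hg : 0 < g) (hy : g < y) : 2 * g ≤ doubling g y := by
  obtain ⟨z, h1, h2, h3⟩ := exists_doubling_eq hg hy
  rw [h1, pow_succ]
  have : (1 : 𝕜) ≤ 2 ^ z := one_le_pow₀ (by norm_num)
  nlinarith

theorem doubling_lt {g y : 𝕜} (hg : 0 < g) (hy : g < y) : doubling g y < 2 * y := by
  obtain ⟨z, h1, h2, h3⟩ := exists_doubling_eq hg hy
  rw [h1, pow_succ]
  linarith

theorem scaledStep_nonneg {K : ℕ} {w : ℕ → 𝕜} (hw : ∀ k, 1 ≤ k → 0 < w k) {S : 𝕜 × (ℕ → 𝕜)}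
    (hg : 0 < S.1) (hτ : ∀ k, 0 ≤ S.2 k) {x : 𝕜} (hx : 0 < x) :
    0 < (scaledStep K w S x).1 ∧ ∀ k, 0 ≤ (scaledStep K w S x).2 k := by
  have h : ∀ k, 0 ≤ Function.update S.2 (scaledLevel K S.1 x)
      (S.2 (scaledLevel K S.1 x) + x / w (scaledLevel K S.1 x)) k := by
    intro k
    rw [Function.update_apply]
    split_ifs
    · have := hw _ (one_le_scaledLevel K S.1 x)
      have := hτ (scaledLevel K S.1 x)
      positivity
    · exact hτ k
  unfold scaledStep
  dsimp only
  split_ifs with h1 h2 h3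
  · exact ⟨by have := le_doubling hg h2; dsimp only; linarith, fun _ => le_rfl⟩
  · exact ⟨by dsimp only; linarith, fun _ => le_rfl⟩
  · exact ⟨hg, h⟩
  · exact ⟨hg, h⟩

end Scaled

/-! ### Two runs with nearby weights stay within one doubling of each other -/

section Simulation

variable {K : ℕ} {A B : ℕ → ℝ}

/-- The relation between two runs of the scaled allocation whose weights differ only slightly: the
leading run `S'` has the same guess and larger times, or twice the guess. -/
structure Sim (K : ℕ) (S S' : ℝ × (ℕ → ℝ)) : Prop where
  pos : 0 < S.1
  nonneg : ∀ k, 0 ≤ S.2 k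
  nonneg' : ∀ k, 0 ≤ S'.2 k
  rel : (S'.1 = S.1 ∧ ∀ k, 1 ≤ k → k + 1 ≤ K → S.2 k ≤ S'.2 k) ∨
    (S'.1 = 2 * S.1 ∧ ∀ k, 1 ≤ k → k + 2 ≤ K → S'.2 (k + 1) ≤ 2 * S.2 k)

/-- A doubled guess moves every threshold by exactly one level. The exceptions keep their level:
jobs already at the last level, and jobs above the smaller guess g, which exceed half of either
guess and have level 1 in both runs. -/
theorem Sim.level {S S' : ℝ × (ℕ → ℝ)} (h : Sim K S S') (hK : 1 ≤ K) (x : ℝ) :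
    scaledLevel K S'.1 x = scaledLevel K S.1 x ∨
      scaledLevel K S'.1 x = scaledLevel K S.1 x + 1 := by
  rcases h.rel with ⟨h1, -⟩ | ⟨h1, -⟩
  · rw [h1]; exact Or.inl rfl
  · rw [h1]
    have := scaledLevel_le hK S.1 x
    rcases le_or_gt x S.1 with hx | hx
    · rw [scaledLevel_two_mul hK h.pos hx]; omega
    · left
      rw [scaledLevel_eq_one hK (by linarith [h.pos]) (by linarith),
        scaledLevel_eq_one hK h.pos.le (by linarith [h.pos])]

theorem scaledStep_cases {S : ℝ × (ℕ → ℝ)} {k : ℕ} {x : ℝ} (h : scaledLevel K S.1 x = k) :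
    (¬ k ≤ K - 1 ∧ scaledStep K A S x = (S.1, Function.update S.2 k (S.2 k + x / A k))) ∨
    (k ≤ K - 1 ∧ S.1 < x ∧ scaledStep K A S x = (doubling S.1 x, fun _ => 0)) ∨
    (k ≤ K - 1 ∧ x ≤ S.1 ∧ S.1 < S.2 k + x / A k ∧
      scaledStep K A S x = (2 * S.1, fun _ => 0)) ∨
    (k ≤ K - 1 ∧ x ≤ S.1 ∧ S.2 k + x / A k ≤ S.1 ∧
      scaledStep K A S x = (S.1, Function.update S.2 k (S.2 k + x / A k))) := by
  subst h
  simp only [scaledStep, Function.update_self]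
  split_ifs with h1 h2 h3
  · exact Or.inr (Or.inl ⟨h1, h2, rfl⟩)
  · exact Or.inr (Or.inr (Or.inl ⟨h1, not_lt.1 h2, h3, rfl⟩))
  · exact Or.inr (Or.inr (Or.inr ⟨h1, not_lt.1 h2, not_lt.1 h3, rfl⟩))
  · exact Or.inl ⟨h1, rfl⟩

/-- With equal guesses the leading run has smaller weights, hence larger times, so it overflows
whenever the other does. With twice the guess, a job of level k in the lagging run usually has level
k + 1 in the leading one and adds x / B (k+1) ≤ 2 (x / A k). The leading time at k + 1 thus stays
within twice the lagging time at k and can pass 2g only if the lagging time passes g. Times of the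
last level never influence a guess, so they are left out of the relation. -/
theorem Sim.step {S S' : ℝ × (ℕ → ℝ)} (h : Sim K S S') (hK : 2 ≤ K)
    (hA : ∀ k, 1 ≤ k → 0 < A k) (hB : ∀ k, 1 ≤ k → 0 < B k)
    (hBA : ∀ k, 1 ≤ k → B k ≤ A k) (hAB : ∀ k, 1 ≤ k → A k ≤ 2 * B (k + 1))
    {x : ℝ} (hx : 0 < x) : Sim K (scaledStep K A S x) (scaledStep K B S' x) := by
  have hS' : 0 < S'.1 := by rcases h.rel with h' | h' <;> linarith [h.pos, h'.1]
  have n1 := scaledStep_nonneg (K := K) hA h.pos h.nonneg hx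
  have n2 := scaledStep_nonneg (K := K) hB hS' h.nonneg' hx
  refine ⟨n1.1, n1.2, n2.2, ?_⟩
  have hk1 := one_le_scaledLevel K S.1 x
  have hkK := scaledLevel_le (by omega : 1 ≤ K) S.1 x
  have hnn := h.nonneg
  have hnn' := h.nonneg'
  have hpos := h.pos
  have hA' := hA _ hk1
  rcases h.rel with ⟨hg, hτ⟩ | ⟨hg, hτ⟩
  · -- equal guesses
    have hB' := hB _ hk1
    have hdiv := div_le_div_of_nonneg_left hx.le hB' (hBA _ hk1)
    have hd0 : 0 ≤ x / A (scaledLevel K S.1 x) := by positivity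
    rcases scaledStep_cases (A := A) (rfl : scaledLevel K S.1 x = _) with
      ⟨a1, a2⟩ | ⟨a1, a2, a3⟩ | ⟨a1, a2, a3, a4⟩ | ⟨a1, a2, a3, a4⟩ <;>
    rcases scaledStep_cases (A := B) (S := S') (by rw [hg] : scaledLevel K S'.1 x = scaledLevel K S.1 x) with
      ⟨b1, b2⟩ | ⟨b1, b2, b3⟩ | ⟨b1, b2, b3, b4⟩ | ⟨b1, b2, b3, b4⟩ <;>
    first
      | omega
      | (exfalso; have := hτ _ hk1 (by omega); linarith)
      | skip
    · rw [a2, b2]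
      refine Or.inl ⟨hg, fun j hj hjK => ?_⟩
      dsimp only
      rw [Function.update_of_ne (by omega), Function.update_of_ne (by omega)]
      exact hτ j hj hjK
    · rw [a3, b3]; left; simp [hg]
    · rw [a4, b4]; left; simp [hg]
    -- Only the leading run overflows. Its times are reset to 0, so the relation for a doubled guess
    -- holds because the lagging times are nonnegative.
    · rw [a4, b4]; right
      refine ⟨by simp [hg], fun j hj hjK => ?_⟩
      have := n1.2 j
      rw [a4] at this
      dsimp only at this ⊢
      linarith
    · rw [a4, b4]
      refine Or.inl ⟨hg, fun j hj hjK => ?_⟩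
      simp only [Function.update_apply]
      split_ifs with hjk
      · have := hτ _ hk1 (by omega); linarith
      · exact hτ j hj hjK
  · -- the leading run has twice the guess
    rcases le_or_gt x S.1 with hxS | hxS
    · have hl := scaledLevel_two_mul (by omega : 1 ≤ K) hpos hxS
      rw [← hg] at hl
      rcases (show scaledLevel K S.1 x + 1 ≥ K ∨ scaledLevel K S.1 x + 2 ≤ K by omega) with hk | hk
      · rw [min_eq_left (by omega)] at hl
        rcases scaledStep_cases (A := B) hl with
          ⟨b1, b2⟩ | ⟨b1, b2, b3⟩ | ⟨b1, b2, b3, b4⟩ | ⟨b1, b2, b3, b4⟩ <;>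
        rcases scaledStep_cases (A := A) (rfl : scaledLevel K S.1 x = _) with
          ⟨a1, a2⟩ | ⟨a1, a2, a3⟩ | ⟨a1, a2, a3, a4⟩ | ⟨a1, a2, a3, a4⟩ <;>
        first
          | omega
          | (exfalso; linarith)
          | skip
        · rw [a2, b2]; right
          refine ⟨hg, fun j hj hjK => ?_⟩
          dsimp only
          rw [Function.update_of_ne (by omega), Function.update_of_ne (by omega)]
          exact hτ j hj hjK
        -- The lagging run overflows at level K - 1 while the leading one files the job under level
        -- K: the guesses become equal and the lagging times are 0.
        · rw [b2, a4]; left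
          refine ⟨hg, fun j hj hjK => ?_⟩
          dsimp only
          rw [Function.update_of_ne (by omega)]
          exact hnn' j
        -- The updated entries, K - 1 in the lagging run and K in the leading run, lie outside the
        -- compared range.
        · rw [b2, a4]; right
          refine ⟨hg, fun j hj hjK => ?_⟩
          dsimp only
          rw [Function.update_of_ne (by omega), Function.update_of_ne (by omega)]
          exact hτ j hj hjK
      · rw [min_eq_right (by omega)] at hl
        have hBk := hB (scaledLevel K S.1 x + 1) (by omega)
        -- This is where A k ≤ 2 B (k+1) enters; it excludes an overflow of the leading run alone.
        have hdiv : x / B (scaledLevel K S.1 x + 1) ≤ 2 * (x / A (scaledLevel K S.1 x)) := by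
          rw [div_le_iff₀ hBk]
          have h5 := hAB _ hk1
          rw [mul_assoc, div_mul_eq_mul_div, ← mul_div_assoc, le_div_iff₀ hA']
          nlinarith
        have hd0 : 0 ≤ x / B (scaledLevel K S.1 x + 1) := by positivity
        have hτk := hτ _ hk1 hk
        rcases scaledStep_cases (A := B) hl with
          ⟨b1, b2⟩ | ⟨b1, b2, b3⟩ | ⟨b1, b2, b3, b4⟩ | ⟨b1, b2, b3, b4⟩ <;>
        rcases scaledStep_cases (A := A) (rfl : scaledLevel K S.1 x = _) with
          ⟨a1, a2⟩ | ⟨a1, a2, a3⟩ | ⟨a1, a2, a3, a4⟩ | ⟨a1, a2, a3, a4⟩ <;>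
        first
          | omega
          | (exfalso; linarith)
          | skip
        · rw [a4, b4]; right; simp [hg]
        · rw [a4, b4]; left; refine ⟨hg, fun j hj hjK => ?_⟩
          have := n2.2 j
          rwa [b4] at this
        · rw [a4, b4]; right; refine ⟨hg, fun j hj hjK => ?_⟩
          simp only [Function.update_apply, Nat.add_right_cancel_iff]
          split_ifs
          · linarith
          · exact hτ j hj hjK
    · have e1 : scaledLevel K S.1 x = 1 :=
        scaledLevel_eq_one (by omega) hpos.le (by linarith)
      have e2 : scaledLevel K S'.1 x = 1 :=
        scaledLevel_eq_one (by omega) (by linarith) (by linarith)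
      rcases scaledStep_cases (A := B) e2 with
        ⟨b1, b2⟩ | ⟨b1, b2, b3⟩ | ⟨b1, b2, b3, b4⟩ | ⟨b1, b2, b3, b4⟩ <;>
      rcases scaledStep_cases (A := A) e1 with
        ⟨a1, a2⟩ | ⟨a1, a2, a3⟩ | ⟨a1, a2, a3, a4⟩ | ⟨a1, a2, a3, a4⟩ <;>
      first
        | omega
        | (exfalso; linarith)
        | skip
      · rw [a3, b3]; left; simp [hg, doubling_two_mul hpos (hg ▸ b2)]
      · rw [a3, b4]; right; simp [hg, doubling_le_two_mul hpos hxS (hg ▸ b2)]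
      -- Here g < x ≤ 2g: the size of the job lifts the lagging guess exactly to the leading one.
      · rw [a3, b4]; left
        refine ⟨by simp [hg, doubling_le_two_mul hpos hxS (hg ▸ b2)], fun j hj hjK => ?_⟩
        have := n2.2 j
        rwa [b4] at this

theorem Sim.foldl (hK : 2 ≤ K)
    (hA : ∀ k, 1 ≤ k → 0 < A k) (hB : ∀ k, 1 ≤ k → 0 < B k)
    (hBA : ∀ k, 1 ≤ k → B k ≤ A k) (hAB : ∀ k, 1 ≤ k → A k ≤ 2 * B (k + 1)) (l : List ℝ) :
    ∀ {S S' : ℝ × (ℕ → ℝ)}, Sim K S S' → (∀ x ∈ l, 0 < x) →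
      Sim K (l.foldl (scaledStep K A) S) (l.foldl (scaledStep K B) S') := by
  induction l with
  | nil => intro S S' h _; exact h
  | cons x l ih =>
    intro S S' h hl
    exact ih (h.step hK hA hB hBA hAB (hl x (by simp))) fun y hy => hl y (by simp [hy])

theorem Sim.init {y : ℝ} (hy : 0 < y) : Sim K (y, fun _ => 0) (y, fun _ => 0) :=
  ⟨hy, fun _ => le_rfl, fun _ => le_rfl, Or.inl ⟨rfl, fun _ _ _ => le_rfl⟩⟩

end Simulation

end TwoSidedScheduling

end

/-! ### Rounded speeds, groups, and the passage to the scaled recursion -/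

noncomputable section

namespace TwoSidedScheduling

variable {m : ℕ}

theorem roundSpeed_le {v : ℝ} (hv : 0 < v) : roundSpeed v ≤ v := by
  simpa [roundSpeed] using Int.zpow_log_le_self one_lt_two hv

theorem lt_two_mul_roundSpeed (v : ℝ) : v < 2 * roundSpeed v := by
  have := Int.lt_zpow_succ_log_self one_lt_two v
  rw [zpow_add_one₀ (by norm_num)] at this
  simp only [roundSpeed]
  push_cast at this
  linarith

theorem roundSpeed_zpow (z : ℤ) : roundSpeed ((2 : ℝ) ^ z) = 2 ^ z := by
  rw [roundSpeed]
  congr 1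
  exact_mod_cast Int.log_zpow (R := ℝ) one_lt_two z

theorem zpow_le_roundSpeed_iff {v : ℝ} (hv : 0 < v) {z : ℤ} :
    (2 : ℝ) ^ z ≤ roundSpeed v ↔ 2 ^ z ≤ v := by
  rw [roundSpeed, zpow_le_zpow_iff_right₀ one_lt_two]
  exact_mod_cast (Int.zpow_le_iff_le_log (R := ℝ) one_lt_two hv).symm

theorem exists_topSpeed_eq (hm : 0 < m) (s : Fin m → ℝ) : ∃ i, roundSpeed (s i) = topSpeed s := by
  have : Nonempty (Fin m) := ⟨⟨0, hm⟩⟩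
  exact exists_eq_ciSup_of_finite (f := fun i => roundSpeed (s i))

theorem roundSpeed_le_topSpeed (s : Fin m → ℝ) (i : Fin m) : roundSpeed (s i) ≤ topSpeed s :=
  le_ciSup (f := fun i => roundSpeed (s i)) (Set.finite_range _).bddAbove i

theorem topSpeed_pos (hm : 0 < m) (s : Fin m → ℝ) : 0 < topSpeed s := by
  obtain ⟨i, hi⟩ := exists_topSpeed_eq hm s
  rw [← hi]; exact roundSpeed_pos _

theorem levelSpeed_anti (hm : 0 < m) (s : Fin m → ℝ) : Antitone (levelSpeed s) := fun _ _ h =>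
  div_two_pow_le (topSpeed_pos hm s).le (Nat.sub_le_sub_right h 1)

theorem levelSpeed_le_two_mul (hm : 0 < m) (s : Fin m → ℝ) (k : ℕ) :
    levelSpeed s k ≤ 2 * levelSpeed s (k + 1) := by
  have := topSpeed_pos hm s
  rw [levelSpeed, levelSpeed]
  cases k with
  | zero => simp; linarith
  | succ k =>
    simp only [Nat.add_sub_cancel]
    rw [pow_succ]
    apply le_of_eq; field_simp

theorem levelSpeed_one (s : Fin m → ℝ) : levelSpeed s 1 = topSpeed s := by
  simp [levelSpeed]

/-- Rounded speeds and group speeds are powers of two, and no rounded speed exceeds the top one.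
Thus every rounded speed from r_k upwards is one of r_1, …, r_k, and a union of groups is a
threshold set. -/
theorem mem_groupsUpTo (hm : 0 < m) (s : Fin m → ℝ) {k : ℕ} (hk : 1 ≤ k) (i : Fin m) :
    i ∈ groupsUpTo s k ↔ levelSpeed s k ≤ roundSpeed (s i) := by
  simp only [groupsUpTo, group, Finset.mem_biUnion, Finset.mem_Icc, Finset.mem_filter,
    Finset.mem_univ, true_and]
  constructor
  · rintro ⟨j, ⟨h1, h2⟩, h⟩
    rw [h]; exact levelSpeed_anti hm s h2
  · intro h
    obtain ⟨i₀, h₀⟩ := exists_topSpeed_eq hm s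
    have h1 := roundSpeed_le_topSpeed s i
    rw [levelSpeed] at h
    rw [← h₀] at h h1
    rw [roundSpeed, roundSpeed, zpow_le_zpow_iff_right₀ one_lt_two] at h1
    have e : ∀ j : ℕ, roundSpeed (s i₀) / 2 ^ j = 2 ^ (Int.log 2 (s i₀) - j) := fun j => by
      rw [roundSpeed, zpow_sub₀ (by norm_num), zpow_natCast]
    rw [e, roundSpeed, zpow_le_zpow_iff_right₀ one_lt_two] at h
    refine ⟨(Int.log 2 (s i₀) - Int.log 2 (s i)).toNat + 1, ⟨by omega, by omega⟩, ?_⟩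
    rw [levelSpeed, ← h₀, e, roundSpeed]
    congr 1
    omega

theorem capacity_eq_sum (hm : 0 < m) (s : Fin m → ℝ) {k : ℕ} (hk : 1 ≤ k) :
    capacity s k = ∑ i, if levelSpeed s k ≤ roundSpeed (s i) then roundSpeed (s i) else 0 := by
  rw [capacity, ← Finset.sum_filter]
  congr 1
  ext i
  simp [mem_groupsUpTo hm s hk]

theorem topSpeed_le_capacity (hm : 0 < m) (s : Fin m → ℝ) {k : ℕ} (hk : 1 ≤ k) :
    topSpeed s ≤ capacity s k := by
  obtain ⟨i, hi⟩ := exists_topSpeed_eq hm s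
  rw [← hi]
  refine Finset.single_le_sum (f := fun i => roundSpeed (s i)) (fun i _ => (roundSpeed_pos _).le) ?_
  rw [mem_groupsUpTo hm s hk, hi, ← levelSpeed_one]
  exact levelSpeed_anti hm s hk

theorem one_le_numLevels (m : ℕ) : 1 ≤ numLevels m := Nat.le_add_left _ _

theorem two_le_numLevels (hm : 2 ≤ m) : 2 ≤ numLevels m := by
  have := Nat.log_pos one_lt_two hm
  unfold numLevels; omega

/-- Capacities relative to the top speed. -/
def weight (s : Fin m → ℝ) (k : ℕ) : ℝ :=
  capacity s k / topSpeed s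

/-- A state, scaled by the top speed. -/
def scaledState (s : Fin m → ℝ) (S : LevelState) : ℝ × (ℕ → ℝ) :=
  (topSpeed s * S.guess, fun k => topSpeed s * S.time k)

theorem weight_pos (hm : 0 < m) (s : Fin m → ℝ) {k : ℕ} (hk : 1 ≤ k) : 0 < weight s k :=
  div_pos (capacity_pos hm s hk) (topSpeed_pos hm s)

theorem jobLevel_eq (s : Fin m → ℝ) (Λ x : ℝ) :
    jobLevel s Λ x = scaledLevel (numLevels m) (topSpeed s * Λ) x := by
  simp only [jobLevel, scaledLevel, levelSpeed, div_mul_eq_mul_div]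

/-- Multiplying guess and times by the top speed turns x / capacity into x / weight and x / r_1 into
x. After this, runs with different top speeds start from the same state and can be compared. -/
theorem scaledState_nextState (hm : 0 < m) (s : Fin m → ℝ) (S : LevelState) (x : ℝ) :
    scaledState s (nextState s S x) =
      scaledStep (numLevels m) (weight s) (scaledState s S) x := by
  have hR := topSpeed_pos hm s
  have hk := one_le_jobLevel s S.guess x
  have e1 : S.guess < x / levelSpeed s 1 ↔ topSpeed s * S.guess < x := by
    rw [levelSpeed_one, lt_div_iff₀ hR, mul_comm]
  have e2 : topSpeed s * (S.time (jobLevel s S.guess x) + x / capacity s (jobLevel s S.guess x)) =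
      topSpeed s * S.time (jobLevel s S.guess x) + x / weight s (jobLevel s S.guess x) := by
    have := capacity_pos hm s hk
    rw [weight]; field_simp
  have e3 : S.guess < S.time (jobLevel s S.guess x) + x / capacity s (jobLevel s S.guess x) ↔
      topSpeed s * S.guess < topSpeed s * S.time (jobLevel s S.guess x) +
        x / weight s (jobLevel s S.guess x) := by
    rw [← e2, mul_lt_mul_iff_right₀ hR]
  have e4 : topSpeed s * doubleUntil S.guess (x / levelSpeed s 1) =
      doubling (topSpeed s * S.guess) x := by
    have : {z : ℕ | x / levelSpeed s 1 ≤ 2 ^ z * S.guess} =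
        {z : ℕ | x ≤ 2 ^ z * (topSpeed s * S.guess)} := by
      ext z
      rw [Set.mem_ofPred_eq, Set.mem_ofPred_eq, levelSpeed_one, div_le_iff₀ hR]
      ring_nf
    rw [doubleUntil, doubling, this]; ring
  have e5 : (fun k => topSpeed s * Function.update S.time (jobLevel s S.guess x)
      (S.time (jobLevel s S.guess x) + x / capacity s (jobLevel s S.guess x)) k) =
      Function.update (fun k => topSpeed s * S.time k) (jobLevel s S.guess x)
        (topSpeed s * S.time (jobLevel s S.guess x) + x / weight s (jobLevel s S.guess x)) := by
    ext k
    rw [Function.update_apply, Function.update_apply]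
    split_ifs
    · exact e2
    · rfl
  simp only [nextState, scaledStep, scaledState, ← jobLevel_eq, Function.update_self, ← e1, ← e3]
  split_ifs <;> simp [e4, e5]; ring

/-- The scaled state after the jobs in `l`, the first of which is `y`. -/
theorem scaledState_foldl (hm : 0 < m) (s : Fin m → ℝ) (l : List ℝ) (S : LevelState) :
    scaledState s (l.foldl (nextState s) S) =
      l.foldl (scaledStep (numLevels m) (weight s)) (scaledState s S) := by
  induction l generalizing S with
  | nil => rfl
  | cons x l ih => simp only [List.foldl_cons, ih, scaledState_nextState hm]

/-- The level of an arriving job of size `x`, where `l` lists the sizes of the earlier jobs. -/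
def levelAfter (K : ℕ) (w : ℕ → ℝ) (l : List ℝ) (x : ℝ) : ℕ :=
  match l with
  | [] => 1
  | y :: l' => scaledLevel K (l'.foldl (scaledStep K w) (y, fun _ => 0)).1 x

/-- The fraction of a job of level `k` that is put on machine `i`. -/
def levelFraction (s : Fin m → ℝ) (k : ℕ) (i : Fin m) : ℝ :=
  if levelSpeed s k ≤ roundSpeed (s i) then roundSpeed (s i) / capacity s k else 0

theorem one_le_levelAfter (K : ℕ) (w : ℕ → ℝ) (l : List ℝ) (x : ℝ) : 1 ≤ levelAfter K w l x := by
  cases l with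
  | nil => exact le_rfl
  | cons y l => exact one_le_scaledLevel _ _ _

theorem levelAfter_le {K : ℕ} (hK : 1 ≤ K) (w : ℕ → ℝ) (l : List ℝ) (x : ℝ) :
    levelAfter K w l x ≤ K := by
  cases l with
  | nil => exact hK
  | cons y l => exact scaledLevel_le hK _ _

theorem levelAfter_antitone (K : ℕ) (w : ℕ → ℝ) (l : List ℝ) : Antitone (levelAfter K w l) := by
  cases l with
  | nil => exact fun _ _ _ => le_rfl
  | cons y l => exact scaledLevel_antitone _ _

/-- The first job needs no separate treatment: all machines of group 1 have the same rounded speed,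
so the uniform fractions are the proportional ones of level 1. -/
theorem fraction_eq (hm : 0 < m) (s : Fin m → ℝ) (l : List ℝ) (x : ℝ) (i : Fin m) :
    fraction s l x i = levelFraction s (levelAfter (numLevels m) (weight s) l x) i := by
  cases l with
  | nil =>
    have hc : capacity s 1 = (group s 1).card * topSpeed s := by
      have : groupsUpTo s 1 = group s 1 := by simp [groupsUpTo]
      rw [capacity, this, Finset.sum_congr rfl (g := fun _ => topSpeed s), Finset.sum_const,
        nsmul_eq_mul]
      intro i hi
      simpa [group, levelSpeed_one] using hi
    have hi : i ∈ group s 1 ↔ levelSpeed s 1 ≤ roundSpeed (s i) := by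
      simp only [group, Finset.mem_filter, Finset.mem_univ, true_and, levelSpeed_one]
      exact ⟨fun h => h.ge, fun h => le_antisymm (roundSpeed_le_topSpeed s i) h⟩
    simp only [fraction, levelFraction, levelAfter, ← hi]
    split_ifs with h
    · have h1 : roundSpeed (s i) = topSpeed s :=
        le_antisymm (roundSpeed_le_topSpeed s i) (by rw [← levelSpeed_one]; exact hi.1 h)
      have h2 := topSpeed_pos hm s
      have h3 : ((group s 1).card : ℝ) ≠ 0 := by
        exact_mod_cast (Finset.card_pos.2 (group_one_nonempty hm s)).ne'
      rw [hc, h1]; field_simp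
    · rfl
  | cons y l =>
    have h2 := topSpeed_pos hm s
    have e : topSpeed s * (l.foldl (nextState s) ⟨y / levelSpeed s 1, fun _ => 0⟩).guess =
        (l.foldl (scaledStep (numLevels m) (weight s)) (y, fun _ => 0)).1 := by
      have h := congrArg Prod.fst (scaledState_foldl hm s l ⟨y / levelSpeed s 1, fun _ => 0⟩)
      refine h.trans ?_
      congr 2
      simp only [scaledState, levelSpeed_one, mul_zero]
      congr 1
      field_simp
    simp only [fraction, jobLevel_eq, e, levelFraction, levelAfter,
      mem_groupsUpTo hm s (one_le_scaledLevel _ _ _)]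
    congr

/-! ### Truthfulness of the jobs -/

theorem intervalIntegrable_fraction (hm : 0 < m) (s : Fin m → ℝ) (l : List ℝ) (i : Fin m)
    (a b : ℝ) : IntervalIntegrable (fun t => fraction s l t i) MeasureTheory.volume a b := by
  have hmeas : Measurable fun t => fraction s l t i := by
    simp only [fraction_eq hm]
    -- The fraction is an arbitrary function of a level in ℕ, and the level is antitone in the size.
    exact (measurable_from_top (f := fun k => levelFraction s k i)).comp
      (levelAfter_antitone _ _ l).measurable
  refine (intervalIntegrable_const (c := (1 : ℝ))).mono_fun hmeas.aestronglyMeasurable ?_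
  refine Filter.Eventually.of_forall fun t => ?_
  dsimp only
  rw [Real.norm_of_nonneg (fraction_nonneg s l t i), norm_one, ← fraction_sum hm s l t]
  exact Finset.single_le_sum (f := fun i => fraction s l t i)
    (fun i _ => fraction_nonneg s l t i) (Finset.mem_univ i)

/-- The mean inverse speed of the groups `1, …, k` is monotone in `k`. -/
theorem sum_levelFraction_div_mono (hm : 0 < m) {s : Fin m → ℝ} (hs : ∀ i, 0 < s i) {j k : ℕ}
    (hj : 1 ≤ j) (hjk : j ≤ k) :
    ∑ i, levelFraction s j i / s i ≤ ∑ i, levelFraction s k i / s i := by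
  have key : ∀ k, 1 ≤ k → ∑ i, levelFraction s k i / s i =
      (∑ i ∈ groupsUpTo s k, roundSpeed (s i) * (1 / s i)) / capacity s k := by
    intro k hk
    have : groupsUpTo s k =
        Finset.univ.filter fun i => levelSpeed s k ≤ roundSpeed (s i) := by
      ext i; simp [mem_groupsUpTo hm s hk]
    rw [this, Finset.sum_filter, Finset.sum_div]
    refine Finset.sum_congr rfl fun i _ => ?_
    rw [levelFraction]
    split_ifs
    · ring
    · simp
  have hk := hj.trans hjk
  rw [key j hj, key k hk, div_le_div_iff₀ (capacity_pos hm s hj) (capacity_pos hm s hk)]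
  have hsub : groupsUpTo s j ⊆ groupsUpTo s k :=
    Finset.biUnion_subset_biUnion_of_subset_left _ (Finset.Icc_subset_Icc_right hjk)
  -- After cross-multiplication the contributions of the common groups cancel. What remains pairs a
  -- machine a added after level j with a machine b of the groups up to j, and b is the faster one.
  simp only [capacity, ← Finset.sum_sdiff hsub, mul_add, add_mul]
  refine add_le_add ?_ le_rfl
  rw [Finset.sum_mul_sum, Finset.sum_mul_sum, Finset.sum_comm]
  refine Finset.sum_le_sum fun a ha => Finset.sum_le_sum fun b hb => ?_
  have ha' : ¬ levelSpeed s j ≤ roundSpeed (s a) := by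
    rw [← mem_groupsUpTo hm s hj]; exact (Finset.mem_sdiff.1 ha).2
  have hb' := (mem_groupsUpTo hm s hj b).1 hb
  have hab : s a ≤ s b := by
    by_contra hc
    push Not at hc
    have h1 : roundSpeed (s b) ≤ roundSpeed (s a) := by
      refine (zpow_le_roundSpeed_iff (hs a)).2 ?_
      exact (roundSpeed_le (hs b)).trans hc.le
    exact ha' (hb'.trans h1)
  have h2 : 1 / s b ≤ 1 / s a := one_div_le_one_div_of_le (hs a) hab
  have h3 := roundSpeed_pos (s a)
  have h4 := roundSpeed_pos (s b)
  calc roundSpeed (s b) * (1 / s b) * roundSpeed (s a)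
      = (roundSpeed (s a) * roundSpeed (s b)) * (1 / s b) := by ring
    _ ≤ (roundSpeed (s a) * roundSpeed (s b)) * (1 / s a) := by gcongr
    _ = roundSpeed (s a) * (1 / s a) * roundSpeed (s b) := by ring

/-- An antitone function lies below its value at `x` to the right of `x`, and above it to the left. -/
theorem integral_sub_le_of_antitone {g : ℝ → ℝ} (hg : Antitone g) (t x : ℝ) :
    (x - t) * g x - ∫ u in (0 : ℝ)..x, g u ≤ -∫ u in (0 : ℝ)..t, g u := by
  have hi : ∀ a b, IntervalIntegrable g MeasureTheory.volume a b := fun a b => hg.intervalIntegrable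
  have h := intervalIntegral.integral_interval_sub_left (hi 0 t) (hi 0 x)
  rcases le_total x t with hxt | hxt
  · have := intervalIntegral.integral_mono_on hxt (hi x t) (intervalIntegrable_const (c := g x))
      (fun u hu => hg hu.1)
    rw [intervalIntegral.integral_const, smul_eq_mul] at this
    linarith
  · have := intervalIntegral.integral_mono_on hxt (intervalIntegrable_const (c := g x)) (hi t x)
      (fun u hu => hg hu.2)
    rw [intervalIntegral.integral_const, smul_eq_mul] at this
    have h2 := intervalIntegral.integral_symm (μ := MeasureTheory.volume) (f := g) x t
    linarith

theorem levelMechanism_jobTruthful (hm : 2 ≤ m) : (levelMechanism m hm).JobTruthful := by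
  intro s h C hs _ _ t x _ _
  have hm' : 0 < m := by omega
  set l := h.map Prod.fst
  set g : ℝ → ℝ := fun u => ∑ i, fraction s l u i / s i with hg
  have hanti : Antitone g := fun a b hab => by
    simp only [hg, fraction_eq hm']
    exact sum_levelFraction_div_mono hm' hs (one_le_levelAfter _ _ _ _)
      (levelAfter_antitone _ _ l hab)
  have hint : ∀ y, ∫ u in (0 : ℝ)..y, g u = ∑ i, 1 / s i * ∫ u in (0 : ℝ)..y, fraction s l u i := by
    intro y
    simp only [hg]
    rw [intervalIntegral.integral_finsetSum]
    · refine Finset.sum_congr rfl fun i _ => ?_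
      rw [intervalIntegral.integral_div]; ring
    · exact fun i _ => (intervalIntegrable_fraction hm' s l i 0 y).div_const _
  -- The fee cancels the reported-size dependence of the waiting times: C enters only through the
  -- fractions at report 0.
  have key : ∀ y, (levelMechanism m hm).jobUtility s h C t y =
      -(∑ i, C i * fraction s l 0 i) + ((y - t) * g y - ∫ u in (0 : ℝ)..y, g u) := by
    intro y
    simp only [OnlineMechanism.jobUtility, levelMechanism, levelFee]
    rw [hint, hg, Finset.mul_sum, ← Finset.sum_sub_distrib, ← Finset.sum_neg_distrib,
      ← Finset.sum_neg_distrib, ← Finset.sum_add_distrib, ← Finset.sum_add_distrib,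
      ← Finset.sum_neg_distrib]
    refine Finset.sum_congr rfl fun i _ => ?_
    have := (hs i).ne'
    simp only [l]
    field_simp
    ring
  rw [key, key]
  have := integral_sub_le_of_antitone hanti t x
  linarith

end TwoSidedScheduling

end

noncomputable section

namespace TwoSidedScheduling

variable {m : ℕ}

/-! ### Truthfulness of the machines -/

/-- The total rounded speed of the machines other than `i` of rounded speed at least `r`. -/
def otherCapacity (s : Fin m → ℝ) (i : Fin m) (r : ℝ) : ℝ :=
  ∑ j ∈ Finset.univ.erase i, if r ≤ roundSpeed (s j) then roundSpeed (s j) else 0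

theorem capacity_eq_otherCapacity_add (hm : 0 < m) (s : Fin m → ℝ) {k : ℕ} (hk : 1 ≤ k)
    (i : Fin m) :
    capacity s k = otherCapacity s i (levelSpeed s k) +
      if levelSpeed s k ≤ roundSpeed (s i) then roundSpeed (s i) else 0 := by
  rw [capacity_eq_sum hm s hk, otherCapacity, Finset.sum_erase_add _ _ (Finset.mem_univ i)]

theorem otherCapacity_update (s : Fin m → ℝ) (i : Fin m) (v r : ℝ) :
    otherCapacity (Function.update s i v) i r = otherCapacity s i r :=
  Finset.sum_congr rfl fun j hj => by rw [Function.update_of_ne (Finset.ne_of_mem_erase hj)]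

theorem otherCapacity_anti (s : Fin m → ℝ) (i : Fin m) {r r' : ℝ} (h : r ≤ r') :
    otherCapacity s i r' ≤ otherCapacity s i r := by
  refine Finset.sum_le_sum fun j _ => ?_
  have := roundSpeed_pos (s j)
  split_ifs with h1 h2 <;> linarith

theorem otherCapacity_nonneg (s : Fin m → ℝ) (i : Fin m) (r : ℝ) : 0 ≤ otherCapacity s i r :=
  Finset.sum_nonneg fun j _ => by
    have := roundSpeed_pos (s j)
    split_ifs <;> linarith

theorem topSpeed_eq_of_forall_le {s : Fin m → ℝ} {R : ℝ} (i : Fin m) (hi : roundSpeed (s i) = R)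
    (h : ∀ j, roundSpeed (s j) ≤ R) : topSpeed s = R := by
  have : Nonempty (Fin m) := ⟨i⟩
  exact le_antisymm (ciSup_le h) (hi ▸ roundSpeed_le_topSpeed s i)

/-- The level at which a job is allocated, in two runs related by `Sim`. -/
theorem levelAfter_sim {K : ℕ} {A B : ℕ → ℝ} (hK : 2 ≤ K)
    (hA : ∀ k, 1 ≤ k → 0 < A k) (hB : ∀ k, 1 ≤ k → 0 < B k)
    (hBA : ∀ k, 1 ≤ k → B k ≤ A k) (hAB : ∀ k, 1 ≤ k → A k ≤ 2 * B (k + 1)) {l : List ℝ}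
    (hl : ∀ y ∈ l, 0 < y) (x : ℝ) :
    levelAfter K B l x = levelAfter K A l x ∨ levelAfter K B l x = levelAfter K A l x + 1 := by
  cases l with
  | nil => exact Or.inl rfl
  | cons y l =>
    exact ((Sim.init (hl y (by simp))).foldl hK hA hB hBA hAB l
      fun z hz => hl z (by simp [hz])).level (by omega) x

/-- Halving the rounded speed of a machine does not increase its fraction of any job: the case of
another machine that is at least as fast. -/
theorem fraction_update_le_of_exists (hm : 2 ≤ m) (s : Fin m → ℝ) (i : Fin m) (z : ℤ)
    {i' : Fin m} (hi' : i' ≠ i) (hz : (2 : ℝ) ^ (z + 1) ≤ roundSpeed (s i')) {l : List ℝ}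
    (hl : ∀ y ∈ l, 0 < y) (x : ℝ) :
    fraction (Function.update s i (2 ^ z)) l x i ≤
      fraction (Function.update s i (2 ^ (z + 1))) l x i := by
  have hm' : 0 < m := by omega
  set s₁ := Function.update s i ((2 : ℝ) ^ (z + 1)) with hs₁
  set s₂ := Function.update s i ((2 : ℝ) ^ z) with hs₂
  have e1 : roundSpeed (s₁ i) = 2 ^ (z + 1) := by rw [hs₁, Function.update_self, roundSpeed_zpow]
  have e2 : roundSpeed (s₂ i) = 2 ^ z := by rw [hs₂, Function.update_self, roundSpeed_zpow]
  have e3 : ∀ j, j ≠ i → roundSpeed (s₁ j) = roundSpeed (s j) := fun j hj => by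
    rw [hs₁, Function.update_of_ne hj]
  have e4 : ∀ j, j ≠ i → roundSpeed (s₂ j) = roundSpeed (s j) := fun j hj => by
    rw [hs₂, Function.update_of_ne hj]
  have hzz : (2 : ℝ) ^ (z + 1) = 2 * 2 ^ z := by rw [zpow_add_one₀ (by norm_num)]; ring
  have hz0 : (0 : ℝ) < 2 ^ z := by positivity
  -- A fastest machine other than i. It is untouched by the change, so the top speed and all
  -- thresholds are the same for both reports.
  obtain ⟨t, ht, htop⟩ : ∃ t, t ≠ i ∧ roundSpeed (s₁ t) = topSpeed s₁ := by
    obtain ⟨t, ht⟩ := exists_topSpeed_eq hm' s₁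
    by_cases h : t = i
    · refine ⟨i', hi', le_antisymm (roundSpeed_le_topSpeed _ _) ?_⟩
      rw [← ht, h, e1, e3 _ hi']; exact hz
    · exact ⟨t, h, ht⟩
  have hR : topSpeed s₂ = topSpeed s₁ := by
    refine topSpeed_eq_of_forall_le t (by rw [e4 t ht, ← htop, e3 t ht]) fun j => ?_
    by_cases hj : j = i
    · rw [hj, e2]; have := roundSpeed_le_topSpeed s₁ i; rw [e1] at this; linarith
    · rw [e4 j hj, ← e3 j hj]; exact roundSpeed_le_topSpeed _ _
  have hlev : ∀ k, levelSpeed s₂ k = levelSpeed s₁ k := fun k => by rw [levelSpeed, levelSpeed, hR]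
  have hRpos := topSpeed_pos hm' s₁
  have o1 : ∀ r, otherCapacity s₁ i r = otherCapacity s i r := otherCapacity_update s i _
  have o2 : ∀ r, otherCapacity s₂ i r = otherCapacity s i r := otherCapacity_update s i _
  -- Machine t belongs to every union of groups, so the capacity without i is at least the larger
  -- speed of i. Losing part or all of i's speed therefore costs at most a factor 2.
  have hO : ∀ k, 1 ≤ k → (2 : ℝ) ^ (z + 1) ≤ otherCapacity s i (levelSpeed s₁ k) := by
    intro k hk
    have h1 : (2 : ℝ) ^ (z + 1) ≤ topSpeed s₁ := e1 ▸ roundSpeed_le_topSpeed s₁ i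
    have h2 : levelSpeed s₁ k ≤ roundSpeed (s t) := by
      rw [← e3 t ht, htop, ← levelSpeed_one]; exact levelSpeed_anti hm' s₁ hk
    refine h1.trans ?_
    rw [← htop, e3 t ht, otherCapacity]
    refine le_trans ?_ (Finset.single_le_sum (f := fun j =>
      if levelSpeed s₁ k ≤ roundSpeed (s j) then roundSpeed (s j) else 0) (fun j _ => ?_)
      (Finset.mem_erase.2 ⟨ht, Finset.mem_univ t⟩))
    · rw [if_pos h2]
    · have := roundSpeed_pos (s j); split_ifs <;> linarith
  have c1 : ∀ k, 1 ≤ k → capacity s₁ k = otherCapacity s i (levelSpeed s₁ k) +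
      if levelSpeed s₁ k ≤ 2 ^ (z + 1) then 2 ^ (z + 1) else 0 := fun k hk => by
    rw [capacity_eq_otherCapacity_add hm' s₁ hk i, o1, e1]
  have c2 : ∀ k, 1 ≤ k → capacity s₂ k = otherCapacity s i (levelSpeed s₁ k) +
      if levelSpeed s₁ k ≤ 2 ^ z then 2 ^ z else 0 := fun k hk => by
    rw [capacity_eq_otherCapacity_add hm' s₂ hk i, o2, e2, hlev]
  have hBA : ∀ k, 1 ≤ k → capacity s₂ k ≤ capacity s₁ k := by
    intro k hk
    rw [c1 k hk, c2 k hk]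
    split_ifs <;> linarith
  have hAB : ∀ k k', 1 ≤ k → k ≤ k' → capacity s₁ k ≤ 2 * capacity s₂ k' := by
    intro k k' hk hkk
    have h1 := hO k hk
    have h2 := otherCapacity_anti s i (levelSpeed_anti hm' s₁ hkk)
    rw [c1 k hk, c2 k' (hk.trans hkk)]
    split_ifs <;> linarith
  have hsim := levelAfter_sim (A := weight s₁) (B := weight s₂) (two_le_numLevels hm)
    (fun k => weight_pos hm' s₁) (fun k => weight_pos hm' s₂)
    (fun k hk => by rw [weight, weight, hR]; gcongr; exact hBA k hk)
    (fun k hk => by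
      rw [weight, weight, hR, ← mul_div_assoc]; gcongr; exact hAB k (k + 1) hk (by omega)) hl x
  rw [fraction_eq hm', fraction_eq hm']
  set k := levelAfter (numLevels m) (weight s₁) l x
  set k' := levelAfter (numLevels m) (weight s₂) l x
  have hk : 1 ≤ k := one_le_levelAfter _ _ _ _
  have hkk : k ≤ k' := by omega
  have p1 := capacity_pos hm' s₁ hk
  have p2 := capacity_pos hm' s₂ (hk.trans hkk)
  rw [levelFraction, levelFraction, hlev, e1, e2]
  -- Since k' ≤ k + 1, a slowed machine that is fast enough for level k' is, with its full speed,
  -- fast enough for level k. Its speed halves while the capacity drops by a factor of at most 2.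
  by_cases h1 : levelSpeed s₁ k' ≤ 2 ^ z
  · have h2 : levelSpeed s₁ k ≤ 2 ^ (z + 1) := by
      have h3 := levelSpeed_le_two_mul hm' s₁ k
      have h4 := levelSpeed_anti hm' s₁ (show k' ≤ k + 1 by omega)
      linarith
    rw [if_pos h1, if_pos h2, div_le_div_iff₀ p2 p1, hzz]
    have := hAB k k' hk hkk
    nlinarith
  · rw [if_neg h1]
    split_ifs <;> positivity

/-- Halving the rounded speed of a machine does not increase its fraction of any job: the case of
a unique fastest machine. -/
theorem fraction_update_le_of_forall (hm : 2 ≤ m) (s : Fin m → ℝ) (i : Fin m) (z : ℤ)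
    (hz : ∀ j, j ≠ i → roundSpeed (s j) ≤ (2 : ℝ) ^ z) {l : List ℝ}
    (hl : ∀ y ∈ l, 0 < y) (x : ℝ) :
    fraction (Function.update s i (2 ^ z)) l x i ≤
      fraction (Function.update s i (2 ^ (z + 1))) l x i := by
  have hm' : 0 < m := by omega
  set s₁ := Function.update s i ((2 : ℝ) ^ (z + 1)) with hs₁
  set s₂ := Function.update s i ((2 : ℝ) ^ z) with hs₂
  have e1 : roundSpeed (s₁ i) = 2 ^ (z + 1) := by rw [hs₁, Function.update_self, roundSpeed_zpow]
  have e2 : roundSpeed (s₂ i) = 2 ^ z := by rw [hs₂, Function.update_self, roundSpeed_zpow]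
  have hzz : (2 : ℝ) ^ (z + 1) = 2 * 2 ^ z := by rw [zpow_add_one₀ (by norm_num)]; ring
  have hz0 : (0 : ℝ) < 2 ^ z := by positivity
  have t1 : topSpeed s₁ = 2 * 2 ^ z := by
    refine topSpeed_eq_of_forall_le i (by rw [e1, hzz]) fun j => ?_
    by_cases hj : j = i
    · rw [hj, e1, hzz]
    · rw [hs₁, Function.update_of_ne hj]; linarith [hz j hj]
  have t2 : topSpeed s₂ = 2 ^ z := by
    refine topSpeed_eq_of_forall_le i e2 fun j => ?_
    by_cases hj : j = i
    · rw [hj, e2]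
    · rw [hs₂, Function.update_of_ne hj]; exact hz j hj
  -- The top speed itself halves, so every group index shifts by one.
  have hlev : ∀ k, 1 ≤ k → levelSpeed s₂ k = levelSpeed s₁ (k + 1) := fun k hk => by
    obtain ⟨j, rfl⟩ := Nat.exists_eq_add_of_le' hk
    rw [levelSpeed, levelSpeed, t1, t2]
    simp only [Nat.add_sub_cancel]
    rw [pow_succ]; field_simp
  have l1 : ∀ k, 1 ≤ k → levelSpeed s₁ k ≤ 2 ^ (z + 1) := fun k hk => by
    rw [hzz, ← t1, ← levelSpeed_one]; exact levelSpeed_anti hm' s₁ hk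
  have l2 : ∀ k, 1 ≤ k → levelSpeed s₂ k ≤ 2 ^ z := fun k hk => by
    rw [← t2, ← levelSpeed_one]; exact levelSpeed_anti hm' s₂ hk
  have c1 : ∀ k, 1 ≤ k → capacity s₁ k =
      otherCapacity s i (levelSpeed s₁ k) + 2 * 2 ^ z := fun k hk => by
    rw [capacity_eq_otherCapacity_add hm' s₁ hk i, otherCapacity_update, e1, if_pos (l1 k hk), hzz]
  have c2 : ∀ k, 1 ≤ k → capacity s₂ k =
      otherCapacity s i (levelSpeed s₁ (k + 1)) + 2 ^ z := fun k hk => by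
    rw [capacity_eq_otherCapacity_add hm' s₂ hk i, otherCapacity_update, e2, if_pos (l2 k hk),
      hlev k hk]
  have hmono : ∀ k, otherCapacity s i (levelSpeed s₁ k) ≤
      otherCapacity s i (levelSpeed s₁ (k + 1)) := fun k =>
    otherCapacity_anti s i (levelSpeed_anti hm' s₁ (Nat.le_succ k))
  have hnn : ∀ k, 0 ≤ otherCapacity s i (levelSpeed s₁ k) := fun k => otherCapacity_nonneg _ _ _
  have w1 : ∀ k, 1 ≤ k → weight s₁ k = (otherCapacity s i (levelSpeed s₁ k) + 2 * 2 ^ z) /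
      (2 * 2 ^ z) := fun k hk => by rw [weight, c1 k hk, t1]
  -- Relative to its own top speed, machine i has weight 1 in both runs, while the other machines
  -- count twice as much after the halving.
  have w2 : ∀ k, 1 ≤ k → weight s₂ k = (2 * otherCapacity s i (levelSpeed s₁ (k + 1)) + 2 * 2 ^ z) /
      (2 * 2 ^ z) := fun k hk => by rw [weight, c2 k hk, t2]; field_simp
  have hBA : ∀ k, 1 ≤ k → weight s₁ k ≤ weight s₂ k := by
    intro k hk
    rw [w1 k hk, w2 k hk]
    gcongr
    linarith [hmono k, hnn (k + 1)]
  -- The roles are exchanged: now the run with the faster machine has the smaller weights and leads.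
  have hsim := levelAfter_sim (A := weight s₂) (B := weight s₁) (two_le_numLevels hm)
    (fun k => weight_pos hm' s₂) (fun k => weight_pos hm' s₁) hBA
    (fun k hk => by
      rw [w1 (k + 1) (by omega), w2 k hk, ← mul_div_assoc]
      gcongr
      linarith) hl x
  rw [fraction_eq hm', fraction_eq hm']
  set k := levelAfter (numLevels m) (weight s₂) l x
  set k' := levelAfter (numLevels m) (weight s₁) l x
  have hk : 1 ≤ k := one_le_levelAfter _ _ _ _
  have hk' : 1 ≤ k' := one_le_levelAfter _ _ _ _
  have p1 := capacity_pos hm' s₁ hk'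
  have p2 := capacity_pos hm' s₂ hk
  rw [levelFraction, levelFraction, e1, e2, if_pos (l1 k' hk'), if_pos (l2 k hk),
    div_le_div_iff₀ p2 p1, hzz]
  have : capacity s₁ k' ≤ 2 * capacity s₂ k := by
    rw [c1 k' hk', c2 k hk]
    rcases hsim with h | h
    · rw [h]; linarith [hmono k, hnn (k + 1)]
    · rw [h]; linarith [hnn (k + 1)]
  nlinarith

theorem fraction_update_le (hm : 2 ≤ m) (s : Fin m → ℝ) (i : Fin m) (z : ℤ) {l : List ℝ}
    (hl : ∀ y ∈ l, 0 < y) (x : ℝ) :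
    fraction (Function.update s i (2 ^ z)) l x i ≤
      fraction (Function.update s i (2 ^ (z + 1))) l x i := by
  by_cases h : ∃ i', i' ≠ i ∧ (2 : ℝ) ^ (z + 1) ≤ roundSpeed (s i')
  · obtain ⟨i', h1, h2⟩ := h
    exact fraction_update_le_of_exists hm s i z h1 h2 hl x
  · push Not at h
    refine fraction_update_le_of_forall hm s i z (fun j hj => ?_) hl x
    -- No power of two lies strictly between 2^z and 2^(z+1).
    have := h j hj
    rw [roundSpeed, zpow_lt_zpow_iff_right₀ one_lt_two] at this
    rw [roundSpeed, zpow_le_zpow_iff_right₀ one_lt_two]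
    omega

/-- The fractional load depends on the speeds only through the rounded speeds. -/
theorem fractionalLoad_congr (hm : 0 < m) {s s' : Fin m → ℝ}
    (h : ∀ i, roundSpeed (s i) = roundSpeed (s' i)) (l : List ℝ) (i : Fin m) :
    fractionalLoad s l i = fractionalLoad s' l i := by
  have hR : topSpeed s = topSpeed s' := by simp only [topSpeed, h]
  have hlev : levelSpeed s = levelSpeed s' := by ext k; rw [levelSpeed, levelSpeed, hR]
  have hcap : capacity s = capacity s' := by
    ext k
    have hg : group s = group s' := by ext k; simp only [group, h, hlev]
    simp only [capacity, groupsUpTo, h, hg]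
  have hw : weight s = weight s' := by ext k; rw [weight, weight, hR, hcap]
  simp only [fractionalLoad, fraction_eq hm, hw, levelFraction, h, hlev, hcap]

/-- The fractional load of machine `i` if its rounded speed is `2 ^ z`. -/
def loadAt (s : Fin m → ℝ) (l : List ℝ) (i : Fin m) (z : ℤ) : ℝ :=
  fractionalLoad (Function.update s i (2 ^ z)) l i

theorem loadAt_mono (hm : 2 ≤ m) (s : Fin m → ℝ) {l : List ℝ} (hl : ∀ y ∈ l, 0 < y) (i : Fin m) :
    Monotone (loadAt s l i) :=
  monotone_int_of_le_succ fun z => by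
    unfold loadAt fractionalLoad
    exact Finset.sum_le_sum fun j _ => mul_le_mul_of_nonneg_right
      (fraction_update_le hm s i z (fun y hy => hl y (List.mem_of_mem_take hy)) _)
      (hl _ (List.getElem_mem _)).le

theorem fractionalLoad_update (hm : 0 < m) (s : Fin m → ℝ) (l : List ℝ) (i : Fin m) (v : ℝ) :
    fractionalLoad (Function.update s i v) l i = loadAt s l i (Int.log 2 v) := by
  refine fractionalLoad_congr hm (fun j => ?_) l i
  by_cases hj : j = i
  · rw [hj, Function.update_self, Function.update_self, roundSpeed_zpow, roundSpeed]
  · rw [Function.update_of_ne hj, Function.update_of_ne hj]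

theorem two_pow_numLevels_le (hm : 0 < m) : 2 ^ (numLevels m - 1) ≤ m :=
  Nat.pow_log_le_self 2 hm.ne'

/-- A machine that is slow compared with another one gets no jobs. -/
theorem loadAt_eq_zero (hm : 2 ≤ m) (s : Fin m → ℝ) (l : List ℝ) {i i' : Fin m} (hi : i' ≠ i)
    {z : ℤ} (hz : 2 ^ z * m < roundSpeed (s i')) : loadAt s l i z = 0 := by
  have hm' : 0 < m := by omega
  have hz0 : (0 : ℝ) < 2 ^ z := by positivity
  unfold loadAt fractionalLoad
  refine Finset.sum_eq_zero fun j _ => ?_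
  rw [fraction_eq hm', levelFraction, if_neg, zero_mul]
  rw [Function.update_self, roundSpeed_zpow, not_le, levelSpeed, lt_div_iff₀ (by positivity)]
  have h1 : roundSpeed (s i') ≤ topSpeed (Function.update s i (2 ^ z)) := by
    have := roundSpeed_le_topSpeed (Function.update s i (2 ^ z)) i'
    rwa [Function.update_of_ne hi] at this
  refine lt_of_le_of_lt ?_ (hz.trans_le h1)
  gcongr
  -- Every threshold in use is at least the top speed divided by 2^(K-1), hence at least the top
  -- speed divided by m.
  have h2 := two_pow_numLevels_le hm'
  have h3 : 2 ^ (levelAfter (numLevels m) (weight (Function.update s i (2 ^ z)))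
      (l.take j) l[j] - 1) ≤ 2 ^ (numLevels m - 1) :=
    Nat.pow_le_pow_right (by norm_num)
      (Nat.sub_le_sub_right (levelAfter_le (one_le_numLevels m) _ _ _) 1)
  exact_mod_cast h3.trans h2

theorem exists_ne_of_two_le (hm : 2 ≤ m) (i : Fin m) : ∃ i' : Fin m, i' ≠ i := by
  have : Nontrivial (Fin m) := Fin.nontrivial_iff_two_le.2 hm
  exact exists_ne i

section

variable {s : Fin m → ℝ} {l : List ℝ} {i : Fin m}

theorem antitoneOn_fractionalLoad (hm : 2 ≤ m) (hl : ∀ y ∈ l, 0 < y) :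
    AntitoneOn (fun t => fractionalLoad (Function.update s i (1 / t)) l i) (Set.Ioi 0) := by
  intro a ha b _ hab
  have ha' : (0 : ℝ) < a := ha
  simp only [fractionalLoad_update (by omega : 0 < m)]
  apply loadAt_mono hm s hl i
  apply Int.log_mono_right
  · have := ha'.trans_le hab; positivity
  · exact one_div_le_one_div_of_le ha' hab

theorem exists_fractionalLoad_eq_zero (hm : 2 ≤ m) :
    ∃ t₀, 0 < t₀ ∧ ∀ t, t₀ < t → fractionalLoad (Function.update s i (1 / t)) l i = 0 := by
  obtain ⟨i', hi'⟩ := exists_ne_of_two_le hm i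
  have h := roundSpeed_pos (s i')
  have hm0 : (0 : ℝ) < m := by positivity
  refine ⟨m / roundSpeed (s i'), by positivity, fun t ht => ?_⟩
  have ht0 : 0 < t := lt_trans (by positivity) ht
  rw [fractionalLoad_update (by omega)]
  refine loadAt_eq_zero hm s l hi' ?_
  have h1 : (2 : ℝ) ^ Int.log 2 (1 / t) ≤ 1 / t := by
    exact_mod_cast Int.zpow_log_le_self one_lt_two (show (0 : ℝ) < 1 / t by positivity)
  calc (2 : ℝ) ^ Int.log 2 (1 / t) * m ≤ 1 / t * m := by gcongr
    _ < roundSpeed (s i') := by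
      rw [div_lt_iff₀ h] at ht
      rw [one_div_mul_eq_div, div_lt_iff₀ ht0]; linarith

theorem integrableOn_fractionalLoad (hm : 2 ≤ m) (hl : ∀ y ∈ l, 0 < y) {b : ℝ} (hb : 0 < b) :
    MeasureTheory.IntegrableOn (fun t => fractionalLoad (Function.update s i (1 / t)) l i)
      (Set.Ioi b) := by
  obtain ⟨t₀, h0, ht₀⟩ := exists_fractionalLoad_eq_zero (s := s) (l := l) (i := i) hm
  have hsub : Set.Ioi b ⊆ Set.Icc b (max b t₀) ∪ Set.Ioi (max b t₀) := fun t ht => by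
    rcases le_or_gt t (max b t₀) with h | h
    · exact Or.inl ⟨le_of_lt ht, h⟩
    · exact Or.inr h
  refine MeasureTheory.IntegrableOn.mono_set (MeasureTheory.IntegrableOn.union ?_ ?_) hsub
  · exact ((antitoneOn_fractionalLoad hm hl).mono fun t ht =>
      hb.trans_le ht.1).integrableOn_isCompact isCompact_Icc
  · refine MeasureTheory.integrableOn_zero.congr_fun (fun t ht => ?_) measurableSet_Ioi
    exact (ht₀ t (lt_of_le_of_lt (le_max_right _ _) ht)).symm

end

/-- The integral identity behind the Archer–Tardos payments. -/
theorem sub_mul_add_integral_le {f : ℝ → ℝ} (hf : AntitoneOn f (Set.Ioi 0))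
    (hi : ∀ b, 0 < b → MeasureTheory.IntegrableOn f (Set.Ioi b)) {a b : ℝ} (ha : 0 < a)
    (hb : 0 < b) :
    (b - a) * f b + ∫ t in Set.Ioi b, f t ≤ ∫ t in Set.Ioi a, f t := by
  have h := intervalIntegral.integral_Ioi_sub_Ioi' (hi a ha) (hi b hb)
  have hint : IntervalIntegrable f MeasureTheory.volume a b :=
    (hf.mono fun t ht => lt_of_lt_of_le (lt_min ha hb) ht.1).intervalIntegrable
  rcases le_total a b with hab | hab
  · have := intervalIntegral.integral_mono_on hab (intervalIntegrable_const (c := f b)) hint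
      (fun u hu => hf (ha.trans_le hu.1) hb hu.2)
    rw [intervalIntegral.integral_const, smul_eq_mul] at this
    linarith
  · have := intervalIntegral.integral_mono_on hab hint.symm (intervalIntegrable_const (c := f b))
      (fun u hu => hf hb (hb.trans_le hu.1) hu.1)
    rw [intervalIntegral.integral_const, smul_eq_mul] at this
    have h2 := intervalIntegral.integral_symm (μ := MeasureTheory.volume) (f := f) a b
    linarith

/-! ### Expectations under independent rounding -/

section Expect

variable {n : ℕ}

theorem map_fst_fullHistory (p : Fin n → ℝ) (a : Fin n → Fin m) :
    (fullHistory p a).map Prod.fst = List.ofFn p := by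
  simp [fullHistory, List.map_ofFn, Function.comp_def]

/-- The history enters only through the reported sizes. The realized assignment therefore has a
product distribution, which is the independence behind the moment computations and the deterministic
payments. -/
theorem levelMechanism_runProb (hm : 2 ≤ m) (s : Fin m → ℝ) (p : Fin n → ℝ) (a : Fin n → Fin m) :
    (levelMechanism m hm).runProb s p a =
      ∏ j : Fin n, fraction s ((List.ofFn p).take j) (p j) (a j) := by
  simp only [OnlineMechanism.runProb, levelMechanism, List.map_take, map_fst_fullHistory]

/-- Under independent rounding, the expectation of a product of functions of the individual
assignments is the product of the expectations. -/
theorem expect_prod (hm : 2 ≤ m) (s : Fin m → ℝ) (p : Fin n → ℝ) (f : Fin n → Fin m → ℝ) :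
    (levelMechanism m hm).expect s p (fun a => ∏ j, f j (a j)) =
      ∏ j : Fin n, ∑ i, fraction s ((List.ofFn p).take j) (p j) i * f j i := by
  rw [OnlineMechanism.expect, Finset.prod_univ_sum, Fintype.piFinset_univ]
  refine Finset.sum_congr rfl fun a _ => ?_
  rw [levelMechanism_runProb, Finset.prod_mul_distrib]

theorem runProb_nonneg (hm : 2 ≤ m) (s : Fin m → ℝ) (p : Fin n → ℝ) (a : Fin n → Fin m) :
    0 ≤ (levelMechanism m hm).runProb s p a :=
  Finset.prod_nonneg fun _ _ => (levelMechanism m hm).prob_nonneg _ _ _ _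

theorem expect_const (hm : 2 ≤ m) (s : Fin m → ℝ) (p : Fin n → ℝ) (c : ℝ) :
    (levelMechanism m hm).expect s p (fun _ => c) = c := by
  have h := expect_prod hm s p (fun _ _ => 1)
  simp only [Finset.prod_const_one, mul_one, fraction_sum (by omega : 0 < m)] at h
  rw [OnlineMechanism.expect] at h ⊢
  rw [← Finset.sum_mul]
  simp only [mul_one] at h
  rw [h, one_mul]

theorem expect_mono (hm : 2 ≤ m) (s : Fin m → ℝ) (p : Fin n → ℝ) {f g : (Fin n → Fin m) → ℝ}
    (h : ∀ a, f a ≤ g a) :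
    (levelMechanism m hm).expect s p f ≤ (levelMechanism m hm).expect s p g :=
  Finset.sum_le_sum fun a _ => mul_le_mul_of_nonneg_left (h a) (runProb_nonneg hm s p a)

theorem expect_apply (hm : 2 ≤ m) (s : Fin m → ℝ) (p : Fin n → ℝ) (j : Fin n) (f : Fin m → ℝ) :
    (levelMechanism m hm).expect s p (fun a => f (a j)) =
      ∑ i, fraction s ((List.ofFn p).take j) (p j) i * f i := by
  classical
  have h := expect_prod hm s p (fun j' i => if j' = j then f i else 1)
  have e : (fun a : Fin n → Fin m => ∏ j', if j' = j then f (a j') else 1) = fun a => f (a j) := by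
    ext a; simp
  rw [e] at h
  rw [h, Finset.prod_eq_single j]
  · simp
  · intro j' _ hj'
    simp [hj', fraction_sum (by omega : 0 < m)]
  · simp

theorem fractionalLoad_ofFn (s : Fin m → ℝ) (p : Fin n → ℝ) (i : Fin m) :
    fractionalLoad s (List.ofFn p) i =
      ∑ j : Fin n, fraction s ((List.ofFn p).take j) (p j) i * p j := by
  rw [fractionalLoad]
  refine Fintype.sum_equiv (finCongr (List.length_ofFn)) _ _ fun j => ?_
  simp
  rfl

theorem expect_load (hm : 2 ≤ m) (s : Fin m → ℝ) (p : Fin n → ℝ) (i : Fin m) :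
    (levelMechanism m hm).expect s p (fun a => load p a i) =
      fractionalLoad s (List.ofFn p) i := by
  have h := fun j => expect_apply hm s p j fun i' => if i' = i then p j else 0
  rw [fractionalLoad_ofFn]
  simp only [mul_ite, mul_zero, Finset.sum_ite_eq', Finset.mem_univ, if_true] at h
  simp only [← h, OnlineMechanism.expect, load, Finset.mul_sum]
  rw [Finset.sum_comm]

end Expect

/-- With true inverse speed a and reported inverse speed b, the expected utility is (b - a) L(b) +
∫_b^∞ L. For antitone L this is at most ∫_a^∞ L, the value at b = a. -/
theorem levelMechanism_machineTruthful (hm : 2 ≤ m) : (levelMechanism m hm).MachineTruthful := by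
  intro n s p hs hp i w hw
  set l := List.ofFn p
  have hl : ∀ y ∈ l, 0 < y := by
    intro y hy
    obtain ⟨j, rfl⟩ := (List.mem_ofFn' _ _).1 hy
    exact hp j
  set f := fun t => fractionalLoad (Function.update s i (1 / t)) l i with hf
  have key : ∀ u, 0 < u → (levelMechanism m hm).machineUtility (Function.update s i u) p i (s i) =
      (1 / u - 1 / s i) * f (1 / u) + ∫ t in Set.Ioi (1 / u), f t := by
    intro u hu
    have e : f (1 / u) = fractionalLoad (Function.update s i u) l i := by simp [hf]
    have h1 := expect_load hm (Function.update s i u) p i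
    have h2 := expect_const hm (Function.update s i u) p
      (levelPay (Function.update s i u) l i)
    have h3 : levelPay (Function.update s i u) l i =
        1 / u * f (1 / u) + ∫ t in Set.Ioi (1 / u), f t := by
      simp only [levelPay, Function.update_self, Function.update_idem, hf]
    have h4 : (levelMechanism m hm).machineUtility (Function.update s i u) p i (s i) =
        (levelMechanism m hm).expect (Function.update s i u) p
          (fun _ => levelPay (Function.update s i u) l i) -
        (levelMechanism m hm).expect (Function.update s i u) p (fun a => load p a i) / s i := by
      have h5 : ∀ a : Fin n → Fin m, (levelMechanism m hm).pay (Function.update s i u)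
          (fullHistory p a) i = levelPay (Function.update s i u) l i := fun a => by
        simp only [levelMechanism, map_fst_fullHistory, l]
      simp only [OnlineMechanism.machineUtility, h5, OnlineMechanism.expect, Finset.sum_div,
        ← Finset.sum_sub_distrib, mul_sub, mul_div_assoc]
    rw [h4, h2, h1, h3, ← e]
    ring
  have h0 := key (s i) (hs i)
  rw [Function.update_eq_self] at h0
  rw [h0, key w hw, sub_self, zero_mul, zero_add]
  have hw' : 0 < 1 / w := by positivity
  have hs' : 0 < 1 / s i := one_div_pos.2 (hs i)
  exact sub_mul_add_integral_le (antitoneOn_fractionalLoad hm hl)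
    (fun b hb => integrableOn_fractionalLoad hm hl hb) hs' hw'

end TwoSidedScheduling

end

noncomputable section

namespace TwoSidedScheduling

variable {m : ℕ}

/-! ### The fractional allocation is `O(log m)`-competitive -/

/-- The total size of the jobs in `l` that are larger than `θ`. -/
def bigWork (θ : ℝ) (l : List ℝ) : ℝ :=
  (l.map fun x => if θ < x then x else 0).sum

theorem bigWork_append (θ : ℝ) (l l' : List ℝ) :
    bigWork θ (l ++ l') = bigWork θ l + bigWork θ l' := by
  simp [bigWork]

theorem bigWork_nonneg (θ : ℝ) {l : List ℝ} (hl : ∀ x ∈ l, 0 < x) : 0 ≤ bigWork θ l := by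
  refine List.sum_nonneg fun y hy => ?_
  obtain ⟨x, hx, rfl⟩ := List.mem_map.1 hy
  split_ifs
  · exact (hl x hx).le
  · exact le_rfl

theorem bigWork_anti {θ θ' : ℝ} (h : θ ≤ θ') {l : List ℝ} (hl : ∀ x ∈ l, 0 < x) :
    bigWork θ' l ≤ bigWork θ l := by
  refine List.sum_le_sum fun x hx => ?_
  have := hl x hx
  split_ifs <;> linarith

theorem fractionalLoad_append_singleton (s : Fin m → ℝ) (l : List ℝ) (x : ℝ) (i : Fin m) :
    fractionalLoad s (l ++ [x]) i = fractionalLoad s l i + fraction s l x i * x := by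
  unfold fractionalLoad
  rw [← Fintype.sum_equiv (finCongr (by simp : l.length + 1 = (l ++ [x]).length))
    (fun j => fraction s ((l ++ [x]).take j) ((l ++ [x])[(j : ℕ)]'(by simp; omega)) i *
      (l ++ [x])[(j : ℕ)]'(by simp; omega)) _ (fun j => by simp), Fin.sum_univ_castSucc]
  congr 1
  · refine Finset.sum_congr rfl fun j _ => ?_
    have h1 : (l ++ [x]).take (j : ℕ) = l.take j := by
      rw [List.take_append_of_le_length j.2.le]
    have h2 : (l ++ [x])[(j : ℕ)]'(by simp) = l[(j : ℕ)] := List.getElem_append_left j.2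
    simp only [Fin.val_castSucc, h1, h2, Fin.getElem_fin]
  · simp

/-- The bound also covers machines that get nothing, so a job of size x and level k can be charged
as rounded speed times x / w_k to every machine alike. -/
theorem fraction_le (hm : 0 < m) (s : Fin m → ℝ) (l : List ℝ) (x : ℝ) (i : Fin m) :
    fraction s l x i * topSpeed s ≤
      roundSpeed (s i) / weight s (levelAfter (numLevels m) (weight s) l x) := by
  have h1 := topSpeed_pos hm s
  have h2 := capacity_pos hm s (one_le_levelAfter (numLevels m) (weight s) l x)
  have h3 := roundSpeed_pos (s i)
  rw [fraction_eq hm, levelFraction, weight, div_div_eq_mul_div]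
  split_ifs
  · rw [div_mul_eq_mul_div]
  · rw [zero_mul]; positivity

theorem one_le_weight (hm : 0 < m) (s : Fin m → ℝ) {k : ℕ} (hk : 1 ≤ k) : 1 ≤ weight s k := by
  rw [weight, one_le_div (topSpeed_pos hm s)]
  exact topSpeed_le_capacity hm s hk

/-- The state after the jobs in `l`, the first of which is `y`. -/
def stateAfter (s : Fin m → ℝ) (y : ℝ) (l : List ℝ) : ℝ × (ℕ → ℝ) :=
  l.foldl (scaledStep (numLevels m) (weight s)) (y, fun _ => 0)

/-- What is known about the state `S` after the jobs in `l` if `G` is the optimum times the top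
speed. -/
structure StateBound (s : Fin m → ℝ) (G : ℝ) (l : List ℝ) (S : ℝ × (ℕ → ℝ)) : Prop where
  pos : 0 < S.1
  le : S.1 ≤ 4 * G
  nonneg : ∀ k, 0 ≤ S.2 k
  time_le : ∀ k, 1 ≤ k → k + 1 ≤ numLevels m → S.2 k ≤ S.1
  work : ∀ k, 1 ≤ k → k + 1 ≤ numLevels m → S.2 k * weight s k ≤ bigWork (S.1 / 2 ^ k) l
  load : ∀ i, fractionalLoad s l i * topSpeed s ≤ roundSpeed (s i) *
    (∑ k ∈ Finset.Icc 1 (numLevels m - 1), S.2 k + (numLevels m + 1) * S.1 +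
      l.sum / weight s (numLevels m))

theorem StateBound.sum_le {s : Fin m → ℝ} {G : ℝ} {l : List ℝ} {S : ℝ × (ℕ → ℝ)}
    (h : StateBound s G l S) :
    ∑ k ∈ Finset.Icc 1 (numLevels m - 1), S.2 k ≤ ((numLevels m : ℝ) - 1) * S.1 := by
  have h1 := one_le_numLevels m
  have := Finset.sum_le_card_nsmul (Finset.Icc 1 (numLevels m - 1)) S.2 S.1 fun k hk => by
    rw [Finset.mem_Icc] at hk
    exact h.time_le k hk.1 (by omega)
  rwa [Nat.card_Icc, Nat.add_sub_cancel, nsmul_eq_mul, Nat.cast_sub h1, Nat.cast_one] at this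

/-- The load is charged in three parts: the times of the current phase, a term (K+1) g that pays for
all finished phases, and the total size over w_K for last-level jobs. When a phase ends, its times
are at most (K-1) g, so at most 2K g + x/w_k has to be covered by (K+1) g' with g' ≥ 2g and g' ≥ x.
The guess cannot pass 4G: a large job brings it below 2x ≤ 4G, and an overflow requires g ≤ 2G. -/
theorem StateBound.step (hm : 2 ≤ m) {s : Fin m → ℝ} {G y : ℝ} {l : List ℝ} {S : ℝ × (ℕ → ℝ)}
    {x : ℝ} (h : StateBound s G (y :: l) S) (hS : stateAfter s y l = S)
    (hpos : ∀ z ∈ y :: l ++ [x], 0 < z) (hx2 : x ≤ 2 * G)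
    (hbig : ∀ k, 1 ≤ k → bigWork (G / 2 ^ (k - 1)) (y :: l ++ [x]) ≤ 2 * G * weight s k) :
    StateBound s G (y :: l ++ [x]) (scaledStep (numLevels m) (weight s) S x) := by
  have hm' : 0 < m := by omega
  have hK := two_le_numLevels hm
  set K := numLevels m with hKdef
  have hx : 0 < x := hpos x (by simp)
  have hpos' : ∀ z ∈ y :: l, 0 < z := fun z hz => hpos z (by
    simp only [List.mem_append]; exact Or.inl hz)
  have hw : ∀ k, 1 ≤ k → 0 < weight s k := fun k => weight_pos hm' s
  have hnn := scaledStep_nonneg (K := K) hw h.pos h.nonneg hx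
  set k := scaledLevel K S.1 x with hk
  have hk1 : 1 ≤ k := one_le_scaledLevel _ _ _
  have hkK : k ≤ K := scaledLevel_le (by omega) _ _
  have hwk := hw k hk1
  have hwK := hw K (by omega)
  have hxw : x / weight s k ≤ x := div_le_self hx.le (one_le_weight hm' s hk1)
  have hxw0 : 0 ≤ x / weight s k := by positivity
  have hK1 : (1 : ℝ) ≤ K := by exact_mod_cast (by omega : 1 ≤ K)
  have hload : ∀ i (B : ℝ), ∑ k ∈ Finset.Icc 1 (K - 1), S.2 k + (K + 1) * S.1 +
      (y :: l).sum / weight s K + x / weight s k ≤ B →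
      fractionalLoad s (y :: l ++ [x]) i * topSpeed s ≤ roundSpeed (s i) * B := by
    intro i B hB
    have h1 := h.load i
    have h2 : fraction s (y :: l) x i * topSpeed s ≤ roundSpeed (s i) / weight s k := by
      have := fraction_le hm' s (y :: l) x i
      rwa [levelAfter, ← stateAfter, hS] at this
    have h3 := roundSpeed_pos (s i)
    rw [fractionalLoad_append_singleton, add_mul]
    calc fractionalLoad s (y :: l) i * topSpeed s + fraction s (y :: l) x i * x * topSpeed s
        ≤ roundSpeed (s i) * (∑ k ∈ Finset.Icc 1 (K - 1), S.2 k + (K + 1) * S.1 +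
          (y :: l).sum / weight s K) + roundSpeed (s i) / weight s k * x := by
          refine add_le_add h1 ?_
          calc fraction s (y :: l) x i * x * topSpeed s
              = fraction s (y :: l) x i * topSpeed s * x := by ring
            _ ≤ _ := by gcongr
      _ = roundSpeed (s i) * (∑ k ∈ Finset.Icc 1 (K - 1), S.2 k + (K + 1) * S.1 +
          (y :: l).sum / weight s K + x / weight s k) := by ring
      _ ≤ _ := by gcongr
  have hsum : (y :: l ++ [x]).sum / weight s K =
      (y :: l).sum / weight s K + x / weight s K := by
    rw [List.sum_append, List.sum_singleton, add_div]
  have hxK0 : 0 ≤ x / weight s K := by positivity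
  have hsumle := h.sum_le
  rw [← hKdef] at hsumle
  have hg := h.pos
  have hupd : ∀ j, j ≠ k → Function.update S.2 k (S.2 k + x / weight s k) j = S.2 j :=
    fun j hj => Function.update_of_ne hj _ _
  -- A job filed under a level k < K is larger than g/2^k, so it counts in full as big work.
  have hwork : k + 1 ≤ K →
      (S.2 k + x / weight s k) * weight s k ≤ bigWork (S.1 / 2 ^ k) (y :: l ++ [x]) := by
    intro hkK'
    rw [bigWork_append, add_mul, div_mul_cancel₀ _ hwk.ne']
    refine add_le_add (h.work k hk1 hkK') ?_
    have : S.1 / 2 ^ k < x := lt_of_scaledLevel_lt hkK'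
    simp [bigWork, this]
  have hbig0 : ∀ θ, 0 ≤ bigWork θ (y :: l ++ [x]) := fun θ => bigWork_nonneg θ hpos
  rcases scaledStep_cases (A := weight s) (rfl : scaledLevel K S.1 x = _) with
    ⟨a1, a2⟩ | ⟨a1, a2, a3⟩ | ⟨a1, a2, a3, a4⟩ | ⟨a1, a2, a3, a4⟩
  · rw [a2] at hnn ⊢
    rw [← hk] at hnn a1 ⊢
    have hkeq : k = K := by omega
    refine ⟨hg, h.le, hnn.2, fun j hj hjK => ?_, fun j hj hjK => ?_, fun i => ?_⟩
    · dsimp only; rw [hupd j (by omega)]; exact h.time_le j hj hjK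
    · dsimp only; rw [hupd j (by omega), bigWork_append]
      have : 0 ≤ bigWork (S.1 / 2 ^ j) [x] := bigWork_nonneg _ (by simpa using hx)
      linarith [h.work j hj hjK]
    · refine hload i _ ?_
      rw [hsum, Finset.sum_congr rfl (g := S.2) (fun j hj => hupd j (by
        rw [Finset.mem_Icc] at hj; omega)), hkeq]
      linarith
  · rw [a3] at hnn ⊢
    have h2 := le_doubling hg a2
    have h3 := doubling_lt hg a2
    have h4 := doubling_spec (y := x) hg
    refine ⟨hnn.1, by dsimp only; linarith, hnn.2, fun j hj hjK => hnn.1.le,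
      fun j hj hjK => by simpa using hbig0 _, fun i => hload i _ ?_⟩
    dsimp only
    rw [hsum, Finset.sum_const_zero]
    nlinarith
  · rw [a4] at hnn ⊢
    rw [← hk] at a1 a3
    -- Otherwise G/2^(k-1) ≤ g/2^k, so the work counted at level k is at most 2G w_k. Then the level
    -- time including the new job is at most 2G < g and does not overflow.
    have hG : S.1 ≤ 2 * G := by
      by_contra hc
      push Not at hc
      have h1 := hwork (by omega)
      have h2 : G / 2 ^ (k - 1) ≤ S.1 / 2 ^ k := by
        obtain ⟨j, hj⟩ := Nat.exists_eq_add_of_le' hk1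
        rw [hj, Nat.add_sub_cancel, pow_succ, div_le_div_iff₀ (by positivity) (by positivity)]
        have : (0 : ℝ) < 2 ^ j := by positivity
        nlinarith
      have h3 := (h1.trans (bigWork_anti h2 hpos)).trans (hbig k hk1)
      have h4 := le_of_mul_le_mul_right h3 hwk
      linarith
    refine ⟨hnn.1, by dsimp only; linarith, hnn.2, fun j hj hjK => hnn.1.le,
      fun j hj hjK => by simpa using hbig0 _, fun i => hload i _ ?_⟩
    dsimp only
    rw [hsum, Finset.sum_const_zero]
    nlinarith
  · rw [a4] at hnn ⊢
    rw [← hk] at hnn a1 a3 ⊢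
    refine ⟨hg, h.le, hnn.2, fun j hj hjK => ?_, fun j hj hjK => ?_, fun i => ?_⟩
    · dsimp only
      rw [Function.update_apply]
      split_ifs
      · exact a3
      · exact h.time_le j hj hjK
    · dsimp only
      by_cases hjk : j = k
      · rw [hjk, Function.update_self]
        exact hwork (by omega)
      · rw [hupd j hjk, bigWork_append]
        have : 0 ≤ bigWork (S.1 / 2 ^ j) [x] := bigWork_nonneg _ (by simpa using hx)
        linarith [h.work j hj hjK]
    · refine hload i _ ?_
      dsimp only
      have hmem : k ∈ Finset.Icc 1 (K - 1) := by rw [Finset.mem_Icc]; omega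
      rw [hsum, Finset.sum_update_of_mem hmem, ← Finset.add_sum_erase _ _ hmem,
        Finset.sdiff_singleton_eq_erase]
      linarith

theorem stateBound (hm : 2 ≤ m) {s : Fin m → ℝ} {G y : ℝ} (l : List ℝ)
    (hpos : ∀ z ∈ y :: l, 0 < z) (hle : ∀ z ∈ y :: l, z ≤ 2 * G)
    (hbig : ∀ k, 1 ≤ k → bigWork (G / 2 ^ (k - 1)) (y :: l) ≤ 2 * G * weight s k) :
    StateBound s G (y :: l) (stateAfter s y l) := by
  have hm' : 0 < m := by omega
  induction l using List.reverseRecOn with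
  | nil =>
    have hy : 0 < y := hpos y (by simp)
    have hy2 : y ≤ 2 * G := hle y (by simp)
    refine ⟨hy, ?_, fun _ => le_rfl, fun _ _ _ => hy.le, fun k _ _ => ?_, fun i => ?_⟩
    · change y ≤ 4 * G; linarith
    · simpa [stateAfter] using bigWork_nonneg _ hpos
    · have h1 := fraction_le hm' s [] y i
      have h2 := roundSpeed_pos (s i)
      have h3 := weight_pos hm' s (one_le_numLevels m)
      have h4 := one_le_weight hm' s (le_refl 1)
      have h5 : (1 : ℝ) ≤ numLevels m := by exact_mod_cast one_le_numLevels m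
      have e : fractionalLoad s [y] i = fraction s [] y i * y := by
        simp [fractionalLoad]
      rw [e]
      simp only [stateAfter, List.foldl_nil, Finset.sum_const_zero, List.sum_singleton, zero_add]
      have h6 : 0 ≤ y / weight s (numLevels m) := by positivity
      have h7 : roundSpeed (s i) / weight s 1 ≤ roundSpeed (s i) := div_le_self h2.le h4
      calc fraction s [] y i * y * topSpeed s = fraction s [] y i * topSpeed s * y := by ring
        _ ≤ roundSpeed (s i) * y := by gcongr; exact h1.trans h7
        _ ≤ _ := by gcongr; nlinarith
  | append_singleton l x ih =>
    have hsub : ∀ z ∈ y :: l, z ∈ y :: (l ++ [x]) := by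
      intro z hz
      rw [← List.cons_append, List.mem_append]
      exact Or.inl hz
    have ih' := ih (fun z hz => hpos z (hsub z hz)) (fun z hz => hle z (hsub z hz)) fun k hk => by
      refine le_trans ?_ (hbig k hk)
      rw [← List.cons_append, bigWork_append]
      have : 0 ≤ bigWork (G / 2 ^ (k - 1)) [x] :=
        bigWork_nonneg _ (by simpa using hpos x (by simp))
      linarith
    have := ih'.step hm rfl (x := x) (by simpa using hpos) (hle x (by simp)) (by simpa using hbig)
    rw [List.cons_append] at this
    convert this using 1
    simp [stateAfter]

/-! ### Comparison with the optimum -/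

section Opt

variable {n : ℕ}

theorem load_nonneg {p : Fin n → ℝ} (hp : ∀ j, 0 < p j) (a : Fin n → Fin m) (i : Fin m) :
    0 ≤ load p a i :=
  Finset.sum_nonneg fun j _ => by have := hp j; split_ifs <;> linarith

theorem exists_load_le_opt (hm : 0 < m) {s : Fin m → ℝ} (hs : ∀ i, 0 < s i) (p : Fin n → ℝ) :
    ∃ a : Fin n → Fin m, ∀ i, load p a i ≤ opt s p * s i := by
  have : Nonempty (Fin m) := ⟨⟨0, hm⟩⟩
  obtain ⟨a, ha⟩ := exists_eq_ciInf_of_finite (f := fun a : Fin n → Fin m => makespan s p a)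
  refine ⟨a, fun i => ?_⟩
  rw [← div_le_iff₀ (hs i), opt, ← ha]
  exact le_ciSup (f := fun i => load p a i / s i) (Set.finite_range _).bddAbove i

theorem opt_nonneg {s : Fin m → ℝ} (hs : ∀ i, 0 < s i) {p : Fin n → ℝ} (hp : ∀ j, 0 < p j) :
    0 ≤ opt s p :=
  Real.iInf_nonneg fun a => Real.iSup_nonneg fun i => div_nonneg (load_nonneg hp a i) (hs i).le

theorem size_le_opt {s : Fin m → ℝ} {p : Fin n → ℝ}
    (hp : ∀ j, 0 < p j) {a : Fin n → Fin m} (ha : ∀ i, load p a i ≤ opt s p * s i) (j : Fin n) :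
    p j ≤ opt s p * s (a j) := by
  refine le_trans ?_ (ha (a j))
  rw [load]
  refine le_trans ?_ (Finset.single_le_sum (f := fun j' => if a j' = a j then p j' else 0)
    (fun j' _ => ?_) (Finset.mem_univ j))
  · simp
  · have := hp j'; split_ifs <;> linarith

theorem opt_pos (hm : 0 < m) {s : Fin m → ℝ} (hs : ∀ i, 0 < s i) {p : Fin n → ℝ}
    (hp : ∀ j, 0 < p j) (j : Fin n) : 0 < opt s p := by
  obtain ⟨a, ha⟩ := exists_load_le_opt hm hs p
  have h1 := (hp j).trans_le (size_le_opt hp ha j)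
  exact pos_of_mul_pos_left h1 (hs _).le

theorem size_le_topSpeed (hm : 0 < m) {s : Fin m → ℝ} (hs : ∀ i, 0 < s i) {p : Fin n → ℝ}
    (hp : ∀ j, 0 < p j) (j : Fin n) : p j ≤ 2 * (opt s p * topSpeed s) := by
  obtain ⟨a, ha⟩ := exists_load_le_opt hm hs p
  have h1 := size_le_opt hp ha j
  have h2 := lt_two_mul_roundSpeed (s (a j))
  have h3 := roundSpeed_le_topSpeed s (a j)
  have h4 := opt_nonneg hs hp
  nlinarith

/-- The jobs that are too large for the machines outside the first `k` groups fit into these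
groups. -/
theorem bigWork_le (hm : 0 < m) {s : Fin m → ℝ} (hs : ∀ i, 0 < s i) {p : Fin n → ℝ}
    (hp : ∀ j, 0 < p j) {k : ℕ} (hk : 1 ≤ k) :
    bigWork (opt s p * topSpeed s / 2 ^ (k - 1)) (List.ofFn p) ≤
      2 * (opt s p * topSpeed s) * weight s k := by
  obtain ⟨a, ha⟩ := exists_load_le_opt hm hs p
  have hO := opt_nonneg hs hp
  have hR := topSpeed_pos hm s
  have e : 2 * (opt s p * topSpeed s) * weight s k = 2 * opt s p * capacity s k := by
    rw [weight]; field_simp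
  rw [e, capacity, Finset.mul_sum, bigWork, List.map_ofFn, List.sum_ofFn]
  have h1 : ∀ j : Fin n, (if opt s p * topSpeed s / 2 ^ (k - 1) < p j then p j else 0) ≤
      ∑ i ∈ groupsUpTo s k, if a j = i then p j else 0 := by
    intro j
    rw [Finset.sum_ite_eq]
    split_ifs with h1 h2 h2
    · exact le_rfl
    · exfalso
      rw [mem_groupsUpTo hm s hk, levelSpeed, roundSpeed] at h2
      have h3 := h1.trans_le (size_le_opt hp ha j)
      rw [mul_div_assoc] at h3
      -- A machine that can finish the job within the optimum has true speed above r_k. As r_k is a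
      -- power of two, rounding down keeps the speed at least r_k.
      have h4 : topSpeed s / 2 ^ (k - 1) < s (a j) := lt_of_mul_lt_mul_left h3 hO
      obtain ⟨i₀, h₀⟩ := exists_topSpeed_eq hm s
      have h5 : topSpeed s / 2 ^ (k - 1) = 2 ^ (Int.log 2 (s i₀) - ((k - 1 : ℕ) : ℤ)) := by
        rw [← h₀, roundSpeed, zpow_sub₀ (by norm_num), zpow_natCast]
      rw [h5] at h2 h4
      exact h2 ((zpow_le_roundSpeed_iff (hs _)).2 h4.le)
    · exact (hp j).le
    · exact le_rfl
  calc ∑ j, ((fun x => if opt s p * topSpeed s / 2 ^ (k - 1) < x then x else 0) ∘ p) j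
      ≤ ∑ j, ∑ i ∈ groupsUpTo s k, (if a j = i then p j else 0) :=
        Finset.sum_le_sum fun j _ => h1 j
    _ = ∑ i ∈ groupsUpTo s k, load p a i := Finset.sum_comm
    _ ≤ _ := Finset.sum_le_sum fun i _ => by
      have h2 := lt_two_mul_roundSpeed (s i)
      have h3 := ha i
      nlinarith

/-- Each ignored machine is slower than r_K, which is at most 2R/m. Together the ignored machines
have speed at most 2R, and R is at most the capacity kept. -/
theorem sum_roundSpeed_le (hm : 0 < m) (s : Fin m → ℝ) :
    ∑ i, roundSpeed (s i) ≤ 3 * capacity s (numLevels m) := by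
  have hR := topSpeed_pos hm s
  have hm0 : (0 : ℝ) < m := by exact_mod_cast hm
  have h1 : ∀ i, roundSpeed (s i) ≤ (if levelSpeed s (numLevels m) ≤ roundSpeed (s i) then
      roundSpeed (s i) else 0) + 2 * topSpeed s / m := by
    intro i
    split_ifs with h
    · have : 0 ≤ 2 * topSpeed s / m := by positivity
      linarith
    · rw [zero_add]
      refine (not_le.1 h).le.trans ?_
      rw [levelSpeed, div_le_div_iff₀ (by positivity) hm0]
      have h2 : m ≤ 2 * 2 ^ (numLevels m - 1) := by
        have := Nat.lt_pow_succ_log_self one_lt_two m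
        rw [pow_succ] at this
        simp only [numLevels, Nat.add_sub_cancel]
        omega
      have h3 : (m : ℝ) ≤ 2 * 2 ^ (numLevels m - 1) := by exact_mod_cast h2
      nlinarith
  have h2 := Finset.sum_le_sum fun i (_ : i ∈ Finset.univ) => h1 i
  rw [Finset.sum_add_distrib, ← capacity_eq_sum hm s (one_le_numLevels m), Finset.sum_const,
    Finset.card_univ, Fintype.card_fin, nsmul_eq_mul, mul_div_cancel₀ _ hm0.ne'] at h2
  linarith [topSpeed_le_capacity hm s (one_le_numLevels m)]

/-- The volume is at most OPT times the sum of the true speeds; rounding costs a factor 2 and the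
ignored machines a factor 3. -/
theorem sum_size_le (hm : 0 < m) {s : Fin m → ℝ} (hs : ∀ i, 0 < s i) {p : Fin n → ℝ}
    (hp : ∀ j, 0 < p j) :
    (List.ofFn p).sum / weight s (numLevels m) ≤ 6 * (opt s p * topSpeed s) := by
  obtain ⟨a, ha⟩ := exists_load_le_opt hm hs p
  have hO := opt_nonneg hs hp
  have hR := topSpeed_pos hm s
  have hc := capacity_pos hm s (one_le_numLevels m)
  have h1 : ∑ j, p j ≤ 2 * opt s p * (3 * capacity s (numLevels m)) := by
    calc ∑ j, p j = ∑ j, ∑ i, (if a j = i then p j else 0) := by simp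
      _ = ∑ i, load p a i := Finset.sum_comm
      _ ≤ ∑ i, 2 * opt s p * roundSpeed (s i) := Finset.sum_le_sum fun i _ => by
        have h2 := lt_two_mul_roundSpeed (s i)
        have h3 := ha i
        nlinarith
      _ = 2 * opt s p * ∑ i, roundSpeed (s i) := by rw [Finset.mul_sum]
      _ ≤ _ := by gcongr; exact sum_roundSpeed_le hm s
  rw [List.sum_ofFn, weight, div_div_eq_mul_div, div_le_iff₀ hc]
  nlinarith

/-- A prefix is measured against the optimum of the whole instance: its jobs and its big work are
among those of the full list. -/
theorem stateBound_take (hm : 2 ≤ m) {s : Fin m → ℝ} (hs : ∀ i, 0 < s i) {p : Fin n → ℝ}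
    (hp : ∀ j, 0 < p j) {y : ℝ} {l l' : List ℝ} (h : List.ofFn p = y :: l ++ l') :
    StateBound s (opt s p * topSpeed s) (y :: l) (stateAfter s y l) := by
  have hm' : 0 < m := by omega
  have hmem : ∀ z ∈ List.ofFn p, 0 < z ∧ z ≤ 2 * (opt s p * topSpeed s) := by
    intro z hz
    obtain ⟨j, rfl⟩ := (List.mem_ofFn' _ _).1 hz
    exact ⟨hp j, size_le_topSpeed hm' hs hp j⟩
  rw [h] at hmem
  refine stateBound hm l (fun z hz => (hmem z (List.mem_append_left _ hz)).1)
    (fun z hz => (hmem z (List.mem_append_left _ hz)).2) fun k hk => ?_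
  have h1 := bigWork_le hm' hs hp hk
  rw [h, bigWork_append] at h1
  have := bigWork_nonneg (opt s p * topSpeed s / 2 ^ (k - 1))
    (fun z hz => (hmem z (List.mem_append_right _ hz)).1)
  linarith

/-- The fractional load of a machine is `O(log m)` times the optimum. -/
theorem fractionalLoad_le (hm : 2 ≤ m) {s : Fin m → ℝ} (hs : ∀ i, 0 < s i) {p : Fin n → ℝ}
    (hp : ∀ j, 0 < p j) (i : Fin m) :
    fractionalLoad s (List.ofFn p) i ≤ roundSpeed (s i) * (opt s p * (8 * numLevels m + 6)) := by
  have hm' : 0 < m := by omega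
  have hO := opt_nonneg hs hp
  have hr := roundSpeed_pos (s i)
  have hR := topSpeed_pos hm' s
  cases hl : List.ofFn p with
  | nil => simp only [fractionalLoad, List.length_nil, Finset.univ_eq_empty, Finset.sum_empty]; positivity
  | cons y l =>
    have h := stateBound_take hm hs hp (l' := []) (by rw [List.append_nil]; exact hl)
    have h1 := h.load i
    have h2 := h.sum_le
    have h3 := sum_size_le hm' hs hp
    rw [hl] at h3
    have h4 := h.le
    have h5 : (0 : ℝ) ≤ numLevels m := by positivity
    refine le_of_mul_le_mul_right (h1.trans ?_) hR
    -- The current times give (K-1) g, the finished phases (K+1) g and the last level 6G. With g ≤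
    -- 4G the sum is (8K + 6) G.
    have h6 : (numLevels m : ℝ) * (stateAfter s y l).1 ≤
        numLevels m * (4 * (opt s p * topSpeed s)) := by gcongr
    calc _ ≤ roundSpeed (s i) * (opt s p * topSpeed s * (8 * numLevels m + 6)) := by
          gcongr; linarith
      _ = _ := by ring

/-- A job that may be assigned to machine `i` is not much larger than the optimum allows there. -/
theorem size_le_of_fraction_ne_zero (hm : 2 ≤ m) {s : Fin m → ℝ} (hs : ∀ i, 0 < s i)
    {p : Fin n → ℝ} (hp : ∀ j, 0 < p j) (j : Fin n) {i : Fin m}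
    (h : fraction s ((List.ofFn p).take j) (p j) i ≠ 0) :
    p j ≤ 4 * (opt s p * roundSpeed (s i)) := by
  have hm' : 0 < m := by omega
  have hO := opt_nonneg hs hp
  have hr := roundSpeed_pos (s i)
  have h1 := size_le_topSpeed hm' hs hp j
  rw [fraction_eq hm', levelFraction] at h
  have hlev : levelSpeed s (levelAfter (numLevels m) (weight s) ((List.ofFn p).take j) (p j)) ≤
      roundSpeed (s i) := by
    by_contra hc
    exact h (if_neg hc)
  cases hl : (List.ofFn p).take j with
  | nil =>
    -- At level 1 no size threshold is available, but machine i then has top speed and every job has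
    -- size at most 2G.
    rw [hl, levelAfter, levelSpeed_one] at hlev
    nlinarith
  | cons y l =>
    have hb := stateBound_take hm hs hp (y := y) (l := l) (l' := (List.ofFn p).drop j)
      (by rw [← hl, List.take_append_drop])
    rw [hl, levelAfter, ← stateAfter] at hlev
    rcases scaledLevel_mem (numLevels m) (stateAfter s y l).1 (p j) with h2 | h2
    · rw [h2, levelSpeed_one] at hlev
      nlinarith
    · refine h2.trans ?_
      have h3 : (stateAfter s y l).1 / 2 ^ (scaledLevel (numLevels m) (stateAfter s y l).1 (p j) - 1)
          ≤ 4 * (opt s p * topSpeed s) /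
            2 ^ (scaledLevel (numLevels m) (stateAfter s y l).1 (p j) - 1) := by
        gcongr
        exact hb.le
      refine h3.trans ?_
      rw [levelSpeed] at hlev
      rw [mul_div_assoc, mul_div_assoc]
      gcongr

/-! ### Concentration -/

theorem exp_le_one_add_two_mul {y : ℝ} (h0 : 0 ≤ y) (h1 : y ≤ 1) : Real.exp y ≤ 1 + 2 * y := by
  have := Real.abs_exp_sub_one_sub_id_le (x := y) (by rw [abs_of_nonneg h0]; exact h1)
  have := (abs_le.1 this).2
  nlinarith

/-- The exponential moment of the load of a machine. -/
theorem expect_exp_load_le (hm : 2 ≤ m) {s : Fin m → ℝ} (hs : ∀ i, 0 < s i) {p : Fin n → ℝ}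
    (hp : ∀ j, 0 < p j) (hO : 0 < opt s p) (i : Fin m) :
    (levelMechanism m hm).expect s p
      (fun a => Real.exp (load p a i / (4 * (opt s p * roundSpeed (s i))))) ≤
      Real.exp (4 * numLevels m + 3) := by
  have hr := roundSpeed_pos (s i)
  set D := 4 * (opt s p * roundSpeed (s i)) with hD
  have hD0 : 0 < D := by positivity
  have e : (fun a : Fin n → Fin m => Real.exp (load p a i / D)) =
      fun a => ∏ j, (fun j i' => if i' = i then Real.exp (p j / D) else 1) j (a j) := by
    ext a
    rw [load, Finset.sum_div, Real.exp_sum]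
    refine Finset.prod_congr rfl fun j _ => ?_
    dsimp only
    split_ifs <;> simp
  rw [e, expect_prod hm s p fun j i' => if i' = i then Real.exp (p j / D) else 1]
  have h1 : ∀ j : Fin n, ∑ i', fraction s ((List.ofFn p).take j) (p j) i' *
      (if i' = i then Real.exp (p j / D) else 1) ≤
      Real.exp (2 * (fraction s ((List.ofFn p).take j) (p j) i * p j / D)) := by
    intro j
    set x := fraction s ((List.ofFn p).take j) (p j) with hx
    have hx0 : 0 ≤ x i := fraction_nonneg _ _ _ _
    have hsum : ∑ i', x i' * (if i' = i then Real.exp (p j / D) else 1) =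
        1 + x i * (Real.exp (p j / D) - 1) := by
      have h2 : ∀ i', x i' * (if i' = i then Real.exp (p j / D) else 1) =
          x i' + if i' = i then x i * (Real.exp (p j / D) - 1) else 0 := by
        intro i'
        split_ifs with h
        · rw [h]; ring
        · ring
      simp only [h2, Finset.sum_add_distrib, Finset.sum_ite_eq', Finset.mem_univ, if_true]
      rw [hx, fraction_sum (by omega)]
    rw [hsum]
    -- The bound p_j ≤ D holds only for machines that may receive the job; for the others the factor
    -- is 1.
    by_cases h0 : x i = 0
    · simp [h0]
    · have h2 : p j ≤ D := size_le_of_fraction_ne_zero hm hs hp j h0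
      have h3 := exp_le_one_add_two_mul (div_nonneg (hp j).le hD0.le) ((div_le_one hD0).2 h2)
      have h4 := Real.add_one_le_exp (2 * (x i * p j / D))
      calc 1 + x i * (Real.exp (p j / D) - 1) ≤ 1 + x i * (2 * (p j / D)) := by
            gcongr; linarith
        _ = 2 * (x i * p j / D) + 1 := by ring
        _ ≤ _ := h4
  calc _ ≤ ∏ j : Fin n, Real.exp (2 * (fraction s ((List.ofFn p).take j) (p j) i * p j / D)) :=
        Finset.prod_le_prod (fun j _ => Finset.sum_nonneg fun i' _ => mul_nonneg
          (fraction_nonneg _ _ _ _) (by split_ifs <;> positivity)) fun j _ => h1 j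
    _ = Real.exp (2 * (fractionalLoad s (List.ofFn p) i / D)) := by
      rw [← Real.exp_sum, ← Finset.mul_sum, ← Finset.sum_div, ← fractionalLoad_ofFn]
    _ ≤ _ := by
      -- The exponent is 2 (8K + 6) / 4 = 4K + 3.
      rw [Real.exp_le_exp, ← mul_div_assoc, div_le_iff₀ hD0, hD]
      have := fractionalLoad_le hm hs hp i
      linarith

theorem makespan_le {s : Fin m → ℝ} (hm : 0 < m) (hs : ∀ i, 0 < s i) {p : Fin n → ℝ}
    (hp : ∀ j, 0 < p j) (a : Fin n → Fin m) {B : ℝ} (hB : ∀ i, load p a i ≤ roundSpeed (s i) * B) :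
    makespan s p a ≤ B := by
  have : Nonempty (Fin m) := ⟨⟨0, hm⟩⟩
  refine ciSup_le fun i => ?_
  have h1 := roundSpeed_pos (s i)
  have h2 := (load_nonneg hp a i).trans (hB i)
  have hB0 : 0 ≤ B := nonneg_of_mul_nonneg_right h2 h1
  rw [div_le_iff₀ (hs i)]
  refine (hB i).trans ?_
  rw [mul_comm]
  gcongr
  exact roundSpeed_le (hs i)

/-- Since log 2 > 0.69 and m ≥ 2, both constants and K are absorbed into multiples of log m. -/
theorem numLevels_le_log (hm : 2 ≤ m) :
    (69 / 100 : ℝ) ≤ Real.log m ∧ 69 / 100 * (numLevels m : ℝ) ≤ 2 * Real.log m := by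
  have h1 : Real.log 2 ≤ Real.log m :=
    Real.log_le_log (by norm_num) (by exact_mod_cast hm)
  have h2 := Real.log_two_gt_d9
  have h3 : (2 : ℝ) ^ Nat.log 2 m ≤ m := by exact_mod_cast Nat.pow_log_le_self 2 (by omega)
  have h4 := Real.log_le_log (by positivity) h3
  rw [Real.log_pow] at h4
  have h5 : (0 : ℝ) ≤ Nat.log 2 m := by positivity
  refine ⟨by linarith, ?_⟩
  rw [numLevels]
  push_cast
  nlinarith

/-- The total exponential moment, normalized. -/
def excess (s : Fin m → ℝ) (p : Fin n → ℝ) (θ : ℝ) (a : Fin n → Fin m) : ℝ :=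
  ∑ i, Real.exp (load p a i / (4 * (opt s p * roundSpeed (s i)))) * Real.exp (-θ)

theorem expect_excess_le (hm : 2 ≤ m) {s : Fin m → ℝ} (hs : ∀ i, 0 < s i) {p : Fin n → ℝ}
    (hp : ∀ j, 0 < p j) (hO : 0 < opt s p) (θ : ℝ) :
    (levelMechanism m hm).expect s p (excess s p θ) ≤
      Real.exp (Real.log m + (4 * numLevels m + 3) - θ) := by
  have h1 : (levelMechanism m hm).expect s p (excess s p θ) =
      ∑ i, (levelMechanism m hm).expect s p
        (fun a => Real.exp (load p a i / (4 * (opt s p * roundSpeed (s i))))) * Real.exp (-θ) := by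
    simp only [OnlineMechanism.expect, excess, Finset.mul_sum, Finset.sum_mul]
    rw [Finset.sum_comm]
    simp only [mul_assoc]
  rw [h1, sub_eq_add_neg, Real.exp_add, Real.exp_add, Real.exp_log (by positivity)]
  calc _ ≤ ∑ i : Fin m, Real.exp (4 * numLevels m + 3) * Real.exp (-θ) :=
        Finset.sum_le_sum fun i _ => by
          gcongr
          exact expect_exp_load_le hm hs hp hO i
    _ = _ := by simp; ring

/-- For each machine the normalized load y satisfies y - θ ≤ exp (y - θ), and a single exponential
is at most the sum. This replaces a tail integration for the expectation. -/
theorem makespan_le_excess (hm : 2 ≤ m) {s : Fin m → ℝ} (hs : ∀ i, 0 < s i) {p : Fin n → ℝ}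
    (hp : ∀ j, 0 < p j) (hO : 0 < opt s p) (θ : ℝ) (a : Fin n → Fin m) :
    makespan s p a ≤ 4 * opt s p * (θ + excess s p θ a) := by
  refine makespan_le (by omega) hs hp a fun i => ?_
  have hr := roundSpeed_pos (s i)
  have h1 : load p a i / (4 * (opt s p * roundSpeed (s i))) - θ ≤ excess s p θ a := by
    have h2 := Real.add_one_le_exp (load p a i / (4 * (opt s p * roundSpeed (s i))) - θ)
    have h3 := Finset.single_le_sum (f := fun i => Real.exp (load p a i /
      (4 * (opt s p * roundSpeed (s i)))) * Real.exp (-θ)) (fun i _ => by positivity)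
      (Finset.mem_univ i)
    rw [sub_eq_add_neg, Real.exp_add] at h2
    simp only [excess]
    linarith
  rw [sub_le_iff_le_add, div_le_iff₀ (by positivity)] at h1
  linarith

theorem opt_of_isEmpty (s : Fin m → ℝ) (p : Fin 0 → ℝ) : opt s p = 0 := by
  simp [opt, makespan, load]

/-- The competitive ratio, in expectation and with high probability. -/
theorem levelMechanism_competitive (hm : 2 ≤ m) {s : Fin m → ℝ} {p : Fin n → ℝ}
    (hs : ∀ i, 0 < s i) (hp : ∀ j, 0 < p j) :
    (levelMechanism m hm).expect s p (makespan s p) ≤ 100 * Real.log m * opt s p ∧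
    1 - 1 / (m : ℝ) ^ 2 ≤ (levelMechanism m hm).probOf s p
      {a | makespan s p a ≤ 100 * Real.log m * opt s p} := by
  obtain ⟨hlog, hK⟩ := numLevels_le_log hm
  have hm0 : (0 : ℝ) < m := by positivity
  rcases n with _ | n
  · have h0 : ∀ a : Fin 0 → Fin m, makespan s p a = 0 := fun a => by simp [makespan, load]
    rw [opt_of_isEmpty, mul_zero]
    constructor
    · have : makespan s p = fun _ => 0 := funext h0
      rw [this, expect_const]
    · have : {a : Fin 0 → Fin m | makespan s p a ≤ 0} = Set.univ := by
        ext a; simp [h0]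
      rw [this, OnlineMechanism.probOf, Set.indicator_univ, expect_const]
      have : 0 ≤ 1 / (m : ℝ) ^ 2 := by positivity
      linarith
  have hO := opt_pos (by omega : 0 < m) hs hp 0
  constructor
  -- This θ makes the expected excess at most 1.
  · set θ := Real.log m + (4 * numLevels m + 3) with hθ
    have h1 := expect_mono hm s p (makespan_le_excess hm hs hp hO θ)
    have h2 := expect_excess_le hm hs hp hO θ
    rw [← hθ, sub_self, Real.exp_zero] at h2
    have h3 : (levelMechanism m hm).expect s p
        (fun a => 4 * opt s p * (θ + excess s p θ a)) =
        4 * opt s p * (θ + (levelMechanism m hm).expect s p (excess s p θ)) := by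
      have h4 := expect_const hm s p θ
      simp only [OnlineMechanism.expect] at h4 ⊢
      rw [← h4, ← Finset.sum_add_distrib, Finset.mul_sum]
      refine Finset.sum_congr rfl fun a _ => ?_
      rw [h4]; ring
    rw [h3] at h1
    refine h1.trans ?_
    -- By `numLevels_le_log`, log m + 4K + 4 is below 25 log m.
    calc 4 * opt s p * (θ + (levelMechanism m hm).expect s p (excess s p θ))
        ≤ 4 * opt s p * (25 * Real.log m) := by gcongr; linarith
      _ = _ := by ring
  -- The same factor 25 leaves enough room for the expected excess to be at most m^(-2), and 4 · 25
  -- = 100.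
  · set θ := 25 * Real.log m with hθ
    have h2 := expect_excess_le hm hs hp hO θ
    have h3 : Real.exp (Real.log m + (4 * numLevels m + 3) - θ) ≤ 1 / (m : ℝ) ^ 2 := by
      have : (1 / (m : ℝ) ^ 2) = Real.exp (-(2 * Real.log m)) := by
        rw [Real.exp_neg, two_mul, Real.exp_add, Real.exp_log hm0, one_div, sq]
      rw [this, Real.exp_le_exp]
      linarith
    have h4 : ∀ a : Fin (n + 1) → Fin m, (1 : ℝ) ≤
        {a | makespan s p a ≤ 100 * Real.log m * opt s p}.indicator (fun _ => (1 : ℝ)) a +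
          excess s p θ a := by
      intro a
      have hnn : 0 ≤ excess s p θ a := Finset.sum_nonneg fun i _ => by positivity
      by_cases ha : makespan s p a ≤ 100 * Real.log m * opt s p
      · rw [Set.indicator_of_mem (by exact ha)]; linarith
      · rw [Set.indicator_of_notMem (by exact ha), zero_add]
        -- Markov's inequality: if the excess is below 1, each of its exponentials has negative
        -- exponent, so every load obeys the bound.
        by_contra hc
        push Not at hc
        refine ha (makespan_le (by omega) hs hp a fun i => ?_)
        have hr := roundSpeed_pos (s i)
        have h5 := Finset.single_le_sum (f := fun i => Real.exp (load p a i /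
          (4 * (opt s p * roundSpeed (s i)))) * Real.exp (-θ)) (fun i _ => by positivity)
          (Finset.mem_univ i)
        have h6 : Real.exp (load p a i / (4 * (opt s p * roundSpeed (s i))) + -θ) < 1 := by
          rw [Real.exp_add]; exact lt_of_le_of_lt h5 hc
        rw [Real.exp_lt_one_iff, ← sub_eq_add_neg, sub_neg, div_lt_iff₀ (by positivity)] at h6
        rw [hθ] at h6
        linarith
    have h5 := expect_mono hm s p h4
    rw [expect_const] at h5
    have h6 : (levelMechanism m hm).expect s p (fun a =>
        {a | makespan s p a ≤ 100 * Real.log m * opt s p}.indicator (fun _ => (1 : ℝ)) a +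
          excess s p θ a) = (levelMechanism m hm).probOf s p
          {a | makespan s p a ≤ 100 * Real.log m * opt s p} +
          (levelMechanism m hm).expect s p (excess s p θ) := by
      simp only [OnlineMechanism.probOf, OnlineMechanism.expect, mul_add, Finset.sum_add_distrib]
    linarith

end Opt

end TwoSidedScheduling

end

namespace TwoSidedScheduling

/-! ### The height of a rational number -/

/-- The larger of the binary lengths of numerator and denominator. -/
def height (q : ℚ) : ℕ :=
  max (Nat.size q.num.natAbs) (Nat.size q.den)

theorem bitSize_le_height (q : ℚ) : bitSize q ≤ 2 * height q + 1 := by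
  unfold bitSize height; omega

theorem height_le_bitSize (q : ℚ) : height q ≤ bitSize q := by
  unfold bitSize height; omega

theorem height_le_iff {q : ℚ} {h : ℕ} :
    height q ≤ h ↔ q.num.natAbs < 2 ^ h ∧ q.den < 2 ^ h := by
  rw [height, max_le_iff, Nat.size_le, Nat.size_le]

/-- Reduction to lowest terms only divides numerator and denominator, so any representation as a
fraction bounds the height. -/
theorem height_div_le {n d : ℤ} {h : ℕ} (hd : d ≠ 0) (hn : n.natAbs < 2 ^ h)
    (hd' : d.natAbs < 2 ^ h) : height ((n : ℚ) / d) ≤ h := by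
  rw [height_le_iff, Rat.intCast_div_eq_divInt]
  constructor
  · refine lt_of_le_of_lt ?_ hn
    rcases eq_or_ne n 0 with rfl | h0
    · simp
    · exact Nat.le_of_dvd (Int.natAbs_pos.2 h0) (Int.natAbs_dvd_natAbs.2 (Rat.num_dvd n hd))
  · refine lt_of_le_of_lt ?_ hd'
    refine Nat.le_of_dvd (Int.natAbs_pos.2 hd) ?_
    have := Int.natAbs_dvd_natAbs.2 (Rat.den_dvd n d)
    simpa using this

theorem num_lt (q : ℚ) : q.num.natAbs < 2 ^ height q := (height_le_iff.1 le_rfl).1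

theorem den_lt (q : ℚ) : q.den < 2 ^ height q := (height_le_iff.1 le_rfl).2

theorem height_mul_le (a b : ℚ) : height (a * b) ≤ height a + height b := by
  have e : a * b = ((a.num * b.num : ℤ) : ℚ) / ((a.den * b.den : ℤ) : ℚ) := by
    conv_lhs => rw [← Rat.num_div_den a, ← Rat.num_div_den b]
    push_cast
    rw [div_mul_div_comm]
  rw [e]
  refine height_div_le (by simp) ?_ ?_
  · rw [Int.natAbs_mul, pow_add]
    exact Nat.mul_lt_mul'' (num_lt a) (num_lt b)
  · rw [Int.natAbs_mul, pow_add]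
    exact Nat.mul_lt_mul'' (by simpa using den_lt a) (by simpa using den_lt b)

theorem height_add_le (a b : ℚ) : height (a + b) ≤ height a + height b + 1 := by
  have e : a + b = ((a.num * b.den + b.num * a.den : ℤ) : ℚ) / ((a.den * b.den : ℤ) : ℚ) := by
    conv_lhs => rw [← Rat.num_div_den a, ← Rat.num_div_den b]
    push_cast
    rw [div_add_div _ _ (by simp) (by simp)]
    ring
  rw [e]
  have h1 := Nat.mul_lt_mul'' (num_lt a) (den_lt b)
  have h2 := Nat.mul_lt_mul'' (num_lt b) (den_lt a)
  have h3 := Nat.mul_lt_mul'' (den_lt a) (den_lt b)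
  have h4 : 2 ^ (height a + height b + 1) = 2 * (2 ^ height a * 2 ^ height b) := by
    rw [pow_succ, pow_add]; ring
  refine height_div_le (by simp) ?_ ?_
  · refine lt_of_le_of_lt (Int.natAbs_add_le _ _) ?_
    rw [Int.natAbs_mul, Int.natAbs_mul, Int.natAbs_natCast, Int.natAbs_natCast, h4]
    rw [mul_comm (2 ^ height b)] at h2
    omega
  · rw [Int.natAbs_mul, Int.natAbs_natCast, Int.natAbs_natCast, h4]
    omega

theorem height_neg (a : ℚ) : height (-a) = height a := by
  simp [height]

theorem height_sub_le (a b : ℚ) : height (a - b) ≤ height a + height b + 1 := by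
  rw [sub_eq_add_neg]
  exact (height_add_le _ _).trans_eq (by rw [height_neg])

theorem height_zero : height 0 = 1 := by
  simp [height]

theorem height_inv_le (a : ℚ) : height a⁻¹ ≤ height a := by
  rcases eq_or_ne a 0 with rfl | h0
  · simp
  have e : a⁻¹ = ((a.den : ℤ) : ℚ) / (a.num : ℚ) := by
    conv_lhs => rw [← Rat.num_div_den a]
    rw [inv_div]
    norm_cast
  rw [e]
  exact height_div_le (by simpa using h0) (by simpa using den_lt a) (num_lt a)

theorem height_div_le_add (a b : ℚ) : height (a / b) ≤ height a + height b := by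
  rw [div_eq_mul_inv]
  exact (height_mul_le _ _).trans (Nat.add_le_add_left (height_inv_le _) _)

theorem height_natCast_le (n : ℕ) : height (n : ℚ) ≤ n + 1 := by
  rw [height_le_iff]
  have : n + 1 < 2 ^ (n + 1) := Nat.lt_two_pow_self
  simp only [Rat.num_natCast, Int.natAbs_natCast, Rat.den_natCast]
  exact ⟨by omega, by omega⟩

theorem height_one_le : height 1 ≤ 1 := by
  simp [height]

/-! ### Contexts

A context describes a family of instances, the data that are available in the memory for each
instance, and a size parameter. -/

/-- A family of instances `x : I` together with arrays `arr b x` of lengths `len b x`. -/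
structure Ctx (I : Type) where
  dom : I → Prop
  size : I → ℕ
  len : ℕ → I → ℕ
  arr : ℕ → I → ℕ → ℚ

namespace Ctx

variable {I J H : Type}

/-- `f` is polynomially bounded in the size of the instance. -/
def PB (Γ : Ctx I) (f : I → ℕ) : Prop :=
  ∃ k, ∀ x, Γ.dom x → f x ≤ (Γ.size x + 2) ^ k

/-- The memory `σ` holds the data of `x`, with the `b`-th array of the context in array `φ b`. -/
def Holds (Γ : Ctx I) (φ : ℕ → ℕ) (x : I) (σ : Memory) : Prop :=
  ∀ b i, i < Γ.len b x → σ (φ b) i = Γ.arr b x i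

/-- For all layouts of the data in the first `t` arrays, there is a polynomial-time program that
writes the first `L x` entries of `w x` into array `t` and does not change the first `t` arrays. -/
def Computes (Γ : Ctx I) (L : I → ℕ) (w : I → ℕ → ℚ) : Prop :=
  ∀ (φ : ℕ → ℕ) (t : ℕ), (∀ b, φ b < t) → ∃ (P : Program) (k : ℕ), ∀ x, Γ.dom x → ∀ σ,
    Γ.Holds φ x σ → ∃ τ c, Exec P σ τ c ∧ (∀ b < t, τ b = σ b) ∧ (∀ i < L x, τ t i = w x i) ∧
      c ≤ (Γ.size x + 2) ^ k

/-- The number `q x` is computable in polynomial time. -/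
def PT (Γ : Ctx I) (q : I → ℚ) : Prop :=
  Γ.PB (fun x => height (q x)) ∧ Γ.Computes (fun _ => 1) fun x _ => q x

/-- The context `Δ` extends `Γ`. -/
structure Ext (Δ : Ctx J) (Γ : Ctx I) (π : J → I) : Prop where
  dom : ∀ y, Δ.dom y → Γ.dom (π y)
  size : ∀ y, Δ.dom y → Γ.size (π y) ≤ Δ.size y
  var : ∃ f : ℕ → ℕ, ∀ b y, Δ.dom y → ∀ i < Γ.len b (π y),
    i < Δ.len (f b) y ∧ Δ.arr (f b) y i = Γ.arr b (π y) i

/-- The numbers `s x i` with `i < n x` are computable in polynomial time from `x` and `i`. -/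
def PTA (Γ : Ctx I) (n : I → ℕ) (s : I → ℕ → ℚ) : Prop :=
  ∀ (J : Type) (Δ : Ctx J) (π : J → I), Ext Δ Γ π → ∀ idx : J → ℕ,
    Δ.PT (fun y => (idx y : ℚ)) → (∀ y, Δ.dom y → idx y < n (π y)) →
      Δ.PT fun y => s (π y) (idx y)

/-- The context with an additional array. -/
def push (Γ : Ctx I) (π : J → I) (D : J → Prop) (l : J → ℕ) (v : J → ℕ → ℚ) : Ctx J where
  dom y := Γ.dom (π y) ∧ D y
  size y := Γ.size (π y)
  len b y := b.casesOn (l y) fun b => Γ.len b (π y)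
  arr b y := b.casesOn (v y) fun b => Γ.arr b (π y)

/-- The layout of an additional array at `a`. -/
def consLayout (a : ℕ) (φ : ℕ → ℕ) (b : ℕ) : ℕ :=
  b.casesOn a φ

variable {Γ : Ctx I} {Δ : Ctx J} {π : J → I}

theorem PB.mono {f g : I → ℕ} (hg : Γ.PB g) (h : ∀ x, Γ.dom x → f x ≤ g x) : Γ.PB f := by
  obtain ⟨k, hk⟩ := hg
  exact ⟨k, fun x hx => (h x hx).trans (hk x hx)⟩

/-- The base is at least 2, so a constant c is bounded by the c-th power even for instances of size
0. -/
theorem PB.const (c : ℕ) : Γ.PB fun _ => c :=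
  ⟨c, fun _ _ => Nat.lt_two_pow_self.le.trans (Nat.pow_le_pow_left (Nat.le_add_left _ _) _)⟩

theorem PB.add {f g : I → ℕ} (hf : Γ.PB f) (hg : Γ.PB g) : Γ.PB fun x => f x + g x := by
  obtain ⟨k, hk⟩ := hf
  obtain ⟨l, hl⟩ := hg
  refine ⟨max k l + 1, fun x hx => ?_⟩
  have h1 := (hk x hx).trans (Nat.pow_le_pow_right (by omega) (le_max_left k l))
  have h2 := (hl x hx).trans (Nat.pow_le_pow_right (by omega) (le_max_right k l))
  rw [pow_succ]
  nlinarith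

theorem PB.mul {f g : I → ℕ} (hf : Γ.PB f) (hg : Γ.PB g) : Γ.PB fun x => f x * g x := by
  obtain ⟨k, hk⟩ := hf
  obtain ⟨l, hl⟩ := hg
  refine ⟨k + l, fun x hx => ?_⟩
  rw [pow_add]
  exact Nat.mul_le_mul (hk x hx) (hl x hx)

theorem PB.pow_size (k : ℕ) : Γ.PB fun x => (Γ.size x + 2) ^ k :=
  ⟨k, fun _ _ => le_rfl⟩

theorem PB.weak (h : Ext Δ Γ π) {f : I → ℕ} (hf : Γ.PB f) : Δ.PB fun y => f (π y) := by
  obtain ⟨k, hk⟩ := hf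
  exact ⟨k, fun y hy => (hk _ (h.dom y hy)).trans
    (Nat.pow_le_pow_left (Nat.add_le_add_right (h.size y hy) 2) k)⟩

theorem Ext.refl (Γ : Ctx I) : Ext Γ Γ fun x => x :=
  ⟨fun _ h => h, fun _ _ => le_rfl, id, fun _ _ _ _ hi => ⟨hi, rfl⟩⟩

theorem Ext.trans {Θ : Ctx H} {ρ : H → J} (h : Ext Θ Δ ρ) (h' : Ext Δ Γ π) :
    Ext Θ Γ fun z => π (ρ z) := by
  obtain ⟨f, hf⟩ := h.var
  obtain ⟨g, hg⟩ := h'.var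
  refine ⟨fun z hz => h'.dom _ (h.dom z hz),
    fun z hz => (h'.size _ (h.dom z hz)).trans (h.size z hz), fun b => f (g b),
    fun b z hz i hi => ?_⟩
  have h1 := hg b (ρ z) (h.dom z hz) i hi
  have h2 := hf (g b) z hz i h1.1
  exact ⟨h2.1, h2.2.trans h1.2⟩

theorem Ext.push (Γ : Ctx I) (π : J → I) (D : J → Prop) (l : J → ℕ) (v : J → ℕ → ℚ) :
    Ext (Γ.push π D l v) Γ π :=
  ⟨fun _ h => h.1, fun _ _ => le_rfl, Nat.succ, fun _ _ _ _ hi => ⟨hi, rfl⟩⟩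

theorem Computes.weak (h : Ext Δ Γ π) {L : I → ℕ} {w : I → ℕ → ℚ} (hw : Γ.Computes L w) :
    Δ.Computes (fun y => L (π y)) fun y => w (π y) := by
  intro φ t hφ
  obtain ⟨f, hf⟩ := h.var
  obtain ⟨P, k, hP⟩ := hw (fun b => φ (f b)) t fun b => hφ _
  refine ⟨P, k, fun y hy σ hσ => ?_⟩
  obtain ⟨τ, c, h1, h2, h3, h4⟩ := hP (π y) (h.dom y hy) σ fun b i hi =>
    (hσ _ _ (hf b y hy i hi).1).trans (hf b y hy i hi).2
  exact ⟨τ, c, h1, h2, h3, h4.trans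
    (Nat.pow_le_pow_left (Nat.add_le_add_right (h.size y hy) 2) k)⟩

theorem PT.weak (h : Ext Δ Γ π) {q : I → ℚ} (hq : Γ.PT q) : Δ.PT fun y => q (π y) :=
  ⟨PB.weak (f := fun x => height (q x)) h hq.1, Computes.weak h hq.2⟩

/-- Extensions compose. Quantifying over all extensions in the definition is what allows an array to
be used inside a loop body, where an index or a loop state is available in addition. -/
theorem PTA.weak (h : Ext Δ Γ π) {n : I → ℕ} {s : I → ℕ → ℚ} (hs : Γ.PTA n s) :
    Δ.PTA (fun y => n (π y)) fun y => s (π y) :=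
  fun _ Θ ρ h' idx hidx hlt => hs _ Θ (fun z => π (ρ z)) (h'.trans h) idx hidx hlt

theorem PTA.app {n : I → ℕ} {s : I → ℕ → ℚ} (hs : Γ.PTA n s) {idx : I → ℕ}
    (hidx : Γ.PT fun x => (idx x : ℚ)) (hlt : ∀ x, Γ.dom x → idx x < n x) :
    Γ.PT fun x => s x (idx x) :=
  hs _ Γ _ (Ext.refl Γ) idx hidx hlt

theorem PT.congr {q q' : I → ℚ} (hq : Γ.PT q) (h : ∀ x, Γ.dom x → q x = q' x) : Γ.PT q' := by
  refine ⟨hq.1.mono fun x hx => by rw [h x hx], fun φ t hφ => ?_⟩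
  obtain ⟨P, k, hP⟩ := hq.2 φ t hφ
  refine ⟨P, k, fun x hx σ hσ => ?_⟩
  obtain ⟨τ, c, h1, h2, h3, h4⟩ := hP x hx σ hσ
  exact ⟨τ, c, h1, h2, fun i hi => (h3 i hi).trans (h x hx), h4⟩

theorem PTA.mono {n n' : I → ℕ} {s : I → ℕ → ℚ} (hs : Γ.PTA n s)
    (h : ∀ x, Γ.dom x → n' x ≤ n x) : Γ.PTA n' s :=
  fun _ Δ π hΔ idx hidx hlt => hs _ Δ π hΔ idx hidx fun y hy =>
    (hlt y hy).trans_le (h _ (hΔ.dom y hy))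

theorem Holds.of_agree {φ : ℕ → ℕ} {t : ℕ} (hφ : ∀ b, φ b < t) {x : I} {σ τ : Memory}
    (h : Γ.Holds φ x σ) (hτ : ∀ b < t, τ b = σ b) : Γ.Holds φ x τ :=
  fun b i hi => by rw [hτ _ (hφ b)]; exact h b i hi

theorem Holds.push {φ : ℕ → ℕ} {D : J → Prop} {l : J → ℕ} {v : J → ℕ → ℚ} {a : ℕ} {y : J}
    {σ : Memory} (h : Γ.Holds φ (π y) σ) (ha : ∀ i < l y, σ a i = v y i) :
    (Γ.push π D l v).Holds (consLayout a φ) y σ := by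
  intro b i hi
  cases b with
  | zero => exact ha i hi
  | succ b => exact h b i hi

theorem consLayout_lt {φ : ℕ → ℕ} {t a : ℕ} (hφ : ∀ b, φ b < t) (ha : a < t) (b : ℕ) :
    consLayout a φ b < t := by
  cases b with
  | zero => exact ha
  | succ b => exact hφ b

end Ctx

/-! ### Elementary programs -/

/-- The expression for the first cell of array `b`. -/
def reg (b : ℕ) : Expr :=
  .cell b (.const 0)

theorem reg_eval (b : ℕ) (σ : Memory) : (reg b).eval σ = σ b 0 := by
  simp [reg, Expr.eval]

theorem bitSize_zero : bitSize 0 = 2 := by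
  simp [bitSize]

theorem bitSize_one : bitSize 1 = 3 := by
  simp [bitSize]

theorem reg_cost (b : ℕ) (σ : Memory) : (reg b).cost σ = 2 + bitSize (σ b 0) := by
  have := reg_eval b σ
  rw [reg] at this ⊢
  rw [Expr.cost, this, Expr.cost, bitSize_zero]

/-- Store the value of `e` in the first cell of array `b`. -/
def setReg (b : ℕ) (e : Expr) : Program :=
  .write b (.const 0) e

/-- The memory after `setReg`. -/
def Memory.set (σ : Memory) (b i : ℕ) (v : ℚ) : Memory :=
  Function.update σ b (Function.update (σ b) i v)

theorem Memory.set_self (σ : Memory) (b i : ℕ) (v : ℚ) : σ.set b i v b i = v := by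
  simp [Memory.set]

theorem Memory.set_of_ne (σ : Memory) {b b' : ℕ} (i : ℕ) (v : ℚ) (h : b' ≠ b) :
    σ.set b i v b' = σ b' := by
  simp [Memory.set, h]

theorem exec_setReg (σ : Memory) (b : ℕ) (e : Expr) :
    Exec (setReg b e) σ (σ.set b 0 (e.eval σ)) (e.cost σ + 3) := by
  have := Exec.write σ b (.const 0) e
  simp only [Expr.eval, Expr.cost, bitSize_zero, Nat.floor_zero] at this
  rw [show e.cost σ + 3 = 2 + e.cost σ + 1 by ring]
  exact this

/-- A loop with an invariant. -/
theorem exec_loop {e : Expr} {P : Program} {C r : ℕ} (inv : ℕ → Memory → Prop)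
    (step : ∀ j < r, ∀ σ, inv j σ → e.eval σ ≠ 0 ∧ ∃ τ c, Exec P σ τ c ∧ inv (j + 1) τ ∧
      e.cost σ + c + 1 ≤ C)
    (done : ∀ σ, inv r σ → e.eval σ = 0 ∧ e.cost σ + 1 ≤ C) {σ : Memory} (h : inv 0 σ) :
    ∃ τ c, Exec (.loop e P) σ τ c ∧ inv r τ ∧ c ≤ (r + 1) * C := by
  have key : ∀ d j σ, j + d = r → inv j σ →
      ∃ τ c, Exec (.loop e P) σ τ c ∧ inv r τ ∧ c ≤ (d + 1) * C := by
    intro d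
    induction d with
    | zero =>
      intro j σ hj hσ
      obtain rfl : j = r := by omega
      exact ⟨σ, _, .loop_false (done σ hσ).1, hσ, by simpa using (done σ hσ).2⟩
    | succ d ih =>
      intro j σ hj hσ
      obtain ⟨h1, τ, c, h2, h3, h4⟩ := step j (by omega) σ hσ
      obtain ⟨υ, c', h5, h6, h7⟩ := ih (j + 1) τ (by omega) h3
      exact ⟨υ, _, .loop_true h1 h2 h5, h6, by nlinarith⟩
  exact key r 0 σ (by omega) h

/-- For `i < n`: run `P`, where `i` is held in `reg a` and `n` in `reg b`. -/
def forLoop (a b : ℕ) (P : Program) : Program :=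
  .seq (setReg a (.const 0)) (.loop (.le (.add (reg a) (.const 1)) (reg b))
    (.seq P (setReg a (.add (reg a) (.const 1)))))

theorem exec_forLoop {a b n C : ℕ} {P : Program} (inv : ℕ → Memory → Prop)
    (hb : ∀ j σ, inv j σ → σ b 0 = n)
    (hset : ∀ j σ v, inv j σ → inv j (σ.set a 0 v))
    (step : ∀ j < n, ∀ σ, inv j σ → σ a 0 = j → ∃ τ c, Exec P σ τ c ∧ inv (j + 1) τ ∧
      τ a 0 = j ∧ c ≤ C) {σ : Memory} (h : inv 0 σ) :
    ∃ τ c, Exec (forLoop a b P) σ τ c ∧ inv n τ ∧ c ≤ (n + 1) * (C + 20 * n + 100) + 10 := by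
  -- The bound is linear in the counter instead of logarithmic. This suffices because loop lengths
  -- are polynomially bounded.
  have hsz : ∀ j : ℕ, j ≤ n + 1 → bitSize (j : ℚ) ≤ 2 * n + 5 := fun j hj =>
    (bitSize_le_height _).trans (by have := height_natCast_le j; omega)
  have hcost : ∀ j ≤ n, ∀ σ : Memory, inv j σ → σ a 0 = j →
      (Expr.le (.add (reg a) (.const 1)) (reg b)).eval σ = (if j + 1 ≤ n then 1 else 0) ∧
      (Expr.le (.add (reg a) (.const 1)) (reg b)).cost σ ≤ 8 * n + 40 := by
    intro j hj σ hσ hja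
    have h1 : (Expr.le (.add (reg a) (.const 1)) (reg b)).eval σ =
        (if j + 1 ≤ n then 1 else 0) := by
      simp only [Expr.eval, reg_eval, hja, hb j σ hσ]
      norm_cast
    refine ⟨h1, ?_⟩
    simp only [Expr.cost, reg_cost, hja, hb j σ hσ, Expr.eval, reg_eval, bitSize_one]
    have h2 := hsz j (by omega)
    have h3 := hsz n (by omega)
    have h4 := hsz (j + 1) (by omega)
    push_cast at h4
    have h5 : bitSize (if (j : ℚ) + 1 ≤ n then 1 else 0) ≤ 3 := by
      split_ifs
      · exact bitSize_one.le
      · rw [bitSize_zero]; omega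
    omega
  obtain ⟨τ, c, h1, h2, h3⟩ := exec_loop (e := .le (.add (reg a) (.const 1)) (reg b))
    (P := .seq P (setReg a (.add (reg a) (.const 1)))) (C := C + 20 * n + 100) (r := n)
    (fun j σ => inv j σ ∧ σ a 0 = j)
    (fun j hj σ hσ => by
      obtain ⟨e1, e2⟩ := hcost j hj.le σ hσ.1 hσ.2
      obtain ⟨τ, c, h1, h2, h3, h4⟩ := step j hj σ hσ.1 hσ.2
      refine ⟨by rw [e1, if_pos (by omega)]; exact one_ne_zero, _, _, .seq h1 (exec_setReg _ _ _),
        ⟨hset _ _ _ h2, ?_⟩, ?_⟩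
      · rw [Memory.set_self]
        simp only [Expr.eval, reg_eval, h3]
        push_cast; rfl
      · simp only [Expr.cost, Expr.eval, reg_cost, reg_eval, h3, bitSize_one]
        have h5 := hsz j (by omega)
        have h6 := hsz (j + 1) (by omega)
        push_cast at h6
        simp only [Expr.cost, Expr.eval, reg_cost, reg_eval] at e2
        omega)
    (fun σ hσ => by
      obtain ⟨e1, e2⟩ := hcost n le_rfl σ hσ.1 hσ.2
      exact ⟨by rw [e1, if_neg (by omega)], by omega⟩)
    (σ := σ.set a 0 0) ⟨hset _ _ _ h, by rw [Memory.set_self]; rfl⟩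
  refine ⟨τ, _, .seq (exec_setReg σ a (.const 0)) h1, h2.1, ?_⟩
  simp only [Expr.cost, bitSize_zero]
  omega

/-- Copy the first entries of array `a` to array `t`; their number is held in `reg b`. -/
def copyArray (a t i b : ℕ) : Program :=
  forLoop i b (.write t (reg i) (.cell a (reg i)))

theorem exec_copyArray {a t i b n C : ℕ} (hat : a ≠ t) (hai : a ≠ i) (hti : t ≠ i) (hib : i ≠ b)
    (htb : t ≠ b) {σ : Memory} (hb : σ b 0 = n) (hC : ∀ j < n, height (σ a j) ≤ C) :
    ∃ τ c, Exec (copyArray a t i b) σ τ c ∧ (∀ b', b' ≠ t → b' ≠ i → τ b' = σ b') ∧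
      (∀ j < n, τ t j = σ a j) ∧ c ≤ (n + 1) * (2 * C + 30 * n + 200) + 10 := by
  obtain ⟨τ, c, h1, h2, h3⟩ := exec_forLoop (a := i) (b := b) (n := n)
    (P := .write t (reg i) (.cell a (reg i))) (C := 2 * C + 10 * n + 100)
    (fun k τ => (∀ b', b' ≠ t → b' ≠ i → τ b' = σ b') ∧ ∀ j < k, τ t j = σ a j)
    (fun k τ h => by rw [h.1 b htb.symm hib.symm, hb])
    (fun k τ v h => by
      refine ⟨fun b' h1 h2 => ?_, fun j hj => ?_⟩
      · rw [Memory.set_of_ne _ _ _ h2, h.1 b' h1 h2]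
      · rw [Memory.set_of_ne _ _ _ hti, h.2 j hj])
    (fun k hk τ h hi => by
      have e1 : (reg i).eval τ = k := by rw [reg_eval, hi]
      have e2 : (Expr.cell a (reg i)).eval τ = σ a k := by
        rw [Expr.eval, e1, Nat.floor_natCast, h.1 a hat hai]
      have hw := Exec.write τ t (reg i) (.cell a (reg i))
      rw [e1, e2, Nat.floor_natCast] at hw
      refine ⟨_, _, hw, ⟨fun b' h1 h2 => ?_, fun j hj => ?_⟩, ?_, ?_⟩
      · rw [Function.update_of_ne h1, h.1 b' h1 h2]
      · rw [Function.update_self, Function.update_apply]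
        split_ifs with hjk
        · rw [hjk]
        · exact h.2 j (by omega)
      · rw [Function.update_of_ne hti.symm, hi]
      · rw [Expr.cost, e2, reg_cost, hi]
        have := hC k hk
        have h4 := bitSize_le_height (σ a k)
        have h5 := bitSize_le_height (k : ℚ)
        have h6 := height_natCast_le k
        omega)
    (σ := σ) ⟨fun _ _ _ => rfl, fun j hj => absurd hj (Nat.not_lt_zero j)⟩
  exact ⟨τ, c, h1, h2.1, h2.2, h3.trans_eq (by ring)⟩

end TwoSidedScheduling

/-! ### Closure of polynomial-time computability under arithmetic, tests, arrays and loops -/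

namespace TwoSidedScheduling

namespace Ctx

variable {I J H : Type} {Γ : Ctx I} {Δ : Ctx J} {π : J → I}

/-- The heights of the numbers `s x i` with `i < n x` are polynomially bounded. -/
def PBA (Γ : Ctx I) (n : I → ℕ) (s : I → ℕ → ℚ) : Prop :=
  ∃ k, ∀ x, Γ.dom x → ∀ i < n x, height (s x i) ≤ (Γ.size x + 2) ^ k

theorem PBA.of_le {n B : I → ℕ} {s : I → ℕ → ℚ} (hB : Γ.PB B)
    (h : ∀ x, Γ.dom x → ∀ i < n x, height (s x i) ≤ B x) : Γ.PBA n s := by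
  obtain ⟨k, hk⟩ := hB
  exact ⟨k, fun x hx i hi => (h x hx i hi).trans (hk x hx)⟩

theorem PBA.exists_bound {n : I → ℕ} {s : I → ℕ → ℚ} (h : Γ.PBA n s) :
    ∃ B : I → ℕ, Γ.PB B ∧ ∀ x, Γ.dom x → ∀ i < n x, height (s x i) ≤ B x := by
  obtain ⟨k, hk⟩ := h
  exact ⟨_, PB.pow_size k, hk⟩

theorem PT.const (c : ℚ) : Γ.PT fun _ => c := by
  refine ⟨PB.const _, fun φ t hφ => ?_⟩
  obtain ⟨k, hk⟩ := PB.const (Γ := Γ) (bitSize c + 3)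
  exact ⟨setReg t (.const c), k, fun x hx σ hσ => ⟨_, _, exec_setReg σ t _,
    fun b hb => Memory.set_of_ne _ _ _ hb.ne, fun i hi => by
      obtain rfl : i = 0 := Nat.lt_one_iff.1 hi
      rw [Memory.set_self]; rfl, hk x hx⟩⟩

/-- The second operand is computed with the first t + 1 arrays protected, so the first result in
array t survives. -/
theorem PT.binary {op : Expr → Expr → Expr} {f : ℚ → ℚ → ℚ}
    (hev : ∀ σ e₁ e₂, (op e₁ e₂).eval σ = f (e₁.eval σ) (e₂.eval σ))
    (hcost : ∀ σ e₁ e₂, (op e₁ e₂).cost σ = e₁.cost σ + e₂.cost σ + bitSize ((op e₁ e₂).eval σ))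
    {q₁ q₂ : I → ℚ} (h₁ : Γ.PT q₁) (h₂ : Γ.PT q₂)
    (hf : Γ.PB fun x => height (f (q₁ x) (q₂ x))) : Γ.PT fun x => f (q₁ x) (q₂ x) := by
  refine ⟨hf, fun φ t hφ => ?_⟩
  obtain ⟨P₁, k₁, hP₁⟩ := h₁.2 φ t hφ
  obtain ⟨P₂, k₂, hP₂⟩ := h₂.2 φ (t + 1) fun b => (hφ b).trans (Nat.lt_succ_self t)
  obtain ⟨k, hk⟩ := (((PB.pow_size (Γ := Γ) k₁).add (PB.pow_size k₂)).add
    (((PB.const 2).mul h₁.1).add ((PB.const 2).mul h₂.1))).add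
    (((PB.const 2).mul hf).add (PB.const 20))
  refine ⟨.seq P₁ (.seq P₂ (setReg t (op (reg t) (reg (t + 1))))), k, fun x hx σ hσ => ?_⟩
  obtain ⟨τ, c, e1, e2, e3, e4⟩ := hP₁ x hx σ hσ
  obtain ⟨υ, d, f1, f2, f3, f4⟩ := hP₂ x hx τ (hσ.of_agree hφ e2)
  have g1 : υ t 0 = q₁ x := by rw [f2 t (by omega)]; exact e3 0 one_pos
  have g2 : υ (t + 1) 0 = q₂ x := f3 0 one_pos
  refine ⟨_, _, .seq e1 (.seq f1 (exec_setReg υ t _)), fun b hb => ?_, fun i hi => ?_, ?_⟩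
  · rw [Memory.set_of_ne _ _ _ hb.ne, f2 b (by omega), e2 b hb]
  · obtain rfl : i = 0 := Nat.lt_one_iff.1 hi
    rw [Memory.set_self, hev, reg_eval, reg_eval, g1, g2]
  · rw [hcost, hev, reg_cost, reg_cost, reg_eval, reg_eval, g1, g2]
    have h1 := bitSize_le_height (q₁ x)
    have h2 := bitSize_le_height (q₂ x)
    have h3 := bitSize_le_height (f (q₁ x) (q₂ x))
    have := hk x hx
    dsimp only at this
    omega

theorem PT.add {q₁ q₂ : I → ℚ} (h₁ : Γ.PT q₁) (h₂ : Γ.PT q₂) : Γ.PT fun x => q₁ x + q₂ x :=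
  PT.binary (op := .add) (f := (· + ·)) (fun _ _ _ => rfl) (fun _ _ _ => rfl) h₁ h₂
    (((h₁.1.add h₂.1).add (PB.const 1)).mono fun _ _ => height_add_le _ _)

theorem PT.sub {q₁ q₂ : I → ℚ} (h₁ : Γ.PT q₁) (h₂ : Γ.PT q₂) : Γ.PT fun x => q₁ x - q₂ x :=
  PT.binary (op := .sub) (f := (· - ·)) (fun _ _ _ => rfl) (fun _ _ _ => rfl) h₁ h₂
    (((h₁.1.add h₂.1).add (PB.const 1)).mono fun _ _ => height_sub_le _ _)

theorem PT.mul {q₁ q₂ : I → ℚ} (h₁ : Γ.PT q₁) (h₂ : Γ.PT q₂) : Γ.PT fun x => q₁ x * q₂ x :=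
  PT.binary (op := .mul) (f := (· * ·)) (fun _ _ _ => rfl) (fun _ _ _ => rfl) h₁ h₂
    ((h₁.1.add h₂.1).mono fun _ _ => height_mul_le _ _)

theorem PT.div {q₁ q₂ : I → ℚ} (h₁ : Γ.PT q₁) (h₂ : Γ.PT q₂) : Γ.PT fun x => q₁ x / q₂ x :=
  PT.binary (op := .div) (f := (· / ·)) (fun _ _ _ => rfl) (fun _ _ _ => rfl) h₁ h₂
    ((h₁.1.add h₂.1).mono fun _ _ => height_div_le_add _ _)

theorem PT.le {q₁ q₂ : I → ℚ} (h₁ : Γ.PT q₁) (h₂ : Γ.PT q₂) :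
    Γ.PT fun x => if q₁ x ≤ q₂ x then 1 else 0 :=
  PT.binary (op := .le) (f := fun a b => if a ≤ b then 1 else 0)
    (fun _ _ _ => rfl) (fun _ _ _ => rfl) h₁ h₂ ((PB.const 1).mono fun _ _ => by
      split_ifs
      · exact height_one_le
      · exact height_zero.le)

/-- Selection is done by arithmetic with the 0/1 value of the test. Both branches are always
evaluated, so both must be computable on all instances. -/
theorem PT.ite_le {q₁ q₂ q₃ q₄ : I → ℚ} (h₁ : Γ.PT q₁) (h₂ : Γ.PT q₂) (h₃ : Γ.PT q₃)
    (h₄ : Γ.PT q₄) : Γ.PT fun x => if q₁ x ≤ q₂ x then q₃ x else q₄ x :=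
  (((h₁.le h₂).mul h₃).add (((PT.const 1).sub (h₁.le h₂)).mul h₄)).congr fun x _ => by
    split_ifs <;> ring

theorem PT.ite_lt {q₁ q₂ q₃ q₄ : I → ℚ} (h₁ : Γ.PT q₁) (h₂ : Γ.PT q₂) (h₃ : Γ.PT q₃)
    (h₄ : Γ.PT q₄) : Γ.PT fun x => if q₁ x < q₂ x then q₃ x else q₄ x :=
  (h₂.ite_le h₁ h₄ h₃).congr fun x _ => by
    rcases lt_or_ge (q₁ x) (q₂ x) with h | h
    · rw [if_pos h, if_neg (not_le.2 h)]
    · rw [if_neg (not_lt.2 h), if_pos h]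

theorem PT.ite_natLe {a b : I → ℕ} {q₃ q₄ : I → ℚ} (h₁ : Γ.PT fun x => (a x : ℚ))
    (h₂ : Γ.PT fun x => (b x : ℚ)) (h₃ : Γ.PT q₃) (h₄ : Γ.PT q₄) :
    Γ.PT fun x => if a x ≤ b x then q₃ x else q₄ x :=
  (h₁.ite_le h₂ h₃ h₄).congr fun x _ => by simp only [Nat.cast_le]

theorem PT.ite_natEq {a b : I → ℕ} {q₃ q₄ : I → ℚ} (h₁ : Γ.PT fun x => (a x : ℚ))
    (h₂ : Γ.PT fun x => (b x : ℚ)) (h₃ : Γ.PT q₃) (h₄ : Γ.PT q₄) :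
    Γ.PT fun x => if a x = b x then q₃ x else q₄ x :=
  (h₁.ite_natLe h₂ (h₂.ite_natLe h₁ h₃ h₄) h₄).congr fun x _ => by
    split_ifs <;> first | rfl | omega

theorem PT.neg {q : I → ℚ} (h : Γ.PT q) : Γ.PT fun x => -q x :=
  ((PT.const 0).sub h).congr fun _ _ => zero_sub _

theorem PT.min {q₁ q₂ : I → ℚ} (h₁ : Γ.PT q₁) (h₂ : Γ.PT q₂) :
    Γ.PT fun x => min (q₁ x) (q₂ x) :=
  (h₁.ite_le h₂ h₁ h₂).congr fun _ _ => (min_def _ _).symm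

theorem PT.max {q₁ q₂ : I → ℚ} (h₁ : Γ.PT q₁) (h₂ : Γ.PT q₂) :
    Γ.PT fun x => max (q₁ x) (q₂ x) :=
  (h₁.ite_le h₂ h₂ h₁).congr fun _ _ => (max_def _ _).symm

theorem PT.natAdd {a b : I → ℕ} (h₁ : Γ.PT fun x => (a x : ℚ)) (h₂ : Γ.PT fun x => (b x : ℚ)) :
    Γ.PT fun x => ((a x + b x : ℕ) : ℚ) :=
  (h₁.add h₂).congr fun x _ => by push_cast; rfl

theorem PT.natConst (c : ℕ) : Γ.PT fun _ => (c : ℚ) :=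
  PT.const c

theorem PT.natSub {a b : I → ℕ} (h₁ : Γ.PT fun x => (a x : ℚ)) (h₂ : Γ.PT fun x => (b x : ℚ)) :
    Γ.PT fun x => ((a x - b x : ℕ) : ℚ) :=
  ((h₁.sub h₂).max (PT.const 0)).congr fun x _ => by
    rcases le_total (b x) (a x) with h | h
    · rw [Nat.cast_sub h, max_eq_left]
      rw [sub_nonneg]; exact_mod_cast h
    · rw [Nat.sub_eq_zero_of_le h, max_eq_right]
      · simp
      · rw [sub_nonpos]; exact_mod_cast h

/-- Reading an array of the context. -/
theorem PT.var (b : ℕ) {idx : I → ℕ} (hidx : Γ.PT fun x => (idx x : ℚ))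
    (hlt : ∀ x, Γ.dom x → idx x < Γ.len b x)
    (hb : Γ.PB fun x => height (Γ.arr b x (idx x))) : Γ.PT fun x => Γ.arr b x (idx x) := by
  refine ⟨hb, fun φ t hφ => ?_⟩
  obtain ⟨P, k₁, hP⟩ := hidx.2 φ t hφ
  obtain ⟨k, hk⟩ := ((PB.pow_size (Γ := Γ) k₁).add ((PB.const 2).mul hidx.1)).add
    (((PB.const 2).mul hb).add (PB.const 20))
  refine ⟨.seq P (setReg t (.cell (φ b) (reg t))), k, fun x hx σ hσ => ?_⟩
  obtain ⟨τ, c, e1, e2, e3, e4⟩ := hP x hx σ hσ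
  have g1 : τ t 0 = idx x := e3 0 one_pos
  have g2 : (Expr.cell (φ b) (reg t)).eval τ = Γ.arr b x (idx x) := by
    rw [Expr.eval, reg_eval, g1, Nat.floor_natCast]
    exact hσ.of_agree hφ e2 b _ (hlt x hx)
  refine ⟨_, _, .seq e1 (exec_setReg τ t _), fun b' hb' => ?_, fun i hi => ?_, ?_⟩
  · rw [Memory.set_of_ne _ _ _ hb'.ne, e2 b' hb']
  · obtain rfl : i = 0 := Nat.lt_one_iff.1 hi
    rw [Memory.set_self, g2]
  · rw [Expr.cost, g2, reg_cost, g1]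
    have h1 := bitSize_le_height (idx x : ℚ)
    have h2 := bitSize_le_height (Γ.arr b x (idx x))
    have := hk x hx
    dsimp only at this
    omega

theorem PTA.var (b : ℕ) (hb : Γ.PBA (Γ.len b) (Γ.arr b)) : Γ.PTA (Γ.len b) (Γ.arr b) := by
  intro J Δ π h idx hidx hlt
  obtain ⟨f, hf⟩ := h.var
  obtain ⟨B, hB, hle⟩ := hb.exists_bound
  have hcongr : ∀ y, Δ.dom y → Δ.arr (f b) y (idx y) = Γ.arr b (π y) (idx y) :=
    fun y hy => (hf b y hy _ (hlt y hy)).2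
  refine (PT.var (f b) hidx (fun y hy => (hf b y hy _ (hlt y hy)).1) ?_).congr hcongr
  refine (PB.weak h hB).mono fun y hy => ?_
  rw [hcongr y hy]
  exact hle _ (h.dom y hy) _ (hlt y hy)

/-- The context for an additional index `i < n x`. -/
def idx (Γ : Ctx I) (n : I → ℕ) : Ctx (I × ℕ) :=
  Γ.push Prod.fst (fun y => y.2 < n y.1) (fun _ => 1) fun y _ => y.2

theorem ext_idx (Γ : Ctx I) (n : I → ℕ) : Ext (Γ.idx n) Γ Prod.fst :=
  Ext.push _ _ _ _ _

theorem PT.idx {n : I → ℕ} (hn : Γ.PB n) : (Γ.idx n).PT fun y => (y.2 : ℚ) := by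
  have hz : (Γ.idx n).PT fun _ => ((0 : ℕ) : ℚ) := PT.natConst 0
  refine PT.var (Γ := Γ.idx n) 0 hz (fun _ _ => one_pos) ?_
  refine ((PB.weak (ext_idx Γ n) hn).add (PB.const 1)).mono fun y hy => ?_
  exact (height_natCast_le _).trans (Nat.add_le_add_right (le_of_lt hy.2) 1)

/-- The definition is applied to a generic index, which turns an array into one number over
instances with an index. -/
theorem PTA.toPT {n : I → ℕ} {s : I → ℕ → ℚ} (hn : Γ.PB n) (hs : Γ.PTA n s) :
    (Γ.idx n).PT fun y => s y.1 y.2 :=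
  hs _ _ _ (ext_idx Γ n) Prod.snd (PT.idx hn) fun _ hy => hy.2

theorem PTA.bound {n : I → ℕ} {s : I → ℕ → ℚ} (hn : Γ.PB n) (hs : Γ.PTA n s) : Γ.PBA n s := by
  obtain ⟨k, hk⟩ := (hs.toPT hn).1
  exact ⟨k, fun x hx i hi => hk (x, i) ⟨hx, hi⟩⟩

/-- An array whose entries are computable in polynomial time can be written to the memory. -/
theorem PTA.computes {n : I → ℕ} {s : I → ℕ → ℚ} (hn : Γ.PB n) (hn' : Γ.PT fun x => (n x : ℚ))
    (hs : Γ.PTA n s) : Γ.Computes n s := by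
  intro φ t hφ
  have hφ' : ∀ b, φ b < t + 1 := fun b => (hφ b).trans (Nat.lt_succ_self t)
  obtain ⟨P₁, k₁, hP₁⟩ := hn'.2 φ (t + 1) hφ'
  -- Layout: output in t, length in t + 1, loop index in t + 2, which the entry program reads and
  -- preserves, and the entry in t + 3.
  obtain ⟨P₂, k₂, hP₂⟩ := (hs.toPT hn).2 (consLayout (t + 2) φ) (t + 3)
    (consLayout_lt (fun b => (hφ b).trans (by omega)) (by omega))
  obtain ⟨B, hB, hle⟩ := (hs.bound hn).exists_bound
  obtain ⟨k, hk⟩ := ((PB.pow_size (Γ := Γ) k₁).add ((hn.add (PB.const 1)).mul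
    (((PB.pow_size k₂).add ((PB.const 2).mul hB)).add (((PB.const 30).mul hn).add
      (PB.const 300))))).add (PB.const 30)
  refine ⟨.seq P₁ (forLoop (t + 2) (t + 1) (.seq P₂ (.write t (reg (t + 2)) (reg (t + 3))))), k,
    fun x hx σ hσ => ?_⟩
  obtain ⟨τ, c, e1, e2, e3, e4⟩ := hP₁ x hx σ hσ
  obtain ⟨υ, d, f1, f2, f3⟩ := exec_forLoop (a := t + 2) (b := t + 1) (n := n x)
    (C := (Γ.size x + 2) ^ k₂ + 2 * B x + 2 * n x + 100)
    (P := .seq P₂ (.write t (reg (t + 2)) (reg (t + 3))))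
    (fun j υ => (∀ b < t, υ b = σ b) ∧ υ (t + 1) 0 = n x ∧ ∀ i < j, υ t i = s x i)
    (fun j υ h => h.2.1)
    (fun j υ v h => by
      refine ⟨fun b hb => ?_, ?_, fun i hi => ?_⟩
      · rw [Memory.set_of_ne _ _ _ (by omega), h.1 b hb]
      · rw [Memory.set_of_ne _ _ _ (by omega), h.2.1]
      · rw [Memory.set_of_ne _ _ _ (by omega), h.2.2 i hi])
    (fun j hj υ h hjυ => by
      have hH : (Γ.idx n).Holds (consLayout (t + 2) φ) (x, j) υ :=
        Holds.push (hσ.of_agree hφ h.1) fun i hi => by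
          obtain rfl : i = 0 := Nat.lt_one_iff.1 hi
          exact hjυ
      obtain ⟨ω, c, g1, g2, g3, g4⟩ := hP₂ (x, j) ⟨hx, hj⟩ υ hH
      have hω : ω (t + 3) 0 = s x j := g3 0 one_pos
      have hω' : ω (t + 2) 0 = j := by rw [g2 _ (by omega), hjυ]
      have hw := Exec.write ω t (reg (t + 2)) (reg (t + 3))
      rw [reg_eval, reg_eval, hω, hω', Nat.floor_natCast, reg_cost, reg_cost, hω, hω'] at hw
      refine ⟨_, _, .seq g1 hw, ⟨fun b hb => ?_, ?_, fun i hi => ?_⟩, ?_, ?_⟩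
      · rw [Function.update_of_ne hb.ne, g2 b (by omega), h.1 b hb]
      · rw [Function.update_of_ne (by omega), g2 _ (by omega), h.2.1]
      · rw [Function.update_self, Function.update_apply]
        split_ifs with hij
        · rw [hij]
        · rw [g2 _ (by omega), h.2.2 i (by omega)]
      · rw [Function.update_of_ne (by omega), hω']
      · have h1 := bitSize_le_height (j : ℚ)
        have h2 := height_natCast_le j
        have h3 := bitSize_le_height (s x j)
        have h4 := hle x hx j hj
        change c ≤ (Γ.size x + 2) ^ k₂ at g4
        omega)
    (σ := τ) ⟨fun b hb => e2 b (by omega), e3 0 one_pos, fun i hi => absurd hi (Nat.not_lt_zero i)⟩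
  refine ⟨υ, _, .seq e1 f1, f2.1, f2.2.2, ?_⟩
  have := hk x hx
  dsimp only at this
  have h6 : (n x + 1) * ((Γ.size x + 2) ^ k₂ + 2 * B x + 2 * n x + 100 + 20 * n x + 100) ≤
      (n x + 1) * ((Γ.size x + 2) ^ k₂ + 2 * B x + (30 * n x + 300)) :=
    Nat.mul_le_mul_left _ (by omega)
  omega

/-- The whole array is recomputed for each entry that is read; this is wasteful but polynomial. -/
theorem Computes.pta {L : I → ℕ} {w : I → ℕ → ℚ} (hb : Γ.PBA L w) (hw : Γ.Computes L w) :
    Γ.PTA L w := by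
  intro J Δ π h idx hidx hlt
  obtain ⟨B, hB, hle⟩ := hb.exists_bound
  have hB' := PB.weak h hB
  have hle' : ∀ y, Δ.dom y → height (w (π y) (idx y)) ≤ B (π y) :=
    fun y hy => hle _ (h.dom y hy) _ (hlt y hy)
  refine ⟨hB'.mono hle', fun φ t hφ => ?_⟩
  obtain ⟨P₁, k₁, hP₁⟩ := hidx.2 φ t hφ
  obtain ⟨P₂, k₂, hP₂⟩ := hw.weak h φ (t + 1) fun b => (hφ b).trans (Nat.lt_succ_self t)
  obtain ⟨k, hk⟩ := ((PB.pow_size (Γ := Δ) k₁).add (PB.pow_size k₂)).add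
    (((PB.const 2).mul hidx.1).add (((PB.const 2).mul hB').add (PB.const 20)))
  refine ⟨.seq P₁ (.seq P₂ (setReg t (.cell (t + 1) (reg t)))), k, fun y hy σ hσ => ?_⟩
  obtain ⟨τ, c, e1, e2, e3, e4⟩ := hP₁ y hy σ hσ
  obtain ⟨υ, d, f1, f2, f3, f4⟩ := hP₂ y hy τ (hσ.of_agree hφ e2)
  have g1 : υ t 0 = idx y := by rw [f2 t (by omega)]; exact e3 0 one_pos
  have g2 : (Expr.cell (t + 1) (reg t)).eval υ = w (π y) (idx y) := by
    rw [Expr.eval, reg_eval, g1, Nat.floor_natCast, f3 _ (hlt y hy)]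
  refine ⟨_, _, .seq e1 (.seq f1 (exec_setReg υ t _)), fun b hb => ?_, fun i hi => ?_, ?_⟩
  · rw [Memory.set_of_ne _ _ _ hb.ne, f2 b (by omega), e2 b hb]
  · obtain rfl : i = 0 := Nat.lt_one_iff.1 hi
    rw [Memory.set_self, g2]
  · rw [Expr.cost, g2, reg_cost, g1]
    have h1 := bitSize_le_height (idx y : ℚ)
    have h2 := bitSize_le_height (w (π y) (idx y))
    have h3 := hle' y hy
    have := hk y hy
    dsimp only at this
    omega

/-- Iteration: `v x j` is the state after `j` steps, and the number `n x` of steps is the first one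
at which a computable test fails. -/
theorem PTA.while {n L : I → ℕ} {v : I → ℕ → ℕ → ℚ} (hL : Γ.PB L) (hL' : Γ.PT fun x => (L x : ℚ))
    (hn : Γ.PB n)
    (hv : ∃ k, ∀ x, Γ.dom x → ∀ j ≤ n x, ∀ i < L x, height (v x j i) ≤ (Γ.size x + 2) ^ k)
    (init : Γ.PTA L fun x => v x 0)
    (cond : ∀ (J : Type) (Δ : Ctx J) (π : J → I), Ext Δ Γ π → ∀ st : J → ℕ,
      (∀ y, Δ.dom y → st y ≤ n (π y)) → Δ.PTA (fun y => L (π y)) (fun y => v (π y) (st y)) →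
        Δ.PT fun y => if st y < n (π y) then 1 else 0)
    (body : ∀ (J : Type) (Δ : Ctx J) (π : J → I), Ext Δ Γ π → ∀ st : J → ℕ,
      (∀ y, Δ.dom y → st y < n (π y)) → Δ.PTA (fun y => L (π y)) (fun y => v (π y) (st y)) →
        Δ.PTA (fun y => L (π y)) fun y => v (π y) (st y + 1)) :
    Γ.PTA L fun x => v x (n x) := by
  obtain ⟨kv, hv⟩ := hv
  refine Computes.pta ⟨kv, fun x hx i hi => hv x hx _ le_rfl i hi⟩ fun φ t hφ => ?_
  -- The test also runs in the final state j = n, whereas the body runs only for j < n. Hence there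
  -- are two contexts.
  set Δc : Ctx (I × ℕ) := Γ.push Prod.fst (fun y => y.2 ≤ n y.1) (fun y => L y.1)
    (fun y => v y.1 y.2) with hΔc
  set Δb : Ctx (I × ℕ) := Γ.push Prod.fst (fun y => y.2 < n y.1) (fun y => L y.1)
    (fun y => v y.1 y.2) with hΔb
  have hc := cond _ Δc Prod.fst (Ext.push _ _ _ _ _) Prod.snd (fun y hy => hy.2)
    (PTA.var (Γ := Δc) 0 ⟨kv, fun y hy i hi => hv y.1 hy.1 y.2 hy.2 i hi⟩)
  have hb := body _ Δb Prod.fst (Ext.push _ _ _ _ _) Prod.snd (fun y hy => hy.2)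
    (PTA.var (Γ := Δb) 0 ⟨kv, fun y hy i hi => hv y.1 hy.1 y.2 (le_of_lt hy.2) i hi⟩)
  have hφ1 : ∀ b, φ b < t + 1 := fun b => (hφ b).trans (by omega)
  have hφ2 : ∀ b, φ b < t + 2 := fun b => (hφ b).trans (by omega)
  have hφ3 := consLayout_lt (a := t) hφ2 (by omega)
  obtain ⟨P₁, k₁, hP₁⟩ := hL'.2 φ (t + 1) hφ1
  obtain ⟨P₂, k₂, hP₂⟩ := (init.computes hL hL') φ (t + 2) hφ2
  obtain ⟨P₃, k₃, hP₃⟩ := hc.2 (consLayout t φ) (t + 2) hφ3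
  obtain ⟨P₄, k₄, hP₄⟩ := (hb.computes (PB.weak (Ext.push _ _ _ _ _) hL)
    (PT.weak (Ext.push _ _ _ _ _) hL')) (consLayout t φ) (t + 2) hφ3
  -- The body reads the old state in array t and writes the new one to t + 2. This block copies it
  -- back to t and then overwrites t + 2 with the value of the next test.
  set P₅ : Program := .seq (copyArray (t + 2) t (t + 3) (t + 1)) P₃ with hP₅
  set C : I → ℕ := fun x => (L x + 1) * (2 * (Γ.size x + 2) ^ kv + (30 * L x + 200)) +
    ((Γ.size x + 2) ^ k₃ + 11) with hCdef
  have hC : Γ.PB C := ((hL.add (PB.const 1)).mul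
    (((PB.const 2).mul (PB.pow_size kv)).add (((PB.const 30).mul hL).add (PB.const 200)))).add
      ((PB.pow_size k₃).add (PB.const 11))
  obtain ⟨k, hk⟩ := ((PB.pow_size (Γ := Γ) k₁).add (PB.pow_size k₂)).add
    (hC.add (((hn.add (PB.const 1)).mul ((PB.pow_size k₄).add (hC.add (PB.const 10)))).add
      (PB.const 10)))
  refine ⟨.seq P₁ (.seq P₂ (.seq P₅ (.loop (reg (t + 2)) (.seq P₄ P₅)))), k,
    fun x hx σ hσ => ?_⟩
  -- the state at the head of the loop
  let good : ℕ → Memory → Prop := fun j υ => (∀ b < t, υ b = σ b) ∧ υ (t + 1) 0 = L x ∧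
    (∀ i < L x, υ t i = v x j i) ∧ υ (t + 2) 0 = if j < n x then 1 else 0
  have block : ∀ j ≤ n x, ∀ υ : Memory, (∀ b < t, υ b = σ b) → υ (t + 1) 0 = L x →
      (∀ i < L x, υ (t + 2) i = v x j i) → ∃ ω c, Exec P₅ υ ω c ∧ good j ω ∧ c ≤ C x := by
    intro j hj υ h1 h2 h3
    obtain ⟨τ, c, e1, e2, e3, e4⟩ := exec_copyArray (a := t + 2) (t := t) (i := t + 3) (b := t + 1)
      (n := L x) (C := (Γ.size x + 2) ^ kv) (by omega) (by omega) (by omega) (by omega) (by omega)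
      (σ := υ) h2 (fun i hi => by rw [h3 i hi]; exact hv x hx j hj i hi)
    have e5 : ∀ b < t, τ b = σ b := fun b hb => by rw [e2 b (by omega) (by omega), h1 b hb]
    have e6 : ∀ i < L x, τ t i = v x j i := fun i hi => by rw [e3 i hi, h3 i hi]
    obtain ⟨ω, d, f1, f2, f3, f4⟩ := hP₃ (x, j) ⟨hx, hj⟩ τ
      (Holds.push (hσ.of_agree hφ e5) e6)
    refine ⟨ω, _, .seq e1 f1, ⟨fun b hb => ?_, ?_, fun i hi => ?_, f3 0 one_pos⟩, ?_⟩
    · rw [f2 b (by omega), e5 b hb]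
    · rw [f2 _ (by omega), e2 _ (by omega) (by omega), h2]
    · rw [f2 _ (by omega), e6 i hi]
    · have f5 : d ≤ (Γ.size x + 2) ^ k₃ := f4
      have e7 : (L x + 1) * (2 * (Γ.size x + 2) ^ kv + 30 * L x + 200) =
        (L x + 1) * (2 * (Γ.size x + 2) ^ kv + (30 * L x + 200)) := by ring
      simp only [hCdef]
      omega
  obtain ⟨τ₁, c₁, a1, a2, a3, a4⟩ := hP₁ x hx σ hσ
  obtain ⟨τ₂, c₂, b1, b2, b3, b4⟩ := hP₂ x hx τ₁ (hσ.of_agree hφ1 a2)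
  obtain ⟨τ₃, c₃, d1, d2, d3⟩ := block 0 (Nat.zero_le _) τ₂
    (fun b hb => by rw [b2 b (by omega), a2 b (by omega)])
    (by rw [b2 _ (by omega)]; exact a3 0 one_pos) b3
  have hcost : ∀ j υ, good j υ → (reg (t + 2)).cost υ ≤ 5 := by
    intro j υ h
    rw [reg_cost, h.2.2.2]
    split_ifs
    · rw [bitSize_one]
    · rw [bitSize_zero]; omega
  obtain ⟨υ, c₄, f1, f2, f3⟩ := exec_loop (e := reg (t + 2)) (P := .seq P₄ P₅) (r := n x)
    (C := (Γ.size x + 2) ^ k₄ + (C x + 10)) good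
    (fun j hj υ h => by
      refine ⟨by rw [reg_eval, h.2.2.2, if_pos hj]; exact one_ne_zero, ?_⟩
      obtain ⟨ω, c, g1, g2, g3, g4⟩ := hP₄ (x, j) ⟨hx, hj⟩ υ
        (Holds.push (hσ.of_agree hφ h.1) h.2.2.1)
      obtain ⟨ρ, d, i1, i2, i3⟩ := block (j + 1) hj ω
        (fun b hb => by rw [g2 b (by omega), h.1 b hb])
        (by rw [g2 _ (by omega), h.2.1]) g3
      refine ⟨ρ, _, .seq g1 i1, i2, ?_⟩
      have := hcost j υ h
      have g5 : c ≤ (Γ.size x + 2) ^ k₄ := g4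
      omega)
    (fun υ h => ⟨by rw [reg_eval, h.2.2.2, if_neg (lt_irrefl _)], by
      have := hcost _ υ h; omega⟩) d2
  refine ⟨υ, _, .seq a1 (.seq b1 (.seq d1 f1)), f2.1, f2.2.2.1, ?_⟩
  have := hk x hx
  dsimp only at this
  omega

end Ctx

end TwoSidedScheduling

/-! ### Counted loops, sums, powers and maxima -/

namespace TwoSidedScheduling

namespace Ctx

variable {I J H : Type} {Γ : Ctx I}

theorem PT.toPTA {q : I → ℚ} (h : Γ.PT q) (n : I → ℕ) : Γ.PTA n fun x _ => q x :=
  fun _ _ _ hΔ _ _ _ => h.weak hΔ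

/-- Iteration of a computable step a computable number of times. -/
theorem PTA.iter {n L : I → ℕ} {v : I → ℕ → ℕ → ℚ} (hL : Γ.PB L) (hL' : Γ.PT fun x => (L x : ℚ))
    (hL0 : ∀ x, Γ.dom x → 0 < L x) (hn : Γ.PB n) (hn' : Γ.PT fun x => (n x : ℚ))
    (hv : ∃ k, ∀ x, Γ.dom x → ∀ j ≤ n x, ∀ i < L x, height (v x j i) ≤ (Γ.size x + 2) ^ k)
    (init : Γ.PTA L fun x => v x 0)
    (body : ∀ (J : Type) (Δ : Ctx J) (π : J → I), Ext Δ Γ π → ∀ st : J → ℕ,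
      (∀ y, Δ.dom y → st y < n (π y)) → (Δ.PT fun y => (st y : ℚ)) →
        Δ.PTA (fun y => L (π y)) (fun y => v (π y) (st y)) →
          Δ.PTA (fun y => L (π y)) fun y => v (π y) (st y + 1)) :
    Γ.PTA L fun x => v x (n x) := by
  -- The counter is stored in cell 0 of the state and the old state is moved up by one cell.
  set v' : I → ℕ → ℕ → ℚ := fun x j i => if i = 0 then (j : ℚ) else v x j (i - 1) with hv'
  have hcounter : ∀ (J : Type) (Δ : Ctx J) (π : J → I), Ext Δ Γ π → ∀ st : J → ℕ,
      Δ.PTA (fun y => L (π y) + 1) (fun y => v' (π y) (st y)) →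
      (Δ.PT fun y => (st y : ℚ)) ∧ Δ.PTA (fun y => L (π y)) (fun y => v (π y) (st y)) := by
    intro J Δ π h st hst
    refine ⟨(hst.app (PT.natConst 0) fun _ _ => Nat.succ_pos _).congr fun y _ => by simp [hv'], ?_⟩
    intro K Θ ρ h' idx hidx hlt
    exact (hst _ Θ ρ h' (fun z => idx z + 1) (hidx.natAdd (PT.natConst 1)) fun z hz =>
      Nat.succ_lt_succ (hlt z hz)).congr fun z _ => by simp [hv']
  have hbuild : ∀ (J : Type) (Δ : Ctx J) (π : J → I), Ext Δ Γ π → ∀ st : J → ℕ,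
      (Δ.PT fun y => (st y : ℚ)) → Δ.PTA (fun y => L (π y)) (fun y => v (π y) (st y)) →
      Δ.PTA (fun y => L (π y) + 1) fun y => v' (π y) (st y) := by
    intro J Δ π h st h1 h2 K Θ ρ h' idx hidx hlt
    refine PT.ite_natEq hidx (PT.natConst 0) (h1.weak h') ?_
    -- The branch for idx ≠ 0 is evaluated even when idx = 0. The truncated index 0 must then be in
    -- range, which uses 0 < L.
    refine h2 _ Θ ρ h' (fun z => idx z - 1) (hidx.natSub (PT.natConst 1)) fun z hz => ?_
    have h3 : idx z < L (π (ρ z)) + 1 := hlt z hz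
    have h4 := hL0 _ (h.dom _ (h'.dom z hz))
    show idx z - 1 < L (π (ρ z))
    omega
  obtain ⟨k, hv⟩ := hv
  have key := PTA.while (Γ := Γ) (n := n) (L := fun x => L x + 1) (v := v') (hL.add (PB.const 1))
    (hL'.natAdd (PT.natConst 1)) hn ?_ ?_ ?_ ?_
  · exact (hcounter I Γ _ (Ext.refl Γ) n key).2
  · obtain ⟨l, hl⟩ := (PB.pow_size (Γ := Γ) k).add (hn.add (PB.const 1))
    refine ⟨l, fun x hx j hj i hi => ?_⟩
    have h1 := hl x hx
    dsimp only at h1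
    simp only [hv']
    split_ifs with h0
    · have := height_natCast_le j
      omega
    · have := hv x hx j hj (i - 1) (by omega)
      omega
  · exact hbuild I Γ _ (Ext.refl Γ) (fun _ => 0) (PT.natConst 0) init
  · intro J Δ π h st hst h1
    exact ((hcounter J Δ π h st h1).1.natAdd (PT.natConst 1)).ite_natLe (hn'.weak h)
      (PT.const 1) (PT.const 0)
  · intro J Δ π h st hst h1
    obtain ⟨h2, h3⟩ := hcounter J Δ π h st h1
    exact hbuild J Δ π h (fun y => st y + 1) (h2.natAdd (PT.natConst 1)) (body J Δ π h st hst h2 h3)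

/-- Iteration of a computable step on a number a computable number of times. -/
theorem PT.iter {n : I → ℕ} {g : I → ℕ → ℚ} (hn : Γ.PB n) (hn' : Γ.PT fun x => (n x : ℚ))
    (hg : Γ.PBA (fun x => n x + 1) g) (init : Γ.PT fun x => g x 0)
    (body : ∀ (J : Type) (Δ : Ctx J) (π : J → I), Ext Δ Γ π → ∀ st : J → ℕ,
      (∀ y, Δ.dom y → st y < n (π y)) → (Δ.PT fun y => (st y : ℚ)) →
        (Δ.PT fun y => g (π y) (st y)) → Δ.PT fun y => g (π y) (st y + 1)) :
    Γ.PT fun x => g x (n x) := by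
  obtain ⟨k, hg⟩ := hg
  refine (PTA.iter (Γ := Γ) (n := n) (L := fun _ => 1) (v := fun x j _ => g x j) (PB.const 1)
    (PT.natConst 1) (fun _ _ => one_pos) hn hn'
    ⟨k, fun x hx j hj i _ => hg x hx j (Nat.lt_succ_of_le hj)⟩ (init.toPTA _) ?_).app
    (PT.natConst 0) fun _ _ => one_pos
  intro J Δ π h st hst h1 h2
  exact (body J Δ π h st hst h1 (h2.app (PT.natConst 0) fun _ _ => one_pos)).toPTA _

/-- Iteration of a computable step on a number while a computable test succeeds. -/
theorem PT.while {n : I → ℕ} {g : I → ℕ → ℚ} (hn : Γ.PB n)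
    (hg : Γ.PBA (fun x => n x + 1) g) (init : Γ.PT fun x => g x 0)
    (cond : ∀ (J : Type) (Δ : Ctx J) (π : J → I), Ext Δ Γ π → ∀ st : J → ℕ,
      (∀ y, Δ.dom y → st y ≤ n (π y)) → (Δ.PT fun y => g (π y) (st y)) →
        Δ.PT fun y => if st y < n (π y) then 1 else 0)
    (body : ∀ (J : Type) (Δ : Ctx J) (π : J → I), Ext Δ Γ π → ∀ st : J → ℕ,
      (∀ y, Δ.dom y → st y < n (π y)) → (Δ.PT fun y => g (π y) (st y)) →
        Δ.PT fun y => g (π y) (st y + 1)) :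
    Γ.PT fun x => g x (n x) := by
  obtain ⟨k, hg⟩ := hg
  refine (PTA.while (Γ := Γ) (n := n) (L := fun _ => 1) (v := fun x j _ => g x j) (PB.const 1)
    (PT.natConst 1) hn
    ⟨k, fun x hx j hj i _ => hg x hx j (Nat.lt_succ_of_le hj)⟩ (init.toPTA _) ?_ ?_).app
    (PT.natConst 0) fun _ _ => one_pos
  · intro J Δ π h st hst h2
    exact cond J Δ π h st hst (h2.app (PT.natConst 0) fun _ _ => one_pos)
  · intro J Δ π h st hst h2
    exact (body J Δ π h st hst (h2.app (PT.natConst 0) fun _ _ => one_pos)).toPTA _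

theorem height_sum_le (f : ℕ → ℚ) {n B : ℕ} (h : ∀ j < n, height (f j) ≤ B) :
    height (∑ j ∈ Finset.range n, f j) ≤ n * (B + 1) + 1 := by
  induction n with
  | zero => simp [height_zero]
  | succ n ih =>
    rw [Finset.sum_range_succ]
    have h1 := height_add_le (∑ j ∈ Finset.range n, f j) (f n)
    have h2 := ih fun j hj => h j (by omega)
    have h3 := h n (by omega)
    rw [Nat.succ_mul]
    omega

theorem PT.sum {n : I → ℕ} {f : I → ℕ → ℚ} (hn : Γ.PB n) (hn' : Γ.PT fun x => (n x : ℚ))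
    (hf : Γ.PTA n f) : Γ.PT fun x => ∑ j ∈ Finset.range (n x), f x j := by
  obtain ⟨B, hB, hle⟩ := (hf.bound hn).exists_bound
  refine PT.iter (g := fun x j => ∑ i ∈ Finset.range j, f x i) hn hn' ?_ ?_ ?_
  · refine PBA.of_le ((hn.mul (hB.add (PB.const 1))).add (PB.const 1)) fun x hx j hj => ?_
    refine (height_sum_le _ fun i hi => hle x hx i (by omega)).trans ?_
    have : j * (B x + 1) ≤ n x * (B x + 1) := Nat.mul_le_mul_right _ (by omega)
    omega
  · simpa using PT.const 0
  · intro J Δ π h st hst h1 h2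
    simp only [Finset.sum_range_succ]
    exact h2.add (hf _ Δ π h st h1 hst)

theorem height_two_pow_le (k : ℕ) : height (2 ^ k : ℚ) ≤ k + 1 := by
  have e : (2 ^ k : ℚ) = ((2 ^ k : ℕ) : ℚ) := by push_cast; rfl
  rw [e, height_le_iff]
  simp only [Rat.num_natCast, Int.natAbs_natCast, Rat.den_natCast]
  exact ⟨Nat.pow_lt_pow_right (by norm_num) (by omega), Nat.one_lt_two_pow (by omega)⟩

/-- The exponent itself, not just its bit length, has to be polynomially bounded, since 2^k has
about k bits. -/
theorem PT.two_pow {k : I → ℕ} (hk : Γ.PB k) (hk' : Γ.PT fun x => (k x : ℚ)) :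
    Γ.PT fun x => (2 : ℚ) ^ k x := by
  refine PT.iter (g := fun _ j => (2 : ℚ) ^ j) hk hk' ?_ ?_ ?_
  · exact PBA.of_le (hk.add (PB.const 1)) fun x hx j hj => (height_two_pow_le j).trans (by omega)
  · simpa using PT.const 1
  · intro J Δ π h st hst h1 h2
    exact ((PT.const 2).mul h2).congr fun y _ => (pow_succ' _ _).symm

/-- The largest of the numbers `0, f 0, …, f (n - 1)`. -/
def _root_.TwoSidedScheduling.maxUpTo (f : ℕ → ℚ) : ℕ → ℚ
  | 0 => 0
  | n + 1 => Max.max (maxUpTo f n) (f n)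

theorem PT.maxUpTo {n : I → ℕ} {f : I → ℕ → ℚ} (hn : Γ.PB n) (hn' : Γ.PT fun x => (n x : ℚ))
    (hf : Γ.PTA n f) : Γ.PT fun x => maxUpTo (f x) (n x) := by
  obtain ⟨B, hB, hle⟩ := (hf.bound hn).exists_bound
  refine PT.iter (g := fun x j => TwoSidedScheduling.maxUpTo (f x) j) hn hn' ?_ (PT.const 0) ?_
  · refine PBA.of_le (hB.add (PB.const 1)) fun x hx j hj => ?_
    have : ∀ j ≤ n x, height (TwoSidedScheduling.maxUpTo (f x) j) ≤ B x + 1 := by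
      intro j
      induction j with
      | zero => intro _; exact height_zero.le.trans (by omega)
      | succ j ih =>
        intro hj
        rw [TwoSidedScheduling.maxUpTo]
        rcases max_choice (TwoSidedScheduling.maxUpTo (f x) j) (f x j) with h | h <;> rw [h]
        · exact ih (by omega)
        · exact (hle x hx j hj).trans (by omega)
    exact this j (by omega)
  · intro J Δ π h st hst h1 h2
    exact h2.max (hf _ Δ π h st h1 hst)

end Ctx

/-! ### Rounding and doubling -/

theorem le_two_pow_height (q : ℚ) : q ≤ 2 ^ height q := by
  have h1 : q ≤ (q.num.natAbs : ℚ) := by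
    calc q ≤ |q| := le_abs_self q
      _ = |(q.num : ℚ)| / q.den := by
        conv_lhs => rw [← Rat.num_div_den q]
        rw [abs_div, Nat.abs_cast]
      _ ≤ |(q.num : ℚ)| := div_le_self (abs_nonneg _) (by exact_mod_cast q.den_pos)
      _ = (q.num.natAbs : ℚ) := by rw [Nat.cast_natAbs, Int.cast_abs]
  exact h1.trans (by exact_mod_cast (num_lt q).le)

theorem inv_two_pow_height_le {q : ℚ} (hq : 0 < q) : (2 ^ height q)⁻¹ ≤ q := by
  have h1 := le_two_pow_height q⁻¹
  have h2 : (2 : ℚ) ^ height q⁻¹ ≤ 2 ^ height q :=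
    pow_le_pow_right₀ (by norm_num) (height_inv_le q)
  rw [inv_le_comm₀ (by positivity) hq]
  exact h1.trans h2

/-- This bounds the number of halvings or doublings needed to find the rounded value. -/
theorem natAbs_log_le {q : ℚ} (hq : 0 < q) : (Int.log 2 q).natAbs ≤ height q := by
  have h1 : Int.log 2 q ≤ height q := by
    have h := (Int.zpow_log_le_self one_lt_two hq).trans (le_two_pow_height q)
    rw [← zpow_natCast (2 : ℚ)] at h
    have h' : (2 : ℚ) ^ Int.log 2 q ≤ 2 ^ ((height q : ℕ) : ℤ) := by
      rw [zpow_natCast] at h ⊢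
      push_cast at h
      exact h
    exact (zpow_le_zpow_iff_right₀ (one_lt_two (α := ℚ))).1 h'
  have h2 : -(height q : ℤ) ≤ Int.log 2 q := by
    have h := inv_two_pow_height_le hq
    rw [← zpow_natCast, ← zpow_neg] at h
    exact (Int.zpow_le_iff_le_log one_lt_two hq).1 (by exact_mod_cast h)
  omega

/-- Rounding down to a power of two. -/
def roundDown (q : ℚ) : ℚ :=
  2 ^ Int.log 2 q

theorem roundDown_pos (q : ℚ) : 0 < roundDown q :=
  zpow_pos two_pos _

namespace Ctx

variable {I J H : Type} {Γ : Ctx I}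

/-- Starting from 1, halve while the value exceeds q, then double while the doubled value is still
at most q. At most one of the two loops does anything, and both tests use only the current value. -/
theorem PT.roundDown {q : I → ℚ} (hq : Γ.PT q) (h0 : ∀ x, Γ.dom x → 0 < q x) :
    Γ.PT fun x => roundDown (q x) := by
  set a : I → ℕ := fun x => (-Int.log 2 (q x)).toNat with ha
  set b : I → ℕ := fun x => (Int.log 2 (q x)).toNat with hb
  have hlog : ∀ x, Γ.dom x → (Int.log 2 (q x)).natAbs ≤ height (q x) :=
    fun x hx => natAbs_log_le (h0 x hx)
  have hle : ∀ x, Γ.dom x → ∀ z : ℤ, (2 : ℚ) ^ z ≤ q x ↔ z ≤ Int.log 2 (q x) := fun x hx z => by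
    have := Int.zpow_le_iff_le_log (R := ℚ) (b := 2) one_lt_two (h0 x hx) (x := z)
    exact_mod_cast this
  have haPB : Γ.PB a := hq.1.mono fun x hx => by have := hlog x hx; simp only [ha]; omega
  have hbPB : Γ.PB b := hq.1.mono fun x hx => by have := hlog x hx; simp only [hb]; omega
  have e1 : ∀ j : ℕ, (1 / 2 : ℚ) ^ j = 2 ^ (-(j : ℤ)) := fun j => by
    rw [zpow_neg, zpow_natCast, one_div, inv_pow]
  have hA : Γ.PT fun x => (1 / 2 : ℚ) ^ a x := by
    refine PT.while (g := fun _ j => (1 / 2 : ℚ) ^ j) haPB ?_ ?_ ?_ ?_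
    · refine PBA.of_le (haPB.add (PB.const 2)) fun x hx j hj => ?_
      rw [one_div, inv_pow]
      exact (height_inv_le _).trans ((height_two_pow_le j).trans (by omega))
    · simpa using PT.const 1
    · intro J Δ π h st hst h1
      refine ((hq.weak h).ite_lt h1 (PT.const 1) (PT.const 0)).congr fun y hy => ?_
      have := hle (π y) (h.dom y hy) (-(st y : ℤ))
      rw [← e1, ← not_lt] at this
      have h3 : q (π y) < (1 / 2 : ℚ) ^ st y ↔ st y < a (π y) := by
        rw [← not_iff_not, this]
        simp only [ha]; omega
      simp only [h3]
    · intro J Δ π h st hst h1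
      exact ((PT.const (1 / 2)).mul h1).congr fun y _ => (pow_succ' _ _).symm
  have hB : Γ.PT fun x => (2 : ℚ) ^ b x * (1 / 2 : ℚ) ^ a x := by
    refine PT.while (g := fun x j => (2 : ℚ) ^ j * (1 / 2 : ℚ) ^ a x) hbPB ?_ ?_ ?_ ?_
    · refine PBA.of_le ((hbPB.add (PB.const 1)).add hA.1) fun x hx j hj => ?_
      refine (height_mul_le _ _).trans ?_
      have := height_two_pow_le j
      dsimp only
      omega
    · simpa using hA
    · intro J Δ π h st hst h1
      refine (((PT.const 2).mul h1).ite_le (hq.weak h) (PT.const 1) (PT.const 0)).congr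
        fun y hy => ?_
      have h2 := hle (π y) (h.dom y hy) (st y + 1 - a (π y))
      have e2 : (2 : ℚ) ^ ((st y : ℤ) + 1 - a (π y)) = 2 * (2 ^ st y * (1 / 2) ^ a (π y)) := by
        rw [e1, ← zpow_natCast (2 : ℚ) (st y), ← zpow_add₀ (by norm_num),
          ← zpow_one_add₀ (by norm_num)]
        congr 1; ring
      rw [e2] at h2
      have h3 : 2 * ((2 : ℚ) ^ st y * (1 / 2) ^ a (π y)) ≤ q (π y) ↔ st y < b (π y) := by
        rw [h2]; simp only [ha, hb]; omega
      simp only [h3]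
    · intro J Δ π h st hst h1
      exact ((PT.const 2).mul h1).congr fun y _ => by rw [pow_succ']; ring
  refine hB.congr fun x _ => ?_
  rw [TwoSidedScheduling.roundDown, e1, ← zpow_natCast (2 : ℚ) (b x), ← zpow_add₀ (by norm_num)]
  congr 1
  simp only [ha, hb]; omega

theorem PT.doubling {g y : I → ℚ} (hg : Γ.PT g) (hy : Γ.PT y) (h0 : ∀ x, Γ.dom x → 0 < g x) :
    Γ.PT fun x => doubling (g x) (y x) := by
  set n : I → ℕ := fun x => sInf {z : ℕ | y x ≤ 2 ^ z * g x} with hn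
  -- From y ≤ 2^height(y) and g ≥ 2^(-height(g)), so the number of doublings is at most the sum of
  -- the heights.
  have hmem : ∀ x, Γ.dom x → y x ≤ 2 ^ (height (y x) + height (g x)) * g x := by
    intro x hx
    have h1 := le_two_pow_height (y x)
    have h2 := inv_two_pow_height_le (h0 x hx)
    rw [inv_le_iff_one_le_mul₀' (by positivity)] at h2
    rw [pow_add, mul_assoc]
    have h3 : (0 : ℚ) < 2 ^ height (y x) := by positivity
    nlinarith
  have hnPB : Γ.PB n := (hy.1.add hg.1).mono fun x hx => Nat.sInf_le (hmem x hx)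
  refine PT.while (g := fun x j => 2 ^ j * g x) hnPB ?_ ?_ ?_ ?_
  · refine PBA.of_le ((hnPB.add (PB.const 1)).add hg.1) fun x hx j hj => ?_
    have hj' : j < n x + 1 := hj
    refine (height_mul_le _ _).trans ?_
    have := height_two_pow_le j
    omega
  · simpa using hg
  · intro J Δ π h st hst h1
    refine (h1.ite_lt (hy.weak h) (PT.const 1) (PT.const 0)).congr fun z hz => ?_
    have hx := h.dom z hz
    have h2 : 2 ^ st z * g (π z) < y (π z) ↔ st z < n (π z) := by
      constructor
      · intro hlt
        by_contra hc
        have h3 : y (π z) ≤ 2 ^ n (π z) * g (π z) :=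
          Nat.sInf_mem (s := {k : ℕ | y (π z) ≤ 2 ^ k * g (π z)}) ⟨_, hmem _ hx⟩
        have h4 : (2 : ℚ) ^ n (π z) * g (π z) ≤ 2 ^ st z * g (π z) :=
          mul_le_mul_of_nonneg_right (pow_le_pow_right₀ (by norm_num) (not_lt.1 hc)) (h0 _ hx).le
        linarith
      · intro hlt
        have := Nat.notMem_of_lt_sInf hlt
        exact not_le.1 this
    simp only [h2, hn]
  · intro J Δ π h st hst h1
    exact ((PT.const 2).mul h1).congr fun z _ => by rw [pow_succ']; ring

end Ctx

end TwoSidedScheduling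

namespace TwoSidedScheduling

/-! ### The allocation on rational data -/

/-- The largest rounded speed. -/
def ratTop (m : ℕ) (s : ℕ → ℚ) : ℚ :=
  maxUpTo (fun i => roundDown (s i)) m

/-- The speed of group `k`. -/
def ratLevelSpeed (m : ℕ) (s : ℕ → ℚ) (k : ℕ) : ℚ :=
  ratTop m s / 2 ^ (k - 1)

/-- The total rounded speed of the groups `1, …, k`. -/
def ratCapacity (m : ℕ) (s : ℕ → ℚ) (k : ℕ) : ℚ :=
  ∑ i ∈ Finset.range m, if ratLevelSpeed m s k ≤ roundDown (s i) then roundDown (s i) else 0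

/-- The capacities relative to the top speed. -/
def ratWeight (m : ℕ) (s : ℕ → ℚ) (k : ℕ) : ℚ :=
  ratCapacity m s k / ratTop m s

/-- The fraction of a job of level `k` that is put on machine `i`. -/
def ratFraction (m : ℕ) (s : ℕ → ℚ) (k i : ℕ) : ℚ :=
  if ratLevelSpeed m s k ≤ roundDown (s i) then roundDown (s i) / ratCapacity m s k else 0

/-- The scaled state after the jobs `0, …, j`. -/
noncomputable def ratState (K : ℕ) (w p : ℕ → ℚ) : ℕ → ℚ × (ℕ → ℚ)
  | 0 => (p 0, fun _ => 0)
  | j + 1 => scaledStep K w (ratState K w p j) (p (j + 1))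

/-- The level of a job of size `x` that arrives as number `j`. -/
noncomputable def ratLevel (K : ℕ) (w p : ℕ → ℚ) (j : ℕ) (x : ℚ) : ℕ :=
  if j = 0 then 1 else scaledLevel K (ratState K w p (j - 1)).1 x

/-- The expected load of machine `i`. -/
noncomputable def ratLoad (m : ℕ) (s : ℕ → ℚ) (n : ℕ) (p : ℕ → ℚ) (i : ℕ) : ℚ :=
  ∑ j ∈ Finset.range n,
    ratFraction m s (ratLevel (numLevels m) (ratWeight m s) p j (p j)) i * p j

/-- Written without pairs and updates, each component of the step is a nest of tests, the form in
which it is later evaluated cell by cell. -/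
theorem scaledStep_fst {𝕜 : Type*} [Field 𝕜] [LinearOrder 𝕜] [IsStrictOrderedRing 𝕜] (K : ℕ)
    (w : ℕ → 𝕜) (S : 𝕜 × (ℕ → 𝕜)) (x : 𝕜) :
    (scaledStep K w S x).1 = if scaledLevel K S.1 x ≤ K - 1 then
      if S.1 < x then doubling S.1 x else
        if S.1 < S.2 (scaledLevel K S.1 x) + x / w (scaledLevel K S.1 x) then 2 * S.1 else S.1
      else S.1 := by
  simp only [scaledStep, Function.update_self]
  split_ifs <;> rfl

theorem scaledStep_snd {𝕜 : Type*} [Field 𝕜] [LinearOrder 𝕜] [IsStrictOrderedRing 𝕜] (K : ℕ)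
    (w : ℕ → 𝕜) (S : 𝕜 × (ℕ → 𝕜)) (x : 𝕜) (i : ℕ) :
    (scaledStep K w S x).2 i =
      if i = scaledLevel K S.1 x then
        if scaledLevel K S.1 x ≤ K - 1 then
          if S.1 < x then 0 else
            if S.1 < S.2 (scaledLevel K S.1 x) + x / w (scaledLevel K S.1 x) then 0 else
              S.2 (scaledLevel K S.1 x) + x / w (scaledLevel K S.1 x)
        else S.2 (scaledLevel K S.1 x) + x / w (scaledLevel K S.1 x)
      else
        if scaledLevel K S.1 x ≤ K - 1 then
          if S.1 < x then 0 else
            if S.1 < S.2 (scaledLevel K S.1 x) + x / w (scaledLevel K S.1 x) then 0 else S.2 i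
        else S.2 i := by
  simp only [scaledStep, Function.update_self]
  by_cases h : i = scaledLevel K S.1 x
  · rw [if_pos h]
    split_ifs <;> simp [h]
  · rw [if_neg h]
    split_ifs <;> simp [h]

/-- A doubling forced by a large job never brings the exponent above Z, because all sizes are at
most 2^Z p_0. Any other doubling raises the exponent by one and happens at most once per job. The
guess therefore has a short description. -/
theorem ratState_guess {K : ℕ} {w p : ℕ → ℚ} {n Z : ℕ} (h0 : 0 < p 0)
    (hp : ∀ j < n, p j ≤ 2 ^ Z * p 0) :
    ∀ j < n, ∃ z ≤ Z + j, (ratState K w p j).1 = 2 ^ z * p 0 := by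
  intro j
  induction j with
  | zero => exact fun _ => ⟨0, Nat.zero_le _, by simp [ratState]⟩
  | succ j ih =>
    intro hj
    obtain ⟨z, hz, e⟩ := ih (by omega)
    rw [ratState, scaledStep_fst]
    split_ifs with h1 h2 h3
    · rw [e] at h2 ⊢
      obtain ⟨y, hy⟩ : ∃ y, sInf {k : ℕ | p (j + 1) ≤ 2 ^ k * (2 ^ z * p 0)} = y := ⟨_, rfl⟩
      refine ⟨y + z, ?_, by rw [doubling, hy, pow_add, mul_assoc]⟩
      have hlt : 2 ^ z * p 0 < 2 ^ Z * p 0 := h2.trans_le (hp _ hj)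
      have hzZ : z < Z := by
        by_contra hc
        have : (2 : ℚ) ^ Z ≤ 2 ^ z := pow_le_pow_right₀ (by norm_num) (not_lt.1 hc)
        nlinarith
      have : y ≤ Z - z := by
        rw [← hy]
        refine Nat.sInf_le ?_
        rw [Set.mem_ofPred_eq, ← mul_assoc, ← pow_add, Nat.sub_add_cancel hzZ.le]
        exact hp _ hj
      omega
    · exact ⟨z + 1, by omega, by rw [e, pow_succ]; ring⟩
    · exact ⟨z, by omega, e⟩
    · exact ⟨z, by omega, e⟩

/-- Each job adds at most one quotient to a time, or resets it to 0, so the heights grow additively.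
-/
theorem height_ratState_time {K : ℕ} (hK : 1 ≤ K) {w p : ℕ → ℚ} {n B : ℕ}
    (hB : ∀ j < n, ∀ k ≤ K, height (p j / w k) ≤ B) :
    ∀ j < n, ∀ k, height ((ratState K w p j).2 k) ≤ j * (B + 1) + 1 := by
  intro j
  induction j with
  | zero => exact fun _ k => by simp [ratState, height_zero]
  | succ j ih =>
    intro hj k
    have h1 : ∀ k, height ((ratState K w p j).2 k) ≤ (j + 1) * (B + 1) + 1 := fun k =>
      (ih (by omega) k).trans (by rw [add_mul]; omega)
    have h2 : ∀ k, k ≤ K → height ((ratState K w p j).2 k + p (j + 1) / w k) ≤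
        (j + 1) * (B + 1) + 1 := fun k hk => by
      have := height_add_le ((ratState K w p j).2 k) (p (j + 1) / w k)
      have := hB (j + 1) hj k hk
      have := ih (by omega) k
      rw [add_mul]; omega
    have h3 := h2 _ (scaledLevel_le hK (ratState K w p j).1 (p (j + 1)))
    have h4 : height 0 ≤ (j + 1) * (B + 1) + 1 := height_zero.le.trans (by omega)
    rw [ratState, scaledStep_snd]
    split_ifs <;> first | exact h4 | exact h3 | exact h1 _

theorem le_two_pow_mul {a b : ℚ} {B : ℕ} (hb : 0 < b) (ha : height a ≤ B) (hb' : height b ≤ B) :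
    a ≤ 2 ^ (2 * B) * b := by
  have h1 : a ≤ 2 ^ B := (le_two_pow_height a).trans (pow_le_pow_right₀ (by norm_num) ha)
  have h2 : (1 : ℚ) ≤ 2 ^ B * b := by
    have := inv_two_pow_height_le hb
    rw [inv_le_iff_one_le_mul₀' (by positivity)] at this
    exact this.trans (by gcongr; norm_num)
  rw [two_mul, pow_add, mul_assoc]
  have : (0 : ℚ) < 2 ^ B := by positivity
  nlinarith

/-- The thresholds decrease, so the accepting levels form an initial segment and the largest one is
their number. The maximum with 1 covers the case of none. -/
theorem scaledLevel_eq_sum {𝕜 : Type*} [Field 𝕜] [LinearOrder 𝕜] [IsStrictOrderedRing 𝕜] {K : ℕ}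
    {g x : 𝕜} (hg : 0 ≤ g) :
    scaledLevel K g x = max 1 (∑ k ∈ Finset.range K, if x ≤ g / 2 ^ k then 1 else 0) := by
  rcases Nat.eq_zero_or_pos K with rfl | hK
  · simp [scaledLevel]
  rw [← Finset.card_filter]
  apply le_antisymm
  · rcases scaledLevel_mem K g x with h | h
    · rw [h]; exact le_max_left _ _
    · refine le_max_of_le_right ?_
      have hsub : Finset.range (scaledLevel K g x) ⊆
          (Finset.range K).filter fun k => x ≤ g / 2 ^ k := fun k hk => by
        have h1 := scaledLevel_le hK g x
        rw [Finset.mem_range] at hk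
        exact Finset.mem_filter.2 ⟨Finset.mem_range.2 (by omega),
          h.trans (div_two_pow_le hg (by omega))⟩
      simpa using Finset.card_le_card hsub
  · refine max_le (one_le_scaledLevel _ _ _) ?_
    have hsub : ((Finset.range K).filter fun k => x ≤ g / 2 ^ k) ⊆
        Finset.range (scaledLevel K g x) := fun k hk => by
      rw [Finset.mem_filter, Finset.mem_range] at hk
      rw [Finset.mem_range]
      exact le_scaledLevel (k := k + 1) (by omega) (by omega) (by simpa using hk.2)
    simpa using Finset.card_le_card hsub

theorem numLevels_eq_sum {m : ℕ} (hm : 0 < m) :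
    numLevels m = ∑ k ∈ Finset.range m, if 2 ^ k ≤ m then 1 else 0 := by
  rw [← Finset.card_filter]
  have : ((Finset.range m).filter fun k => 2 ^ k ≤ m) = Finset.range (numLevels m) := by
    ext k
    rw [Finset.mem_filter, Finset.mem_range, Finset.mem_range, numLevels, Nat.lt_succ_iff,
      Nat.le_log_iff_pow_le one_lt_two hm.ne']
    exact ⟨fun h => h.2, fun h => ⟨Nat.lt_two_pow_self.trans_le h, h⟩⟩
  rw [this, Finset.card_range]

theorem numLevels_le_self {m : ℕ} (hm : 0 < m) : numLevels m ≤ m := by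
  have h1 : 2 ^ (numLevels m - 1) ≤ m := Nat.pow_log_le_self 2 hm.ne'
  have h2 := Nat.lt_two_pow_self (n := numLevels m - 1)
  omega

theorem ratLevel_le {m : ℕ} (w p : ℕ → ℚ) (j : ℕ) (x : ℚ) :
    ratLevel (numLevels m) w p j x ≤ numLevels m := by
  rw [ratLevel]
  split_ifs
  · exact one_le_numLevels m
  · exact scaledLevel_le (one_le_numLevels m) _ _

/-! ### Polynomial-time computation of levels, fractions and expected loads -/

namespace Ctx

variable {I J H : Type} {Γ : Ctx I} {Δ : Ctx J} {π : J → I}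

theorem PB.of_lt (h : Ext Δ Γ π) {n : I → ℕ} (hn : Γ.PB n) {idx : J → ℕ}
    (hlt : ∀ y, Δ.dom y → idx y < n (π y)) : Δ.PB idx :=
  (hn.weak h).mono fun y hy => (hlt y hy).le

theorem PT.natSum {n : I → ℕ} {f : I → ℕ → ℕ} (hn : Γ.PB n) (hn' : Γ.PT fun x => (n x : ℚ))
    (hf : Γ.PTA n fun x i => (f x i : ℚ)) :
    Γ.PT fun x => ((∑ j ∈ Finset.range (n x), f x j : ℕ) : ℚ) :=
  (PT.sum hn hn' hf).congr fun x _ => by push_cast; rfl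

theorem PT.numLevels {m : I → ℕ} (hm : Γ.PB m) (hm' : Γ.PT fun x => (m x : ℚ))
    (h0 : ∀ x, Γ.dom x → 0 < m x) : Γ.PT fun x => (numLevels (m x) : ℚ) := by
  refine (PT.natSum (f := fun x k => if 2 ^ k ≤ m x then 1 else 0) hm hm' ?_).congr
    fun x hx => by rw [numLevels_eq_sum (h0 x hx)]
  intro J Δ π h idx hidx hlt
  refine ((PT.two_pow (PB.of_lt h hm hlt) hidx).ite_le (hm'.weak h) (PT.const 1)
    (PT.const 0)).congr fun y _ => ?_
  have : (2 : ℚ) ^ idx y ≤ m (π y) ↔ 2 ^ idx y ≤ m (π y) := by exact_mod_cast Iff.rfl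
  simp only [this, Nat.cast_ite, Nat.cast_one, Nat.cast_zero]

theorem PB.numLevels {m : I → ℕ} (hm : Γ.PB m) (h0 : ∀ x, Γ.dom x → 0 < m x) :
    Γ.PB fun x => numLevels (m x) :=
  hm.mono fun x hx => numLevels_le_self (h0 x hx)

theorem PT.scaledLevel {K : I → ℕ} {g q : I → ℚ} (hK : Γ.PB K) (hK' : Γ.PT fun x => (K x : ℚ))
    (hg : Γ.PT g) (hq : Γ.PT q) (h0 : ∀ x, Γ.dom x → 0 ≤ g x) :
    Γ.PT fun x => (scaledLevel (K x) (g x) (q x) : ℚ) := by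
  refine ((PT.const 1).max (PT.natSum (f := fun x k => if q x ≤ g x / 2 ^ k then 1 else 0) hK hK'
    ?_)).congr fun x hx => by
      rw [scaledLevel_eq_sum (h0 x hx), Nat.cast_max, Nat.cast_one]
  intro J Δ π h idx hidx hlt
  refine ((hq.weak h).ite_le ((hg.weak h).div (PT.two_pow (PB.of_lt h hK hlt) hidx)) (PT.const 1)
    (PT.const 0)).congr fun y _ => ?_
  push_cast
  rfl

/-- The speeds `s x i > 0` of `m x ≥ 1` machines are computable in polynomial time. -/
structure Speeds (Γ : Ctx I) (m : I → ℕ) (s : I → ℕ → ℚ) : Prop where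
  pb : Γ.PB m
  pt : Γ.PT fun x => (m x : ℚ)
  m_pos : ∀ x, Γ.dom x → 0 < m x
  pta : Γ.PTA m s
  pos : ∀ x, Γ.dom x → ∀ i < m x, 0 < s x i

/-- The sizes `p x j > 0` of `n x` jobs are computable in polynomial time. -/
structure Sizes (Γ : Ctx I) (n : I → ℕ) (p : I → ℕ → ℚ) : Prop where
  pb : Γ.PB n
  pt : Γ.PT fun x => (n x : ℚ)
  pta : Γ.PTA n p
  pos : ∀ x, Γ.dom x → ∀ j < n x, 0 < p x j

variable {m n : I → ℕ} {s p : I → ℕ → ℚ}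

theorem Speeds.weak (h : Ext Δ Γ π) (hs : Γ.Speeds m s) :
    Δ.Speeds (fun y => m (π y)) fun y => s (π y) :=
  ⟨hs.pb.weak h, hs.pt.weak h, fun y hy => hs.m_pos _ (h.dom y hy), hs.pta.weak h,
    fun y hy => hs.pos _ (h.dom y hy)⟩

theorem Sizes.weak (h : Ext Δ Γ π) (hp : Γ.Sizes n p) :
    Δ.Sizes (fun y => n (π y)) fun y => p (π y) :=
  ⟨hp.pb.weak h, hp.pt.weak h, hp.pta.weak h, fun y hy => hp.pos _ (h.dom y hy)⟩

theorem Speeds.round (hs : Γ.Speeds m s) : Γ.PTA m fun x i => roundDown (s x i) :=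
  fun J Δ π h idx hidx hlt => (hs.pta J Δ π h idx hidx hlt).roundDown fun y hy =>
    hs.pos _ (h.dom y hy) _ (hlt y hy)

theorem Speeds.top (hs : Γ.Speeds m s) : Γ.PT fun x => ratTop (m x) (s x) :=
  PT.maxUpTo hs.pb hs.pt hs.round

theorem Speeds.levelSpeed (hs : Γ.Speeds m s) {k : I → ℕ} (hk : Γ.PB k)
    (hk' : Γ.PT fun x => (k x : ℚ)) : Γ.PT fun x => ratLevelSpeed (m x) (s x) (k x) :=
  hs.top.div (PT.two_pow (hk.mono fun _ _ => Nat.sub_le _ _) (hk'.natSub (PT.natConst 1)))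

theorem Speeds.capacity (hs : Γ.Speeds m s) {k : I → ℕ} (hk : Γ.PB k)
    (hk' : Γ.PT fun x => (k x : ℚ)) : Γ.PT fun x => ratCapacity (m x) (s x) (k x) := by
  refine PT.sum hs.pb hs.pt fun J Δ π h idx hidx hlt => ?_
  have hr := hs.round J Δ π h idx hidx hlt
  exact ((hs.levelSpeed hk hk').weak h).ite_le hr hr (PT.const 0)

theorem Speeds.fraction (hs : Γ.Speeds m s) {k i : I → ℕ} (hk : Γ.PB k)
    (hk' : Γ.PT fun x => (k x : ℚ)) (hi : Γ.PT fun x => (i x : ℚ))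
    (hlt : ∀ x, Γ.dom x → i x < m x) : Γ.PT fun x => ratFraction (m x) (s x) (k x) (i x) := by
  have hr := hs.round.app hi hlt
  exact (hs.levelSpeed hk hk').ite_le hr (hr.div (hs.capacity hk hk')) (PT.const 0)

theorem Speeds.numLevels (hs : Γ.Speeds m s) :
    Γ.PT fun x => (TwoSidedScheduling.numLevels (m x) : ℚ) :=
  PT.numLevels hs.pb hs.pt hs.m_pos

theorem Speeds.weight (hs : Γ.Speeds m s) :
    Γ.PTA (fun x => TwoSidedScheduling.numLevels (m x) + 1) fun x => ratWeight (m x) (s x) :=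
  fun J Δ π h idx hidx hlt => by
    have hs' := hs.weak h
    have hK := PB.numLevels hs'.pb hs'.m_pos
    exact (hs'.capacity ((hK.add (PB.const 1)).mono fun y hy => (hlt y hy).le) hidx).div hs'.top

theorem Speeds.update (hs : Γ.Speeds m s) {v : I → ℚ} {i : I → ℕ} (hv : Γ.PT v)
    (hv0 : ∀ x, Γ.dom x → 0 < v x) (hi : Γ.PT fun x => (i x : ℚ)) :
    Γ.Speeds m fun x => Function.update (s x) (i x) (v x) where
  pb := hs.pb
  pt := hs.pt
  m_pos := hs.m_pos
  pta := fun J Δ π h idx hidx hlt =>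
    (hidx.ite_natEq (hi.weak h) (hv.weak h) (hs.pta J Δ π h idx hidx hlt)).congr fun y _ => by
      simp only [Function.update_apply]
  pos := fun x hx j hj => by
    rw [Function.update_apply]
    split_ifs
    · exact hv0 x hx
    · exact hs.pos x hx j hj

theorem Sizes.exists_bound (hp : Γ.Sizes n p) : ∃ B : I → ℕ, Γ.PB B ∧
    ∀ x, Γ.dom x → ∀ j < n x, height (p x j) ≤ B x :=
  (hp.pta.bound hp.pb).exists_bound

theorem Sizes.guess_eq (hp : Γ.Sizes n p) (K : I → ℕ) (w : I → ℕ → ℚ) : ∃ Z : I → ℕ, Γ.PB Z ∧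
    ∀ x, Γ.dom x → ∀ j < n x, ∃ z ≤ Z x, (ratState (K x) (w x) (p x) j).1 = 2 ^ z * p x 0 := by
  obtain ⟨B, hB, hle⟩ := hp.exists_bound
  refine ⟨fun x => 2 * B x + n x, ((PB.const 2).mul hB).add hp.pb, fun x hx j hj => ?_⟩
  have h0 : 0 < n x := by omega
  obtain ⟨z, hz, e⟩ := ratState_guess (K := K x) (w := w x) (p := p x) (n := n x) (Z := 2 * B x)
    (hp.pos x hx 0 h0) (fun i hi => le_two_pow_mul (hp.pos x hx 0 h0) (hle x hx i hi)
      (hle x hx 0 h0)) j hj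
  exact ⟨z, hz.trans (Nat.add_le_add_left hj.le _), e⟩

theorem Sizes.guess_pos (hp : Γ.Sizes n p) (K : I → ℕ) (w : I → ℕ → ℚ) {x : I} (hx : Γ.dom x)
    {j : ℕ} (hj : j < n x) : 0 < (ratState (K x) (w x) (p x) j).1 := by
  obtain ⟨Z, -, hZ⟩ := hp.guess_eq K w
  obtain ⟨z, -, e⟩ := hZ x hx j hj
  rw [e]
  have := hp.pos x hx 0 (by omega)
  positivity

theorem Sizes.guess (hp : Γ.Sizes n p) {K : I → ℕ} {w : I → ℕ → ℚ} (hK : Γ.PB K)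
    (hK' : Γ.PT fun x => (K x : ℚ)) (hK1 : ∀ x, Γ.dom x → 1 ≤ K x)
    (hw : Γ.PTA (fun x => K x + 1) w) {j : I → ℕ} (hj : Γ.PT fun x => (j x : ℚ))
    (hlt : ∀ x, Γ.dom x → j x < n x) :
    Γ.PT fun x => (ratState (K x) (w x) (p x) (j x)).1 := by
  obtain ⟨B, hB, hle⟩ := hp.exists_bound
  obtain ⟨W, hW, hWle⟩ := (hw.bound (hK.add (PB.const 1))).exists_bound
  obtain ⟨Z, hZ, hZe⟩ := hp.guess_eq K w
  have hjPB : Γ.PB j := hp.pb.mono fun x hx => (hlt x hx).le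
  -- Levels start at 1, so cell 0 is free for the guess. Cells 1, …, K hold the times.
  set v : I → ℕ → ℕ → ℚ := fun x j i => if i = 0 then (ratState (K x) (w x) (p x) j).1 else
    (ratState (K x) (w x) (p x) j).2 i with hv
  have key := PTA.iter (Γ := Γ) (n := j) (L := fun x => K x + 1) (v := v) (hK.add (PB.const 1))
    (hK'.natAdd (PT.natConst 1)) (fun _ _ => Nat.succ_pos _) hjPB hj ?_ ?_ ?_
  · exact (key.app (PT.natConst 0) fun _ _ => Nat.succ_pos _).congr fun x _ => by simp [hv]
  · obtain ⟨k, hk⟩ := ((hZ.add (PB.const 1)).add hB).add ((hp.pb.mul ((hB.add hW).add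
      (PB.const 1))).add (PB.const 1))
    refine ⟨k, fun x hx i hi a ha => le_trans ?_ (hk x hx)⟩
    have hin : i < n x := hi.trans_lt (hlt x hx)
    simp only [hv]
    split_ifs with h0
    · obtain ⟨z, hz, e⟩ := hZe x hx i hin
      rw [e]
      have h1 := height_mul_le (2 ^ z) (p x 0)
      have h2 := height_two_pow_le z
      have h3 := hle x hx 0 (by omega)
      omega
    · have h1 := height_ratState_time (hK1 x hx) (w := w x) (p := p x) (n := n x)
        (B := B x + W x) (fun i hi k hk => (height_div_le_add _ _).trans
          (Nat.add_le_add (hle x hx i hi) (hWle x hx k (Nat.lt_succ_of_le hk)))) i hin a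
      have h2 : i * (B x + W x + 1) ≤ n x * (B x + W x + 1) := Nat.mul_le_mul_right _ hin.le
      omega
  · intro J Δ π h idx hidx hlt'
    have hp0 : Δ.PT fun y => p (π y) 0 := hp.pta J Δ π h (fun _ => 0) (PT.natConst 0) fun y hy =>
      (Nat.zero_le _).trans_lt (hlt _ (h.dom y hy))
    exact (hidx.ite_natEq (PT.natConst 0) hp0 (PT.const 0)).congr fun y _ => by simp [hv, ratState]
  · intro J Δ π h st hst hst' hV H Θ ρ h' idx hidx hlt'
    have hΓ := h'.trans h
    have hdom : ∀ z, Θ.dom z → Γ.dom (π (ρ z)) := hΓ.dom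
    have hstn : ∀ z, Θ.dom z → st (ρ z) + 1 < n (π (ρ z)) := fun z hz => by
      have h1 : st (ρ z) < j (π (ρ z)) := hst _ (h'.dom z hz)
      have h2 := hlt _ (hdom z hz)
      omega
    have hKT : Θ.PT fun z => (K (π (ρ z)) : ℚ) := hK'.weak hΓ
    have hx : Θ.PT fun z => p (π (ρ z)) (st (ρ z) + 1) :=
      hp.pta H Θ (fun z => π (ρ z)) hΓ (fun z => st (ρ z) + 1)
        ((hst'.weak h').natAdd (PT.natConst 1)) hstn
    have hV' := hV.weak h'
    set S : H → ℚ × (ℕ → ℚ) := fun z => ratState (K (π (ρ z))) (w (π (ρ z))) (p (π (ρ z))) (st (ρ z))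
      with hS
    have hg : Θ.PT fun z => (S z).1 :=
      (hV'.app (PT.natConst 0) fun _ _ => Nat.succ_pos _).congr fun z _ => by simp [hv, hS]
    have hg0 : ∀ z, Θ.dom z → 0 < (S z).1 := fun z hz =>
      hp.guess_pos K w (hdom z hz) (by have := hstn z hz; omega)
    set k : H → ℕ := fun z => TwoSidedScheduling.scaledLevel (K (π (ρ z))) (S z).1
      (p (π (ρ z)) (st (ρ z) + 1)) with hk
    have hkT : Θ.PT fun z => (k z : ℚ) :=
      PT.scaledLevel (hK.weak hΓ) hKT hg hx fun z hz => (hg0 z hz).le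
    have hk1 : ∀ z, 1 ≤ k z := fun z => one_le_scaledLevel _ _ _
    have hkK : ∀ z, Θ.dom z → k z < K (π (ρ z)) + 1 := fun z hz =>
      Nat.lt_succ_of_le (scaledLevel_le (hK1 _ (hdom z hz)) _ _)
    have htk : Θ.PT fun z => (S z).2 (k z) := (hV'.app hkT hkK).congr fun z _ => by
      have := hk1 z
      simp only [hv, hS]
      rw [if_neg (by omega)]
    have hsum : Θ.PT fun z => (S z).2 (k z) + p (π (ρ z)) (st (ρ z) + 1) / w (π (ρ z)) (k z) :=
      htk.add (hx.div (hw H Θ _ hΓ k hkT hkK))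
    have hti : Θ.PT fun z => v (π (ρ z)) (st (ρ z)) (idx z) := hV'.app hidx hlt'
    have hz : Θ.PT fun _ => (0 : ℚ) := PT.const 0
    have hKT1 := hKT.natSub (PT.natConst 1)
    -- The tests repeat `scaledStep_fst` for cell 0 and `scaledStep_snd` for the others.
    refine (hidx.ite_natEq (PT.natConst 0)
      (hkT.ite_natLe hKT1 (hg.ite_lt hx (PT.doubling hg hx hg0)
        (hg.ite_lt hsum ((PT.const 2).mul hg) hg)) hg)
      (hidx.ite_natEq hkT
        (hkT.ite_natLe hKT1 (hg.ite_lt hx hz (hg.ite_lt hsum hz hsum)) hsum)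
        (hkT.ite_natLe hKT1 (hg.ite_lt hx hz (hg.ite_lt hsum hz hti)) hti))).congr fun z _ => ?_
    simp only [hv]
    by_cases h0 : idx z = 0
    · rw [if_pos h0, if_pos h0, ratState, scaledStep_fst]
    · rw [if_neg h0, if_neg h0, if_neg h0, ratState, scaledStep_snd]

theorem Sizes.level (hp : Γ.Sizes n p) (hs : Γ.Speeds m s) {j : I → ℕ}
    (hj : Γ.PT fun x => (j x : ℚ)) (hlt : ∀ x, Γ.dom x → j x < n x) {q : I → ℚ} (hq : Γ.PT q) :
    Γ.PT fun x =>
      (ratLevel (TwoSidedScheduling.numLevels (m x)) (ratWeight (m x) (s x)) (p x) (j x) (q x) : ℚ) := by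
  have hlt' : ∀ x, Γ.dom x → j x - 1 < n x := fun x hx => (Nat.sub_le _ _).trans_lt (hlt x hx)
  have hg := hp.guess (PB.numLevels hs.pb hs.m_pos) hs.numLevels (fun x _ => one_le_numLevels _)
    hs.weight (hj.natSub (PT.natConst 1)) hlt'
  refine (hj.ite_natEq (PT.natConst 0) (PT.natConst 1) (PT.scaledLevel
    (PB.numLevels hs.pb hs.m_pos) hs.numLevels hg hq fun x hx =>
      (hp.guess_pos (fun x => TwoSidedScheduling.numLevels (m x)) (fun x => ratWeight (m x) (s x))
        hx (hlt' x hx)).le)).congr fun x _ => ?_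
  rw [ratLevel]
  split_ifs <;> rfl

theorem Sizes.load (hp : Γ.Sizes n p) (hs : Γ.Speeds m s) {i : I → ℕ}
    (hi : Γ.PT fun x => (i x : ℚ)) (hlt : ∀ x, Γ.dom x → i x < m x) :
    Γ.PT fun x => ratLoad (m x) (s x) (n x) (p x) (i x) := by
  refine PT.sum hp.pb hp.pt fun J Δ π h idx hidx hidx' => ?_
  have hs' := hs.weak h
  have hq := hp.pta J Δ π h idx hidx hidx'
  exact (hs'.fraction ((PB.numLevels hs'.pb hs'.m_pos).mono fun y _ => ratLevel_le _ _ _ _)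
    ((hp.weak h).level hs' hidx hidx' hq) (hi.weak h) fun y hy => hlt _ (h.dom y hy)).mul hq

end Ctx

end TwoSidedScheduling

namespace TwoSidedScheduling

/-! ### The rational allocation is the real one -/

theorem log_ratCast {q : ℚ} (hq : 0 < q) : Int.log 2 (q : ℝ) = Int.log 2 q := by
  have hq' : (0 : ℝ) < q := by exact_mod_cast hq
  have key : ∀ z : ℤ, z ≤ Int.log 2 (q : ℝ) ↔ z ≤ Int.log 2 q := fun z => by
    rw [← Int.zpow_le_iff_le_log one_lt_two hq', ← Int.zpow_le_iff_le_log one_lt_two hq]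
    have : (((2 : ℕ) : ℝ) ^ z : ℝ) = ((((2 : ℕ) : ℚ) ^ z : ℚ) : ℝ) := by push_cast; rfl
    rw [this, Rat.cast_le]
  exact le_antisymm ((key _).1 le_rfl) ((key _).2 le_rfl)

theorem roundSpeed_ratCast {q : ℚ} (hq : 0 < q) : roundSpeed (q : ℝ) = (roundDown q : ℝ) := by
  rw [roundSpeed, roundDown, log_ratCast hq]; push_cast; rfl

theorem le_maxUpTo (f : ℕ → ℚ) {n i : ℕ} (hi : i < n) : f i ≤ maxUpTo f n := by
  induction n with
  | zero => omega
  | succ n ih =>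
    rcases Nat.lt_succ_iff_lt_or_eq.1 hi with h | rfl
    · exact (ih h).trans (le_max_left _ _)
    · exact le_max_right _ _

theorem exists_maxUpTo_eq {f : ℕ → ℚ} {n : ℕ} (hn : 0 < n) (hf : ∀ i < n, 0 < f i) :
    ∃ i < n, maxUpTo f n = f i := by
  induction n with
  | zero => omega
  | succ n ih =>
    rcases max_choice (maxUpTo f n) (f n) with h | h
    · rcases Nat.eq_zero_or_pos n with rfl | h0
      · exact ⟨0, one_pos, max_eq_right (hf 0 one_pos).le⟩
      · obtain ⟨i, hi, e⟩ := ih h0 fun i hi => hf i (by omega)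
        exact ⟨i, by omega, h.trans e⟩
    · exact ⟨n, Nat.lt_succ_self n, h⟩

/-- The rational numbers `t i` are the positive speeds `s i`. -/
structure RatSpeeds {m : ℕ} (s : Fin m → ℝ) (t : ℕ → ℚ) : Prop where
  eq : ∀ i : Fin m, s i = (t i : ℝ)
  pos : ∀ i : Fin m, 0 < t i

section

variable {m : ℕ} {s : Fin m → ℝ} {t : ℕ → ℚ}

theorem RatSpeeds.round (h : RatSpeeds s t) (i : Fin m) :
    roundSpeed (s i) = (roundDown (t i) : ℝ) := by
  rw [h.eq, roundSpeed_ratCast (h.pos i)]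

theorem RatSpeeds.update (h : RatSpeeds s t) (i : Fin m) {v : ℚ} (hv : 0 < v) :
    RatSpeeds (Function.update s i (v : ℝ)) (Function.update t i v) where
  eq j := by
    rw [Function.update_apply, Function.update_apply, apply_ite (Rat.cast (K := ℝ)), h.eq j]
    simp only [Fin.ext_iff]
  pos j := by
    rw [Function.update_apply]
    split_ifs
    · exact hv
    · exact h.pos j

theorem ratTop_pos (hm : 0 < m) (t : ℕ → ℚ) : 0 < ratTop m t :=
  (roundDown_pos (t 0)).trans_le (le_maxUpTo (fun i => roundDown (t i)) hm)

theorem exists_ratTop_eq (hm : 0 < m) (t : ℕ → ℚ) : ∃ i < m, ratTop m t = roundDown (t i) :=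
  exists_maxUpTo_eq hm fun i _ => roundDown_pos (t i)

theorem RatSpeeds.top (hm : 0 < m) (h : RatSpeeds s t) : topSpeed s = (ratTop m t : ℝ) := by
  apply le_antisymm
  · obtain ⟨i, hi⟩ := exists_topSpeed_eq hm s
    rw [← hi, h.round, Rat.cast_le]
    exact le_maxUpTo (fun i => roundDown (t i)) i.2
  · obtain ⟨i, hi, e⟩ := exists_ratTop_eq hm t
    rw [e, ← h.round ⟨i, hi⟩]
    exact roundSpeed_le_topSpeed s _

theorem RatSpeeds.levelSpeed (hm : 0 < m) (h : RatSpeeds s t) (k : ℕ) :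
    levelSpeed s k = (ratLevelSpeed m t k : ℝ) := by
  rw [TwoSidedScheduling.levelSpeed, ratLevelSpeed, h.top hm]; push_cast; rfl

/-- The two capacities differ at k = 0: the union of no groups is empty, while the threshold with
truncated k - 1 is that of level 1. This is harmless since levels are at least 1. -/
theorem RatSpeeds.capacity (hm : 0 < m) (h : RatSpeeds s t) {k : ℕ} (hk : 1 ≤ k) :
    capacity s k = (ratCapacity m t k : ℝ) := by
  rw [capacity_eq_sum hm s hk, ratCapacity, Rat.cast_sum, Finset.sum_range]
  refine Finset.sum_congr rfl fun i _ => ?_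
  rw [h.levelSpeed hm, h.round]
  simp only [Rat.cast_le]
  split_ifs
  · rfl
  · exact Rat.cast_zero.symm

theorem RatSpeeds.weight (hm : 0 < m) (h : RatSpeeds s t) {k : ℕ} (hk : 1 ≤ k) :
    weight s k = (ratWeight m t k : ℝ) := by
  rw [TwoSidedScheduling.weight, ratWeight, h.capacity hm hk, h.top hm, Rat.cast_div]

theorem RatSpeeds.levelFraction (hm : 0 < m) (h : RatSpeeds s t) {k : ℕ} (hk : 1 ≤ k) (i : Fin m) :
    levelFraction s k i = (ratFraction m t k i : ℝ) := by
  rw [TwoSidedScheduling.levelFraction, ratFraction, h.levelSpeed hm, h.round, h.capacity hm hk]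
  simp only [Rat.cast_le]
  split_ifs
  · exact (Rat.cast_div _ _).symm
  · exact Rat.cast_zero.symm

end

theorem scaledLevel_ratCast (K : ℕ) (g x : ℚ) : scaledLevel K (g : ℝ) (x : ℝ) = scaledLevel K g x := by
  rw [scaledLevel, scaledLevel]
  have : ∀ k : ℕ, (x : ℝ) ≤ (g : ℝ) / 2 ^ (k - 1) ↔ x ≤ g / 2 ^ (k - 1) := fun k => by
    rw [← Rat.cast_le (K := ℝ)]; push_cast; rfl
  simp only [this]

theorem doubling_ratCast (g y : ℚ) : doubling (g : ℝ) (y : ℝ) = ((doubling g y : ℚ) : ℝ) := by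
  have : ∀ z : ℕ, (y : ℝ) ≤ 2 ^ z * (g : ℝ) ↔ y ≤ 2 ^ z * g := fun z => by
    rw [← Rat.cast_le (K := ℝ)]; push_cast; rfl
  rw [doubling, doubling]
  simp only [this]
  push_cast; rfl

/-- A rational state as a real one. -/
def castState (S : ℚ × (ℕ → ℚ)) : ℝ × (ℕ → ℝ) :=
  (S.1, fun k => S.2 k)

theorem scaledStep_castState {K : ℕ} {w : ℕ → ℝ} {w' : ℕ → ℚ} (hw : ∀ k, 1 ≤ k → w k = w' k)
    (S : ℚ × (ℕ → ℚ)) (x : ℚ) :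
    scaledStep K w (castState S) x = castState (scaledStep K w' S x) := by
  have e1 : scaledLevel K (castState S).1 (x : ℝ) = scaledLevel K S.1 x := scaledLevel_ratCast K _ _
  have e2 : (castState S).2 (scaledLevel K S.1 x) + (x : ℝ) / w (scaledLevel K S.1 x) =
      ((S.2 (scaledLevel K S.1 x) + x / w' (scaledLevel K S.1 x) : ℚ) : ℝ) := by
    rw [hw _ (one_le_scaledLevel _ _ _)]; push_cast; rfl
  have e3 : (castState S).1 = (S.1 : ℝ) := rfl
  have e4 : ∀ i, (castState S).2 i = (S.2 i : ℝ) := fun i => rfl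
  refine Prod.ext ?_ (funext fun i => ?_)
  · change _ = (((scaledStep K w' S x).1 : ℚ) : ℝ)
    rw [scaledStep_fst, scaledStep_fst, e1, e2, e3, doubling_ratCast]
    simp only [Rat.cast_lt]
    split_ifs <;> first | rfl | (push_cast; rfl)
  · change _ = (((scaledStep K w' S x).2 i : ℚ) : ℝ)
    rw [scaledStep_snd, scaledStep_snd, e1, e2, e3, e4]
    simp only [Rat.cast_lt]
    split_ifs <;> first | rfl | exact Rat.cast_zero.symm

/-- The numbers `p j` are the entries of the list `l`. -/
def RatList (l : List ℝ) (p : ℕ → ℚ) : Prop :=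
  ∀ j (hj : j < l.length), l[j] = (p j : ℝ)

/-- The scaled state after the jobs in `l`. -/
noncomputable def listState (K : ℕ) (w : ℕ → ℝ) : List ℝ → ℝ × (ℕ → ℝ)
  | [] => (0, fun _ => 0)
  | y :: l => l.foldl (scaledStep K w) (y, fun _ => 0)

theorem listState_append (K : ℕ) (w : ℕ → ℝ) {l : List ℝ} (hl : l ≠ []) (x : ℝ) :
    listState K w (l ++ [x]) = scaledStep K w (listState K w l) x := by
  cases l with
  | nil => exact absurd rfl hl
  | cons y l => simp [listState]

theorem listState_take {K : ℕ} {w : ℕ → ℝ} {w' : ℕ → ℚ} (hw : ∀ k, 1 ≤ k → w k = w' k)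
    {l : List ℝ} {p : ℕ → ℚ} (h : RatList l p) {j : ℕ} (hj : j < l.length) :
    listState K w (l.take (j + 1)) = castState (ratState K w' p j) := by
  induction j with
  | zero =>
    rw [List.take_succ_eq_append_getElem hj, h 0 hj]
    simp [listState, castState, ratState]
  | succ j ih =>
    rw [List.take_succ_eq_append_getElem hj, h _ hj, listState_append, ih (by omega),
      scaledStep_castState hw]
    · rfl
    · rw [Ne, List.take_eq_nil_iff]
      rintro (h | h)
      · omega
      · rw [h] at hj; exact absurd hj (Nat.not_lt_zero _)

theorem levelAfter_take {K : ℕ} {w : ℕ → ℝ} {w' : ℕ → ℚ} (hw : ∀ k, 1 ≤ k → w k = w' k)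
    {l : List ℝ} {p : ℕ → ℚ} (h : RatList l p) {j : ℕ} (hj : j ≤ l.length) (x : ℚ) :
    levelAfter K w (l.take j) x = ratLevel K w' p j x := by
  rcases Nat.eq_zero_or_pos j with rfl | h0
  · simp [levelAfter, ratLevel]
  · obtain ⟨i, rfl⟩ : ∃ i, j = i + 1 := ⟨j - 1, by omega⟩
    have e := congrArg Prod.fst (listState_take (K := K) hw h (j := i) (by omega))
    rw [ratLevel, if_neg (by omega), Nat.add_sub_cancel, ← scaledLevel_ratCast]
    change _ = scaledLevel K (castState (ratState K w' p i)).1 (x : ℝ)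
    rw [← e]
    cases hl : l.take (i + 1) with
    | nil =>
      have := congrArg List.length hl
      rw [List.length_take, List.length_nil] at this
      omega
    | cons y l' => rfl

section

variable {m : ℕ} {s : Fin m → ℝ} {t : ℕ → ℚ} {l : List ℝ} {p : ℕ → ℚ}

theorem RatSpeeds.fraction_take (hm : 0 < m) (hs : RatSpeeds s t) (hl : RatList l p) {j : ℕ}
    (hj : j ≤ l.length) (x : ℚ) (i : Fin m) :
    fraction s (l.take j) x i =
      (ratFraction m t (ratLevel (numLevels m) (ratWeight m t) p j x) i : ℝ) := by
  have h := levelAfter_take (K := numLevels m) (fun k hk => hs.weight hm hk) hl hj x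
  rw [fraction_eq hm, h, hs.levelFraction hm]
  rw [← h]
  exact one_le_levelAfter _ _ _ _

theorem RatSpeeds.load (hm : 0 < m) (hs : RatSpeeds s t) (hl : RatList l p) (i : Fin m) :
    fractionalLoad s l i = (ratLoad m t l.length p i : ℝ) := by
  rw [fractionalLoad, ratLoad, Rat.cast_sum, Finset.sum_range]
  refine Finset.sum_congr rfl fun j _ => ?_
  rw [Rat.cast_mul, ← hs.fraction_take hm hl j.2.le, ← hl j j.2]
  rfl

end

/-! ### The fees -/

theorem integral_ite_le {x u : ℝ} (hx : 0 ≤ x) (hu : 0 ≤ u) :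
    ∫ t in (0 : ℝ)..x, (if t ≤ u then 1 else 0) = min x u := by
  rcases le_total u x with h | h
  · rw [min_eq_right h]
    have := intervalIntegral.integral_indicator (μ := MeasureTheory.volume) (f := fun _ => (1 : ℝ))
      (a₁ := 0) (a₂ := u) (a₃ := x) ⟨hu, h⟩
    simpa [Set.indicator_apply] using this
  · rw [min_eq_left h]
    have : ∫ t in (0 : ℝ)..x, (if t ≤ u then (1 : ℝ) else 0) = ∫ t in (0 : ℝ)..x, (1 : ℝ) := by
      refine intervalIntegral.integral_congr fun t ht => ?_
      rw [Set.uIcc_of_le hx] at ht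
      exact if_pos (ht.2.trans h)
    simp [this]

theorem intervalIntegrable_ite_le (u a b : ℝ) :
    IntervalIntegrable (fun t : ℝ => if t ≤ u then (1 : ℝ) else 0) MeasureTheory.volume a b := by
  refine Antitone.intervalIntegrable fun t t' htt' => ?_
  split_ifs with h1 h2
  · exact le_rfl
  · exact absurd (htt'.trans h1) h2
  · exact zero_le_one
  · exact le_rfl

/-- Telescoping writes a function of the level as a combination of indicators of "level at least j +
2". Each of these is the indicator of a half-line in the job size. -/
theorem eq_add_sum_range_ite (F : ℕ → ℝ) {K k : ℕ} (h1 : 1 ≤ k) (hK : k ≤ K) :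
    F k = F 1 + ∑ j ∈ Finset.range (K - 1), (F (j + 2) - F (j + 1)) * if j + 2 ≤ k then 1 else 0 := by
  have e : ∑ j ∈ Finset.range (K - 1), (F (j + 2) - F (j + 1)) * (if j + 2 ≤ k then 1 else 0) =
      ∑ j ∈ Finset.range (k - 1), (F (j + 2) - F (j + 1)) := by
    simp only [mul_ite, mul_one, mul_zero]
    rw [← Finset.sum_filter]
    congr 1
    ext j
    simp only [Finset.mem_filter, Finset.mem_range]
    omega
  rw [e, Finset.sum_range_sub (fun j => F (j + 1)), Nat.sub_add_cancel h1]
  ring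

theorem add_two_le_scaledLevel {K j : ℕ} (hj : j + 2 ≤ K) {g x : ℝ} (hg : 0 ≤ g) :
    j + 2 ≤ scaledLevel K g x ↔ x ≤ g / 2 ^ (j + 1) := by
  constructor
  · intro h
    have h1 : scaledLevel K g x ≠ 1 := by omega
    exact (le_div_of_scaledLevel (Or.inr h1)).trans (div_two_pow_le hg (by omega))
  · intro h
    exact le_scaledLevel (by omega) hj h

/-- As a function of the size the integrand is a step function that jumps at the thresholds
g/2^(j+1), and each indicator integrates to a minimum. This makes the fee an exact finite sum. -/
theorem integral_scaledLevel (F : ℕ → ℝ) {K : ℕ} (hK : 1 ≤ K) {g x : ℝ} (hg : 0 ≤ g)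
    (hx : 0 ≤ x) :
    ∫ t in (0 : ℝ)..x, F (scaledLevel K g t) = x * F 1 +
      ∑ j ∈ Finset.range (K - 1), (F (j + 2) - F (j + 1)) * min x (g / 2 ^ (j + 1)) := by
  have e : ∀ t, F (scaledLevel K g t) = F 1 + ∑ j ∈ Finset.range (K - 1),
      (F (j + 2) - F (j + 1)) * if t ≤ g / 2 ^ (j + 1) then 1 else 0 := fun t => by
    rw [eq_add_sum_range_ite F (one_le_scaledLevel K g t) (scaledLevel_le hK g t)]
    congr 1
    refine Finset.sum_congr rfl fun j hj => ?_
    rw [Finset.mem_range] at hj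
    simp only [add_two_le_scaledLevel (show j + 2 ≤ K by omega) hg]
  have hi : ∀ j ∈ Finset.range (K - 1), IntervalIntegrable (fun t : ℝ => (F (j + 2) - F (j + 1)) *
      if t ≤ g / 2 ^ (j + 1) then (1 : ℝ) else 0) MeasureTheory.volume 0 x := fun j _ =>
    (intervalIntegrable_ite_le _ _ _).const_mul _
  simp only [e]
  rw [intervalIntegral.integral_add intervalIntegrable_const
    (by simpa only [Finset.sum_fn] using IntervalIntegrable.sum (Finset.range (K - 1)) hi),
    intervalIntegral.integral_finsetSum hi]
  congr 1
  · simp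
  · refine Finset.sum_congr rfl fun j _ => ?_
    rw [intervalIntegral.integral_const_mul, integral_ite_le hx (by positivity)]

/-- The scaled guess when job number `j` arrives, and `0` if there is none. -/
noncomputable def ratGuess (K : ℕ) (w p : ℕ → ℚ) (j : ℕ) : ℚ :=
  if j = 0 then 0 else (ratState K w p (j - 1)).1

/-- The fee. -/
noncomputable def ratFee (m : ℕ) (s : ℕ → ℚ) (n : ℕ) (p C : ℕ → ℚ) (x : ℚ) : ℚ :=
  -∑ i ∈ Finset.range m,
    (C i * (ratFraction m s (ratLevel (numLevels m) (ratWeight m s) p n x) i -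
        ratFraction m s (ratLevel (numLevels m) (ratWeight m s) p n 0) i) +
      1 / s i * (x * ratFraction m s (ratLevel (numLevels m) (ratWeight m s) p n x) i -
        (x * ratFraction m s 1 i + ∑ j ∈ Finset.range (numLevels m - 1),
          (ratFraction m s (j + 2) i - ratFraction m s (j + 1) i) *
            min x (ratGuess (numLevels m) (ratWeight m s) p n / 2 ^ (j + 1)))))

/-- With guess 0 every positive size has level 1, which is the rule for the first job. At size 0
this convention would give level K instead. -/
theorem levelAfter_eq_scaledLevel {K : ℕ} (hK : 1 ≤ K) {w : ℕ → ℝ} {w' : ℕ → ℚ}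
    (hw : ∀ k, 1 ≤ k → w k = w' k) {l : List ℝ} {p : ℕ → ℚ} (h : RatList l p) {x : ℝ} (hx : 0 < x) :
    levelAfter K w l x = scaledLevel K (ratGuess K w' p l.length : ℝ) x := by
  cases l with
  | nil =>
    rw [List.length_nil, ratGuess, if_pos rfl, Rat.cast_zero]
    exact (scaledLevel_eq_one hK le_rfl (by simpa using hx)).symm
  | cons y l =>
    have e := congrArg Prod.fst (listState_take (K := K) hw h (j := l.length) (by simp))
    rw [show (y :: l).take (l.length + 1) = y :: l by simp] at e
    rw [ratGuess, if_neg (by simp), List.length_cons, Nat.add_sub_cancel]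
    change scaledLevel K (listState K w (y :: l)).1 x = _
    rw [e]
    rfl

section

variable {m : ℕ} {s C : Fin m → ℝ} {t c : ℕ → ℚ} {l : List ℝ} {p : ℕ → ℚ}

theorem ratGuess_nonneg {K n : ℕ} {w : ℕ → ℚ} (hp : ∀ j < n, 0 < p j) : 0 ≤ ratGuess K w p n := by
  rw [ratGuess]
  split_ifs with h
  · exact le_rfl
  · set B := ∑ j ∈ Finset.range n, height (p j)
    have hB : ∀ j < n, height (p j) ≤ B := fun j hj =>
      Finset.single_le_sum (f := fun j => height (p j)) (fun _ _ => Nat.zero_le _)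
        (Finset.mem_range.2 hj)
    have h0 : 0 < n := by omega
    obtain ⟨z, -, e⟩ := ratState_guess (K := K) (w := w) (n := n) (Z := 2 * B) (hp 0 h0)
      (fun j hj => le_two_pow_mul (hp 0 h0) (hB j hj) (hB 0 h0)) (n - 1) (by omega)
    rw [e]
    have := hp 0 h0
    positivity

theorem RatSpeeds.fee (hm : 0 < m) (hs : RatSpeeds s t) (hl : RatList l p)
    (hp : ∀ j < l.length, 0 < p j) (hC : ∀ i : Fin m, C i = (c i : ℝ)) {x : ℚ} (hx : 0 < x) :
    levelFee s l C x = (ratFee m t l.length p c x : ℝ) := by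
  have hx' : (0 : ℝ) < x := by exact_mod_cast hx
  have hF : ∀ (q : ℚ) (i : Fin m), fraction s l q i =
      (ratFraction m t (ratLevel (numLevels m) (ratWeight m t) p l.length q) i : ℝ) := fun q i => by
    have := hs.fraction_take hm hl le_rfl q i
    rwa [List.take_length] at this
  have hI : ∀ i : Fin m, ∫ v in (0 : ℝ)..x, fraction s l v i =
      ((x * ratFraction m t 1 i + ∑ j ∈ Finset.range (numLevels m - 1),
          (ratFraction m t (j + 2) i - ratFraction m t (j + 1) i) *
            min x (ratGuess (numLevels m) (ratWeight m t) p l.length / 2 ^ (j + 1)) : ℚ) : ℝ) := by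
    intro i
    have e : ∫ v in (0 : ℝ)..x, fraction s l v i = ∫ v in (0 : ℝ)..x, TwoSidedScheduling.levelFraction s
        (scaledLevel (numLevels m)
          (ratGuess (numLevels m) (ratWeight m t) p l.length : ℝ) v) i := by
      rw [intervalIntegral.integral_of_le hx'.le, intervalIntegral.integral_of_le hx'.le]
      -- The integral runs over (0, x], so the size 0, where the convention for the guess fails,
      -- plays no role.
      refine MeasureTheory.setIntegral_congr_fun measurableSet_Ioc fun v hv => ?_
      rw [fraction_eq hm, levelAfter_eq_scaledLevel (one_le_numLevels m)
        (fun k hk => hs.weight hm hk) hl hv.1]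
    rw [e, integral_scaledLevel (fun k => TwoSidedScheduling.levelFraction s k i) (one_le_numLevels m)
      (by exact_mod_cast ratGuess_nonneg hp) hx'.le]
    push_cast
    rw [hs.levelFraction hm le_rfl]
    congr 1
    refine Finset.sum_congr rfl fun j _ => ?_
    rw [hs.levelFraction hm (by omega), hs.levelFraction hm (by omega)]
  rw [levelFee, ratFee, Rat.cast_neg, Rat.cast_sum, Finset.sum_range]
  congr 1
  refine Finset.sum_congr rfl fun i _ => ?_
  have h0 := hF 0 i
  rw [Rat.cast_zero] at h0
  rw [hI, hF, h0, hs.eq, hC]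
  push_cast
  rfl

end

end TwoSidedScheduling

namespace TwoSidedScheduling

/-! ### The payments -/

theorem setIntegral_Ioi_eq_of_const {f : ℝ → ℝ} {a b c : ℝ} (hab : a ≤ b)
    (hf : MeasureTheory.IntegrableOn f (Set.Ioi a)) (h : ∀ t ∈ Set.Ioc a b, f t = c) :
    ∫ t in Set.Ioi a, f t = (b - a) * c + ∫ t in Set.Ioi b, f t := by
  rw [← intervalIntegral.integral_interval_add_Ioi hf (hf.mono_set (Set.Ioi_subset_Ioi hab)),
    intervalIntegral.integral_of_le hab, MeasureTheory.setIntegral_congr_fun measurableSet_Ioc h,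
    ← intervalIntegral.integral_of_le hab, intervalIntegral.integral_const, smul_eq_mul]

theorem log_one_div_eq {t : ℝ} (ht : 0 < t) {z : ℤ} (h1 : (2 : ℝ) ^ z ≤ 1 / t)
    (h2 : 1 / t < (2 : ℝ) ^ (z + 1)) : Int.log 2 (1 / t) = z := by
  have ht' : 0 < 1 / t := by positivity
  have h3 := (Int.zpow_le_iff_le_log (b := 2) one_lt_two ht').1 (by exact_mod_cast h1)
  have h4 := (Int.lt_zpow_iff_log_lt (b := 2) one_lt_two ht').1 (by exact_mod_cast h2)
  omega

section

variable {m : ℕ} {s : Fin m → ℝ} {l : List ℝ} {i i' : Fin m}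

/-- The load is constant while the rounded speed is 2^(ζ-d-1), that is, for inverse speeds in
(2^d/2^ζ, 2^(d+1)/2^ζ], an interval of length 2^d/2^ζ. The part up to 1/2^ζ joins the first term of
the payment and replaces the true speed by the rounded one. -/
theorem levelPay_eq (hm : 2 ≤ m) (hl : ∀ y ∈ l, 0 < y) (hs : 0 < s i) (hi : i' ≠ i) {D : ℕ}
    (hD : (2 : ℝ) ^ (Int.log 2 (s i) - D) * m < roundSpeed (s i')) :
    levelPay s l i = loadAt s l i (Int.log 2 (s i)) / 2 ^ Int.log 2 (s i) +
      ∑ d ∈ Finset.range D, 2 ^ d / 2 ^ Int.log 2 (s i) *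
        loadAt s l i (Int.log 2 (s i) - (d + 1 : ℕ)) := by
  set ζ := Int.log 2 (s i) with hζ
  have hr0 : (0 : ℝ) < 2 ^ ζ := by positivity
  have hle : (2 : ℝ) ^ ζ ≤ s i := roundSpeed_le hs
  set f : ℝ → ℝ := fun t => fractionalLoad (Function.update s i (1 / t)) l i with hf
  have hf' : ∀ t, f t = loadAt s l i (Int.log 2 (1 / t)) := fun t =>
    fractionalLoad_update (by omega) s l i _
  have hint : ∀ b, 0 < b → MeasureTheory.IntegrableOn f (Set.Ioi b) := fun b hb =>
    integrableOn_fractionalLoad hm hl hb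
  have h0 : f (1 / s i) = loadAt s l i ζ := by rw [hf', one_div_one_div]
  have h1 : ∫ t in Set.Ioi (1 / s i), f t =
      (1 / 2 ^ ζ - 1 / s i) * loadAt s l i ζ + ∫ t in Set.Ioi (1 / 2 ^ ζ : ℝ), f t := by
    refine setIntegral_Ioi_eq_of_const (one_div_le_one_div_of_le hr0 hle)
      (hint _ (by positivity)) fun t ht => ?_
    have ht0 : 0 < t := lt_trans (by positivity) ht.1
    rw [hf', log_one_div_eq ht0 (z := ζ)]
    · exact (le_one_div hr0 ht0).2 ht.2
    · have h2 : s i < 2 * 2 ^ ζ := lt_two_mul_roundSpeed (s i)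
      rw [zpow_add_one₀ (by norm_num), mul_comm]
      exact ((one_div_lt ht0 hs).2 ht.1).trans h2
  have h2 : ∀ D : ℕ, ∫ t in Set.Ioi (1 / 2 ^ ζ : ℝ), f t =
      ∑ d ∈ Finset.range D, 2 ^ d / 2 ^ ζ * loadAt s l i (ζ - (d + 1 : ℕ)) +
        ∫ t in Set.Ioi (2 ^ D / 2 ^ ζ : ℝ), f t := by
    intro D
    induction D with
    | zero => simp
    | succ D ih =>
      have e : (2 : ℝ) ^ (ζ - (D + 1 : ℕ)) = 1 / (2 ^ (D + 1) / 2 ^ ζ) := by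
        rw [zpow_sub₀ (by norm_num), zpow_natCast, one_div_div]
      have e' : (2 : ℝ) ^ (ζ - (D + 1 : ℕ) + 1) = 1 / (2 ^ D / 2 ^ ζ) := by
        rw [show ζ - (D + 1 : ℕ) + 1 = ζ - D by push_cast; ring, zpow_sub₀ (by norm_num),
          zpow_natCast, one_div_div]
      have hD0 : (0 : ℝ) < 2 ^ D / 2 ^ ζ := by positivity
      have h3 := setIntegral_Ioi_eq_of_const (f := f) (a := 2 ^ D / 2 ^ ζ)
        (b := 2 ^ (D + 1) / 2 ^ ζ) (c := loadAt s l i (ζ - (D + 1 : ℕ)))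
        (by gcongr <;> [norm_num; omega]) (hint _ hD0) fun t ht => by
          have ht0 : 0 < t := hD0.trans ht.1
          rw [hf', log_one_div_eq ht0 (z := ζ - (D + 1 : ℕ))]
          · rw [e]
            exact one_div_le_one_div_of_le ht0 ht.2
          · rw [e']
            exact one_div_lt_one_div_of_lt hD0 ht.1
      rw [ih, Finset.sum_range_succ, h3, ← sub_div, pow_succ]
      ring
  -- Beyond depth D the machine is too slow for every group, so the tail vanishes.
  have h3 : ∫ t in Set.Ioi (2 ^ D / 2 ^ ζ : ℝ), f t = 0 := by
    refine MeasureTheory.setIntegral_eq_zero_of_forall_eq_zero fun t ht => ?_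
    have ht0 : 0 < t := lt_trans (by positivity) ht
    rw [hf']
    refine loadAt_eq_zero hm s l hi
      (lt_of_le_of_lt (mul_le_mul_of_nonneg_right ?_ (Nat.cast_nonneg m)) hD)
    have e : (2 : ℝ) ^ (ζ - D) = 1 / (2 ^ D / 2 ^ ζ) := by
      rw [zpow_sub₀ (by norm_num), zpow_natCast, one_div_div]
    have h4 : (2 : ℝ) ^ Int.log 2 (1 / t) ≤ 1 / t := by
      exact_mod_cast Int.zpow_log_le_self one_lt_two (show (0 : ℝ) < 1 / t by positivity)
    rw [e]
    exact h4.trans (one_div_le_one_div_of_le (by positivity) (le_of_lt ht))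
  rw [levelPay]
  change 1 / s i * f (1 / s i) + ∫ t in Set.Ioi (1 / s i), f t = _
  rw [h0, h1, h2 D, h3]
  ring

end

/-- The least `d` with `q < 2 ^ d`. -/
noncomputable def powAbove (q : ℚ) : ℕ :=
  sInf {d : ℕ | q < 2 ^ d}

theorem lt_two_pow_height_succ (q : ℚ) : q < 2 ^ (height q + 1) :=
  (le_two_pow_height q).trans_lt (pow_lt_pow_right₀ (by norm_num) (Nat.lt_succ_self _))

theorem lt_two_pow_powAbove (q : ℚ) : q < 2 ^ powAbove q :=
  Nat.sInf_mem (s := {d : ℕ | q < 2 ^ d}) ⟨_, lt_two_pow_height_succ q⟩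

theorem powAbove_le (q : ℚ) : powAbove q ≤ height q + 1 :=
  Nat.sInf_le (lt_two_pow_height_succ q)

theorem lt_powAbove_iff (q : ℚ) (d : ℕ) : d < powAbove q ↔ 2 ^ d ≤ q := by
  constructor
  · intro h
    exact not_lt.1 (Nat.notMem_of_lt_sInf h)
  · intro h
    by_contra hc
    have h1 : (2 : ℚ) ^ powAbove q ≤ 2 ^ d := pow_le_pow_right₀ (by norm_num) (not_lt.1 hc)
    exact absurd (lt_two_pow_powAbove q) (not_lt.2 (h1.trans h))

/-- The number of relevant lower speeds of machine `i`. -/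
noncomputable def ratDepth (m : ℕ) (s : ℕ → ℚ) (i : ℕ) : ℕ :=
  powAbove (roundDown (s i) * m / roundDown (s (if i = 0 then 1 else 0)))

/-- The payment. -/
noncomputable def ratPay (m : ℕ) (s : ℕ → ℚ) (n : ℕ) (p : ℕ → ℚ) (i : ℕ) : ℚ :=
  ratLoad m (Function.update s i (roundDown (s i))) n p i / roundDown (s i) +
    ∑ d ∈ Finset.range (ratDepth m s i), 2 ^ d / roundDown (s i) *
      ratLoad m (Function.update s i (roundDown (s i) / 2 ^ (d + 1))) n p i

theorem RatSpeeds.pay {m : ℕ} (hm : 2 ≤ m) {s : Fin m → ℝ} {t : ℕ → ℚ} (hs : RatSpeeds s t)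
    {l : List ℝ} {p : ℕ → ℚ} (hl : RatList l p) (hp : ∀ j < l.length, 0 < p j) (i : Fin m) :
    levelPay s l i = (ratPay m t l.length p i : ℝ) := by
  have hm' : 0 < m := by omega
  -- Any machine other than i serves to bound the depth; machine 0 is used, or machine 1 if i is 0.
  set o : Fin m := ⟨if (i : ℕ) = 0 then 1 else 0, by split_ifs <;> omega⟩ with ho
  have hoi : o ≠ i := by
    rw [Ne, Fin.ext_iff, ho]
    dsimp only
    split_ifs <;> omega
  have hsi : 0 < s i := by rw [hs.eq]; exact_mod_cast hs.pos i
  have hr : (2 : ℝ) ^ Int.log 2 (s i) = (roundDown (t i) : ℝ) := hs.round i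
  have hr0 := roundDown_pos (t i)
  have hload : ∀ d : ℕ, loadAt s l i (Int.log 2 (s i) - (d : ℕ)) =
      (ratLoad m (Function.update t i (roundDown (t i) / 2 ^ d)) l.length p i : ℝ) := fun d => by
    have e : (2 : ℝ) ^ (Int.log 2 (s i) - d) = ((roundDown (t i) / 2 ^ d : ℚ) : ℝ) := by
      rw [zpow_sub₀ (by norm_num), zpow_natCast, hr]; push_cast; rfl
    rw [loadAt, e, (hs.update i (by positivity)).load hm' hl]
  have hpos : ∀ y ∈ l, 0 < y := fun y hy => by
    obtain ⟨j, hj, rfl⟩ := List.getElem_of_mem hy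
    rw [hl j hj]
    exact_mod_cast hp j hj
  have h0 := hload 0
  rw [Nat.cast_zero, sub_zero, pow_zero, div_one] at h0
  rw [levelPay_eq hm hpos hsi hoi (D := ratDepth m t i), hr, h0, ratPay]
  · push_cast
    congr 1
    refine Finset.sum_congr rfl fun d _ => ?_
    rw [← hload]
    push_cast; rfl
  · have h1 := lt_two_pow_powAbove (roundDown (t i) * m / roundDown (t o))
    rw [div_lt_iff₀ (roundDown_pos _)] at h1
    have h2 : roundDown (t i) / 2 ^ ratDepth m t i * m < roundDown (t o) := by
      rw [div_mul_eq_mul_div, div_lt_iff₀ (by positivity), mul_comm (roundDown (t o))]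
      exact h1
    rw [zpow_sub₀ (by norm_num), zpow_natCast, hr, hs.round]
    exact_mod_cast h2

/-! ### Random choices from a uniformly random integer -/

/-- The number of `i < m` with `a 0 + ⋯ + a i ≤ u`. -/
def pickIndex (a : ℕ → ℕ) (m u : ℕ) : ℕ :=
  ∑ i ∈ Finset.range m, if ∑ j ∈ Finset.range (i + 1), a j ≤ u then 1 else 0

theorem sum_range_mono (a : ℕ → ℕ) : Monotone fun i => ∑ j ∈ Finset.range i, a j :=
  fun _ _ h => Finset.sum_le_sum_of_subset (Finset.range_subset_range.2 h)

theorem pickIndex_eq {a : ℕ → ℕ} {m u i : ℕ} (hi : i < m) (h1 : ∑ j ∈ Finset.range i, a j ≤ u)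
    (h2 : u < ∑ j ∈ Finset.range (i + 1), a j) : pickIndex a m u = i := by
  rw [pickIndex, ← Finset.card_filter]
  have : ((Finset.range m).filter fun k => ∑ j ∈ Finset.range (k + 1), a j ≤ u) =
      Finset.range i := by
    ext k
    rw [Finset.mem_filter, Finset.mem_range, Finset.mem_range]
    constructor
    · rintro ⟨-, h⟩
      by_contra hc
      have := sum_range_mono a (show i + 1 ≤ k + 1 by omega)
      dsimp only at this
      omega
    · intro h
      have := sum_range_mono a (show k + 1 ≤ i by omega)
      dsimp only at this
      exact ⟨by omega, by omega⟩
  rw [this, Finset.card_range]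

theorem exists_sum_range_le_lt {a : ℕ → ℕ} {m u : ℕ} (hu : u < ∑ j ∈ Finset.range m, a j) :
    ∃ i < m, ∑ j ∈ Finset.range i, a j ≤ u ∧ u < ∑ j ∈ Finset.range (i + 1), a j := by
  induction m with
  | zero => simp at hu
  | succ m ih =>
    by_cases h : u < ∑ j ∈ Finset.range m, a j
    · obtain ⟨i, hi, h'⟩ := ih h
      exact ⟨i, by omega, h'⟩
    · exact ⟨m, Nat.lt_succ_self m, not_lt.1 h, hu⟩

theorem pickIndex_lt {a : ℕ → ℕ} {m u : ℕ} (hu : u < ∑ j ∈ Finset.range m, a j) :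
    pickIndex a m u < m := by
  obtain ⟨i, hi, h1, h2⟩ := exists_sum_range_le_lt hu
  rwa [pickIndex_eq hi h1 h2]

/-- The integers that select i form the interval between consecutive partial sums, whose length is a
i. -/
theorem card_pickIndex {a : ℕ → ℕ} {m i : ℕ} (hi : i < m) :
    ((Finset.range (∑ j ∈ Finset.range m, a j)).filter fun u => pickIndex a m u = i).card = a i := by
  have : ((Finset.range (∑ j ∈ Finset.range m, a j)).filter fun u => pickIndex a m u = i) =
      Finset.Ico (∑ j ∈ Finset.range i, a j) (∑ j ∈ Finset.range (i + 1), a j) := by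
    ext u
    rw [Finset.mem_filter, Finset.mem_range, Finset.mem_Ico]
    constructor
    · rintro ⟨hu, h⟩
      obtain ⟨k, hk, h1, h2⟩ := exists_sum_range_le_lt hu
      rw [pickIndex_eq hk h1 h2] at h
      rw [← h]
      exact ⟨h1, h2⟩
    · rintro ⟨h1, h2⟩
      have := sum_range_mono a (show i + 1 ≤ m by omega)
      exact ⟨h2.trans_le this, pickIndex_eq hi h1 h2⟩
  rw [this, Nat.card_Ico, Finset.sum_range_succ, Nat.add_sub_cancel_left]

/-- The fractions of a job of level `k`, scaled to natural numbers. -/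
def ratShare (m : ℕ) (s : ℕ → ℚ) (k i : ℕ) : ℕ :=
  ⌊if ratLevelSpeed m s k ≤ roundDown (s i) then
    roundDown (s i) * 2 ^ (numLevels m - 1) / ratTop m s else 0⌋₊

/-- A machine in the first k ≤ K groups has speed at least R/2^(K-1). Scaled by 2^(K-1)/R it is a
power of two with nonnegative exponent, so the floor loses nothing. -/
theorem ratShare_cast {m : ℕ} (hm : 0 < m) (s : ℕ → ℚ) {k : ℕ} (hk : k ≤ numLevels m) (i : ℕ) :
    (ratShare m s k i : ℚ) = if ratLevelSpeed m s k ≤ roundDown (s i) then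
      roundDown (s i) * 2 ^ (numLevels m - 1) / ratTop m s else 0 := by
  rw [ratShare]
  split_ifs with h
  · obtain ⟨i₀, -, e⟩ := exists_ratTop_eq hm s
    rw [ratLevelSpeed, e, roundDown, roundDown, ← zpow_natCast (2 : ℚ), ← zpow_sub₀ (by norm_num),
      zpow_le_zpow_iff_right₀ one_lt_two] at h
    have : roundDown (s i) * 2 ^ (numLevels m - 1) / ratTop m s =
        ((2 ^ (Int.log 2 (s i) + (numLevels m - 1 : ℕ) - Int.log 2 (s i₀)).toNat : ℕ) : ℚ) := by
      rw [e, roundDown, roundDown, ← zpow_natCast (2 : ℚ), ← zpow_add₀ (by norm_num),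
        ← zpow_sub₀ (by norm_num)]
      push_cast
      rw [← zpow_natCast (2 : ℚ), Int.toNat_of_nonneg (by omega)]
    rw [this, Nat.floor_natCast]
  · simp

theorem sum_ratShare {m : ℕ} (hm : 0 < m) (s : ℕ → ℚ) {k : ℕ} (hk : k ≤ numLevels m) :
    ((∑ i ∈ Finset.range m, ratShare m s k i : ℕ) : ℚ) =
      ratCapacity m s k * 2 ^ (numLevels m - 1) / ratTop m s := by
  rw [Nat.cast_sum, ratCapacity, Finset.sum_mul, Finset.sum_div]
  refine Finset.sum_congr rfl fun i _ => ?_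
  rw [ratShare_cast hm s hk]
  split_ifs <;> simp

theorem ratCapacity_pos {m : ℕ} (hm : 0 < m) (s : ℕ → ℚ) (k : ℕ) : 0 < ratCapacity m s k := by
  obtain ⟨i, hi, e⟩ := exists_ratTop_eq hm s
  have hR := ratTop_pos hm s
  have h1 : ratLevelSpeed m s k ≤ roundDown (s i) := by
    rw [← e]
    exact div_le_self hR.le (one_le_pow₀ (by norm_num))
  refine Finset.sum_pos' (fun j _ => ?_) ⟨i, Finset.mem_range.2 hi, ?_⟩
  · split_ifs
    · exact (roundDown_pos _).le
    · exact le_rfl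
  · rw [if_pos h1]
    exact roundDown_pos _

theorem sum_ratShare_pos {m : ℕ} (hm : 0 < m) (s : ℕ → ℚ) {k : ℕ} (hk : k ≤ numLevels m) :
    0 < ∑ i ∈ Finset.range m, ratShare m s k i := by
  have h := sum_ratShare hm s hk
  have h1 := ratCapacity_pos hm s k
  have h2 := ratTop_pos hm s
  have : (0 : ℚ) < ((∑ i ∈ Finset.range m, ratShare m s k i : ℕ) : ℚ) := by
    rw [h]; positivity
  exact_mod_cast this

theorem ratFraction_eq_div {m : ℕ} (hm : 0 < m) (s : ℕ → ℚ) {k : ℕ} (hk : k ≤ numLevels m) (i : ℕ) :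
    ratFraction m s k i =
      (ratShare m s k i : ℚ) / ((∑ i ∈ Finset.range m, ratShare m s k i : ℕ) : ℚ) := by
  rw [sum_ratShare hm s hk, ratShare_cast hm s hk, ratFraction]
  have h1 := ratCapacity_pos hm s k
  have h2 := ratTop_pos hm s
  split_ifs
  · field_simp
  · simp

end TwoSidedScheduling

/-! ### Polynomial-time computation of payments, fees and random choices -/

namespace TwoSidedScheduling

namespace Ctx

variable {I J H : Type} {Γ : Ctx I} {Δ : Ctx J} {π : J → I}

theorem PT.powAbove {q : I → ℚ} (hq : Γ.PT q) : Γ.PT fun x => (powAbove (q x) : ℚ) := by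
  have hn : Γ.PB fun x => TwoSidedScheduling.powAbove (q x) :=
    (hq.1.add (PB.const 1)).mono fun x _ => powAbove_le _
  refine PT.while (g := fun _ j => (j : ℚ)) hn ?_ (PT.natConst 0) ?_ ?_
  · refine PBA.of_le (hn.add (PB.const 2)) fun x _ j hj => (height_natCast_le j).trans ?_
    have hj' : j < TwoSidedScheduling.powAbove (q x) + 1 := hj
    omega
  · intro J Δ π h st hst h1
    refine ((PT.two_pow ((hn.weak h).mono hst) h1).ite_le (hq.weak h) (PT.const 1)
      (PT.const 0)).congr fun y _ => ?_
    simp only [lt_powAbove_iff]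
  · intro J Δ π h st hst h1
    exact h1.natAdd (PT.natConst 1)

variable {m n : I → ℕ} {s p C : I → ℕ → ℚ}

theorem Speeds.depthRatio (hs : Γ.Speeds m s) (h2 : ∀ x, Γ.dom x → 2 ≤ m x) {i : I → ℕ}
    (hi : Γ.PT fun x => (i x : ℚ)) (hlt : ∀ x, Γ.dom x → i x < m x) :
    Γ.PT fun x => roundDown (s x (i x)) * m x / roundDown (s x (if i x = 0 then 1 else 0)) := by
  have ho : Γ.PT fun x => ((if i x = 0 then 1 else 0 : ℕ) : ℚ) :=
    (hi.ite_natEq (PT.natConst 0) (PT.const 1) (PT.const 0)).congr fun x _ => by push_cast; rfl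
  exact ((hs.round.app hi hlt).mul hs.pt).div (hs.round.app ho fun x hx => by
    have := h2 x hx
    split_ifs <;> omega)

/-- The number of summands is about the logarithm of a ratio of speeds, hence linear in heights.
Each summand is one load computation with a changed speed. -/
theorem Sizes.pay (hp : Γ.Sizes n p) (hs : Γ.Speeds m s) (h2 : ∀ x, Γ.dom x → 2 ≤ m x) {i : I → ℕ}
    (hi : Γ.PT fun x => (i x : ℚ)) (hlt : ∀ x, Γ.dom x → i x < m x) :
    Γ.PT fun x => ratPay (m x) (s x) (n x) (p x) (i x) := by
  have hr := hs.round.app hi hlt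
  have hq := hs.depthRatio h2 hi hlt
  have hD : Γ.PT fun x => (ratDepth (m x) (s x) (i x) : ℚ) := hq.powAbove
  have hDPB : Γ.PB fun x => ratDepth (m x) (s x) (i x) :=
    (hq.1.add (PB.const 1)).mono fun x _ => powAbove_le _
  refine ((hp.load (hs.update hr (fun x _ => roundDown_pos _) hi) hi hlt).div hr).add
    (PT.sum hDPB hD fun J Δ π h idx hidx hidx' => ?_)
  have hr' := hr.weak h
  have hi' := hi.weak h
  have hidxPB := PB.of_lt h hDPB hidx'
  exact ((PT.two_pow hidxPB hidx).div hr').mul ((hp.weak h).load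
    ((hs.weak h).update (hr'.div (PT.two_pow (hidxPB.add (PB.const 1))
      (hidx.natAdd (PT.natConst 1)))) (fun y _ => div_pos (roundDown_pos _) (by positivity)) hi')
    hi' fun y hy => hlt _ (h.dom y hy))

theorem Sizes.ratGuess (hp : Γ.Sizes (fun x => n x + 1) p) (hs : Γ.Speeds m s)
    (hn : Γ.PT fun x => (n x : ℚ)) : Γ.PT fun x =>
      ratGuess (TwoSidedScheduling.numLevels (m x)) (ratWeight (m x) (s x)) (p x) (n x) :=
  (hn.ite_natEq (PT.natConst 0) (PT.const 0) (hp.guess (PB.numLevels hs.pb hs.m_pos) hs.numLevels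
    (fun x _ => one_le_numLevels _) hs.weight (hn.natSub (PT.natConst 1)) fun x _ => by omega)).congr
    fun x _ => by rw [TwoSidedScheduling.ratGuess]

/-- The arriving job is included as entry n of n + 1 sizes, which makes n an admissible index; the
level itself uses only the n earlier jobs. -/
theorem Sizes.fee (hp : Γ.Sizes (fun x => n x + 1) p) (hs : Γ.Speeds m s)
    (hn : Γ.PT fun x => (n x : ℚ)) (hC : Γ.PTA m C) {q : I → ℚ} (hq : Γ.PT q) :
    Γ.PT fun x => ratFee (m x) (s x) (n x) (p x) (C x) (q x) := by
  refine (PT.sum hs.pb hs.pt fun J Δ π h idx hidx hidx' => ?_).neg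
  have hp' := hp.weak h
  have hs' := hs.weak h
  have hn' := hn.weak h
  have hq' := hq.weak h
  have hK := PB.numLevels hs'.pb hs'.m_pos
  have hF : ∀ q : J → ℚ, Δ.PT q → Δ.PT fun y => ratFraction (m (π y)) (s (π y))
      (ratLevel (TwoSidedScheduling.numLevels (m (π y))) (ratWeight (m (π y)) (s (π y))) (p (π y))
        (n (π y)) (q y)) (idx y) := fun q hq =>
    hs'.fraction (hK.mono fun y _ => ratLevel_le _ _ _ _)
      (hp'.level hs' hn' (fun y _ => Nat.lt_succ_self _) hq) hidx hidx'
  have hF1 : Δ.PT fun y => ratFraction (m (π y)) (s (π y)) 1 (idx y) :=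
    hs'.fraction (PB.const 1) (PT.natConst 1) hidx hidx'
  refine ((hC J Δ π h idx hidx hidx').mul ((hF _ hq').sub (hF _ (PT.const 0)))).add
    (((PT.const 1).div (hs'.pta.app hidx hidx')).mul ((hq'.mul (hF _ hq')).sub
      ((hq'.mul hF1).add (PT.sum (hK.mono fun y _ => Nat.sub_le _ _)
        (hs'.numLevels.natSub (PT.natConst 1)) fun H Θ ρ h' j hj hj' => ?_))))
  have hs'' := hs'.weak h'
  have hi := hidx.weak h'
  have hi' : ∀ z, Θ.dom z → idx (ρ z) < m (π (ρ z)) := fun z hz => hidx' _ (h'.dom z hz)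
  have hjPB := PB.of_lt h' (hK.mono fun y _ => Nat.sub_le _ 1) hj'
  have hj1 := hjPB.add (PB.const 1)
  have hj2 := hjPB.add (PB.const 2)
  exact ((hs''.fraction hj2 (hj.natAdd (PT.natConst 2)) hi hi').sub
    (hs''.fraction hj1 (hj.natAdd (PT.natConst 1)) hi hi')).mul
    ((hq'.weak h').min (((hp'.weak h').ratGuess hs'' (hn'.weak h')).div
      (PT.two_pow hj1 (hj.natAdd (PT.natConst 1)))))

theorem Speeds.share (hs : Γ.Speeds m s) {k : I → ℕ} (hk : Γ.PT fun x => (k x : ℚ))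
    (hk' : ∀ x, Γ.dom x → k x ≤ TwoSidedScheduling.numLevels (m x)) :
    Γ.PTA m fun x i => (ratShare (m x) (s x) (k x) i : ℚ) := by
  intro J Δ π h idx hidx hlt
  have hs' := hs.weak h
  have hr := hs.round J Δ π h idx hidx hlt
  have hK := PB.numLevels hs'.pb hs'.m_pos
  have hkPB : Δ.PB fun y => k (π y) := hK.mono fun y hy => hk' _ (h.dom y hy)
  exact ((hs'.levelSpeed hkPB (hk.weak h)).ite_le hr ((hr.mul (PT.two_pow
    (hK.mono fun y _ => Nat.sub_le _ _) (hs'.numLevels.natSub (PT.natConst 1)))).div hs'.top)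
    (PT.const 0)).congr fun y hy => (ratShare_cast (hs'.m_pos y hy) _ (hk' _ (h.dom y hy)) _).symm

theorem PT.pickIndex {a : I → ℕ → ℕ} {u : I → ℕ} (hm : Γ.PB m) (hm' : Γ.PT fun x => (m x : ℚ))
    (ha : Γ.PTA m fun x i => (a x i : ℚ)) (hu : Γ.PT fun x => (u x : ℚ)) :
    Γ.PT fun x => (pickIndex (a x) (m x) (u x) : ℚ) := by
  refine PT.natSum hm hm' fun J Δ π h idx hidx hlt => ?_
  have hsum : Δ.PT fun y => ((∑ j ∈ Finset.range (idx y + 1), a (π y) j : ℕ) : ℚ) :=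
    PT.natSum (f := fun y => a (π y)) ((PB.of_lt h hm hlt).add (PB.const 1))
      (hidx.natAdd (PT.natConst 1)) ((ha.weak h).mono fun y hy => hlt y hy)
  exact (hsum.ite_natLe (hu.weak h) (PT.const 1) (PT.const 0)).congr fun y _ => by push_cast; rfl

end Ctx

/-! ### Input lists -/

/-- The context given by the first `T + 1` input lists, each extended by a zero. -/
def inputCtx {I : Type} (T : ℕ) (enc : I → List (List ℚ)) : Ctx I where
  dom _ := True
  size x := inputSize (enc x)
  len b x := if b ≤ T then ((enc x).getD b []).length + 1 else 0
  arr b x i := ((enc x).getD b []).getD i 0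

theorem bitSize_le_inputSize {inp : List (List ℚ)} {l : List ℚ} (hl : l ∈ inp) {q : ℚ} (hq : q ∈ l) :
    bitSize q ≤ inputSize inp :=
  (List.single_le_sum (fun _ _ => Nat.zero_le _) _ (List.mem_map_of_mem hq)).trans
    (List.single_le_sum (fun _ _ => Nat.zero_le _) _
      (List.mem_map_of_mem (f := fun l => (l.map bitSize).sum) hl))

theorem length_le_sum_bitSize (l : List ℚ) : l.length ≤ (l.map bitSize).sum := by
  induction l with
  | nil => simp
  | cons q l ih =>
    rw [List.map_cons, List.sum_cons, List.length_cons]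
    have : 1 ≤ bitSize q := Nat.le_add_left _ _
    omega

theorem length_le_inputSize {inp : List (List ℚ)} {l : List ℚ} (hl : l ∈ inp) :
    l.length ≤ inputSize inp :=
  (length_le_sum_bitSize l).trans
    (List.single_le_sum (fun _ _ => Nat.zero_le _) _
      (List.mem_map_of_mem (f := fun l => (l.map bitSize).sum) hl))

theorem height_getD_le (inp : List (List ℚ)) (b i : ℕ) :
    height ((inp.getD b []).getD i 0) ≤ inputSize inp + 1 := by
  by_cases hb : b < inp.length
  · by_cases hi : i < (inp.getD b []).length
    · rw [List.getD_eq_getElem _ _ hi]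
      refine (height_le_bitSize _).trans (Nat.le_succ_of_le (bitSize_le_inputSize (l := inp.getD b [])
        ?_ (List.getElem_mem hi)))
      rw [List.getD_eq_getElem _ _ hb]
      exact List.getElem_mem hb
    · rw [List.getD_eq_default _ _ (not_lt.1 hi), height_zero]
      omega
  · rw [List.getD_eq_default _ _ (not_lt.1 hb)]
    simp [height_zero]

section

variable {I : Type} {T : ℕ} {enc : I → List (List ℚ)}

theorem inputCtx_pta {b : ℕ} (hb : b ≤ T) :
    (inputCtx T enc).PTA (fun x => ((enc x).getD b []).length + 1)
      fun x i => ((enc x).getD b []).getD i 0 := by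
  have h := Ctx.PTA.var (Γ := inputCtx T enc) b
    (Ctx.PBA.of_le (B := fun x => inputSize (enc x) + 2)
      ⟨1, fun x _ => (pow_one _).ge⟩ fun x _ i _ =>
        (height_getD_le (enc x) b i).trans (Nat.le_succ _))
  exact h.mono fun x _ => by simp [inputCtx, hb]

theorem polyTimeComputable_of_pt {q : I → ℚ} (hq : (inputCtx T enc).PT q) {f : I → ℝ}
    (hf : ∀ x, (q x : ℝ) = f x) : PolyTimeComputable enc f := by
  -- Arrays beyond T have length 0 in the context, so they may all be laid out at T; array T + 1
  -- receives the result.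
  obtain ⟨P, k₁, hP⟩ := hq.2 (fun b => min b T) (T + 1) fun b => Nat.lt_succ_of_le (min_le_right _ _)
  obtain ⟨k, hk⟩ := (Ctx.PB.pow_size (Γ := inputCtx T enc) k₁).add
    (((Ctx.PB.const 2).mul hq.1).add (Ctx.PB.const 20))
  refine ⟨.seq P (setReg 0 (reg (T + 1))), (Polynomial.X + Polynomial.C 2) ^ k, fun x => ?_⟩
  obtain ⟨τ, c, e1, e2, e3, e4⟩ := hP x trivial (initialMemory (enc x)) fun b i hi => by
    have hb : b ≤ T := by
      by_contra hb
      simp [inputCtx, hb] at hi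
    change initialMemory (enc x) (min b T) i = _
    rw [min_eq_left hb]
    rfl
  have e5 : τ (T + 1) 0 = q x := e3 0 one_pos
  refine ⟨_, _, .seq e1 (exec_setReg τ 0 _), ?_, ?_⟩
  · rw [Memory.set_self, reg_eval, e5, hf]
  · rw [reg_cost, e5, Polynomial.eval_pow, Polynomial.eval_add, Polynomial.eval_X,
      Polynomial.eval_C]
    have h1 := bitSize_le_height (q x)
    have h2 := hk x trivial
    dsimp only at h2
    change _ ≤ (inputSize (enc x) + 2) ^ k at h2
    change c ≤ (inputSize (enc x) + 2) ^ k₁ at e4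
    change (inputSize (enc x) + 2) ^ k₁ + _ ≤ _ at h2
    omega

end

/-! ### The queries -/

theorem ratSpeeds_getD {m : ℕ} {v : Fin m → ℚ} (hv : ∀ i, 0 < v i) :
    RatSpeeds (realVec v) fun i => (List.ofFn v).getD i 0 where
  eq i := by
    rw [List.getD_eq_getElem _ _ (by simp), List.getElem_ofFn]
    rfl
  pos i := by
    rw [List.getD_eq_getElem _ _ (by simp), List.getElem_ofFn]
    exact hv _

theorem map_fst_realHistory {m : ℕ} (h : List (ℚ × Fin m)) :
    (realHistory h).map Prod.fst = (h.map Prod.fst).map fun q : ℚ => (q : ℝ) := by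
  simp [realHistory, Function.comp_def]

theorem ratList_getD (l : List ℚ) : RatList (l.map fun q : ℚ => (q : ℝ)) fun j => l.getD j 0 := by
  intro j hj
  rw [List.length_map] at hj
  change _ = ((l.getD j 0 : ℚ) : ℝ)
  rw [List.getElem_map, List.getD_eq_getElem _ _ hj]

theorem getD_pos {l : List ℚ} (hl : ∀ q ∈ l, 0 < q) {j : ℕ} (hj : j < l.length) :
    0 < l.getD j 0 := by
  rw [List.getD_eq_getElem _ _ hj]
  exact hl _ (List.getElem_mem hj)

namespace PayQuery

/-- The speeds as an array. -/
def speeds (q : PayQuery) (i : ℕ) : ℚ :=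
  (List.ofFn q.speed).getD i 0

/-- The job sizes as an array. -/
def sizes (q : PayQuery) (j : ℕ) : ℚ :=
  (q.hist.map Prod.fst).getD j 0

theorem param {b : ℕ} (hb : b < 3) :
    (inputCtx 3 encode).PT fun q => [(q.m : ℚ), (q.hist.length : ℚ), ((q.i : ℕ) : ℚ)].getD b 0 :=
  (inputCtx_pta (T := 3) (enc := encode) (b := 0) (by norm_num)).app (idx := fun _ => b)
    (Ctx.PT.natConst b) fun q _ => by simp [encode]; omega

theorem hasSpeeds : (inputCtx 3 encode).Speeds (fun q => q.m) speeds where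
  pb := ⟨1, fun q _ => by
    have h : (List.ofFn q.speed).length ≤ inputSize q.encode :=
      length_le_inputSize (by simp [encode])
    rw [List.length_ofFn] at h
    rw [pow_one]
    exact h.trans (Nat.le_add_right _ 2)⟩
  pt := param (b := 0) (by norm_num)
  m_pos q _ := by have := q.two_le; omega
  pta := (inputCtx_pta (T := 3) (enc := encode) (b := 1) (by norm_num)).mono fun q _ => by
    simp [encode]
  pos q _ i hi := (ratSpeeds_getD q.speed_pos).pos ⟨i, hi⟩

theorem hasSizes : (inputCtx 3 encode).Sizes (fun q => q.hist.length) sizes where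
  pb := ⟨1, fun q _ => by
    have h : (q.hist.map Prod.fst).length ≤ inputSize q.encode :=
      length_le_inputSize (by simp [encode])
    rw [List.length_map] at h
    rw [pow_one]
    exact h.trans (Nat.le_add_right _ 2)⟩
  pt := param (b := 1) (by norm_num)
  pta := (inputCtx_pta (T := 3) (enc := encode) (b := 2) (by norm_num)).mono fun q _ => by
    simp [encode]
  pos q _ j hj := by
    refine getD_pos (fun y hy => ?_) (by simpa using hj)
    obtain ⟨e, he, rfl⟩ := List.mem_map.1 hy
    exact q.hist_pos e he

theorem pay_polyTimeComputable : PolyTimeComputable encode fun q =>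
    (levelMechanism q.m q.two_le).pay (realVec q.speed) (realHistory q.hist) q.i := by
  refine polyTimeComputable_of_pt (hasSizes.pay hasSpeeds (fun q _ => q.two_le)
    (i := fun q => q.i) (param (b := 2) (by norm_num)) fun q _ => q.i.2) fun q => ?_
  have h := (ratSpeeds_getD q.speed_pos).pay q.two_le (ratList_getD (q.hist.map Prod.fst))
    (fun j hj => hasSizes.pos q trivial j (by simpa using hj)) q.i
  change _ = levelPay (realVec q.speed) ((realHistory q.hist).map Prod.fst) q.i
  rw [map_fst_realHistory, h, List.length_map, List.length_map]
  rfl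

end PayQuery

namespace JobQuery

/-- The speeds as an array. -/
def speeds (q : JobQuery) (i : ℕ) : ℚ :=
  (List.ofFn q.speed).getD i 0

/-- The job sizes, including that of the new job, as an array. -/
def sizes (q : JobQuery) (j : ℕ) : ℚ :=
  if j = q.hist.length then q.size else (q.hist.map Prod.fst).getD j 0

/-- The completion times as an array. -/
def times (q : JobQuery) (i : ℕ) : ℚ :=
  (List.ofFn q.time).getD i 0

/-- The level of the new job. -/
noncomputable def level (q : JobQuery) : ℕ :=
  ratLevel (numLevels q.m) (ratWeight q.m q.speeds) q.sizes q.hist.length q.size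

/-- The number of equally likely random choices. -/
noncomputable def range (q : JobQuery) : ℕ :=
  ∑ i ∈ Finset.range q.m, ratShare q.m q.speeds q.level i

/-- The machine for the random choice `u`. -/
noncomputable def pick (q : JobQuery) (u : ℕ) : Fin q.m :=
  if h : u < q.range then ⟨pickIndex (ratShare q.m q.speeds q.level) q.m u, pickIndex_lt h⟩
  else ⟨0, by have := q.two_le; omega⟩

theorem level_le (q : JobQuery) : q.level ≤ numLevels q.m :=
  ratLevel_le _ _ _ _

theorem ratSpeeds (q : JobQuery) : RatSpeeds (realVec q.speed) q.speeds :=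
  ratSpeeds_getD q.speed_pos

theorem ratList (q : JobQuery) :
    RatList ((q.hist.map Prod.fst).map fun q : ℚ => (q : ℝ)) q.sizes := fun j hj => by
  have h : j ≠ q.hist.length := by
    rw [List.length_map, List.length_map] at hj
    omega
  rw [sizes, if_neg h]
  exact ratList_getD _ j hj

theorem sizes_pos (q : JobQuery) {j : ℕ} (hj : j < q.hist.length + 1) : 0 < q.sizes j := by
  rw [sizes]
  split_ifs with h
  · exact q.size_pos
  · refine getD_pos (fun y hy => ?_) (by rw [List.length_map]; omega)
    obtain ⟨e, he, rfl⟩ := List.mem_map.1 hy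
    exact q.hist_pos e he

theorem fraction_eq_div (q : JobQuery) (i : Fin q.m) :
    fraction (realVec q.speed) ((realHistory q.hist).map Prod.fst) q.size i =
      (ratShare q.m q.speeds q.level i : ℝ) / (q.range : ℝ) := by
  have hm : 0 < q.m := by have := q.two_le; omega
  have h := q.ratSpeeds.fraction_take hm q.ratList (j := q.hist.length) (by simp) q.size i
  rw [List.take_of_length_le (by simp)] at h
  rw [map_fst_realHistory, h]
  change ((ratFraction q.m q.speeds q.level i : ℚ) : ℝ) = _
  rw [ratFraction_eq_div hm _ q.level_le, Rat.cast_div, Rat.cast_natCast, Rat.cast_natCast]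
  rfl

theorem param {b : ℕ} (hb : b < 3) :
    (inputCtx 4 encode).PT fun q => [(q.m : ℚ), (q.hist.length : ℚ), q.size].getD b 0 :=
  (inputCtx_pta (T := 4) (enc := encode) (b := 0) (by norm_num)).app (idx := fun _ => b)
    (Ctx.PT.natConst b) fun q _ => by simp [encode]; omega

theorem hasSpeeds : (inputCtx 4 encode).Speeds (fun q => q.m) speeds where
  pb := ⟨1, fun q _ => by
    have h : (List.ofFn q.speed).length ≤ inputSize q.encode :=
      length_le_inputSize (by simp [encode])
    rw [List.length_ofFn] at h
    rw [pow_one]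
    exact h.trans (Nat.le_add_right _ 2)⟩
  pt := param (b := 0) (by norm_num)
  m_pos q _ := by have := q.two_le; omega
  pta := (inputCtx_pta (T := 4) (enc := encode) (b := 1) (by norm_num)).mono fun q _ => by
    simp [encode]
  pos q _ i hi := q.ratSpeeds.pos ⟨i, hi⟩

theorem hasSizes : (inputCtx 4 encode).Sizes (fun q => q.hist.length + 1) sizes where
  pb := ⟨1, fun q _ => by
    have h : (q.hist.map Prod.fst).length ≤ inputSize q.encode :=
      length_le_inputSize (by simp [encode])
    rw [List.length_map] at h
    rw [pow_one]
    exact Nat.add_le_add h one_le_two⟩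
  pt := (param (b := 1) (by norm_num)).natAdd (Ctx.PT.natConst 1)
  -- Both branches are evaluated, so the history list is also read at its length; the padding zero
  -- of the input arrays makes this admissible.
  pta := fun _ _ _ h idx hidx hlt =>
    hidx.ite_natEq ((param (b := 1) (by norm_num)).weak h) ((param (b := 2) (by norm_num)).weak h)
      (inputCtx_pta (T := 4) (enc := encode) (b := 2) (by norm_num) _ _ _ h idx hidx fun y hy => by
        have := hlt y hy
        simpa [encode] using this)
  pos q _ _ hj := q.sizes_pos hj

theorem hasTimes : (inputCtx 4 encode).PTA (fun q => q.m) times :=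
  (inputCtx_pta (T := 4) (enc := encode) (b := 4) (by norm_num)).mono fun q _ => by simp [encode]

theorem level_pt : (inputCtx 4 encode).PT fun q => (q.level : ℚ) :=
  hasSizes.level hasSpeeds (param (b := 1) (by norm_num)) (fun _ _ => Nat.lt_succ_self _)
    (param (b := 2) (by norm_num))

theorem share_pta :
    (inputCtx 4 encode).PTA (fun q => q.m) fun q i => (ratShare q.m q.speeds q.level i : ℚ) :=
  hasSpeeds.share level_pt fun q _ => q.level_le

theorem range_polyTimeComputable : PolyTimeComputable encode fun q => (q.range : ℝ) :=
  polyTimeComputable_of_pt (Ctx.PT.natSum hasSpeeds.pb hasSpeeds.pt share_pta) fun q => by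
    rw [Rat.cast_natCast]
    rfl

/-- The random integer is only appended to the encoding, so everything computable from a job query
stays computable. -/
theorem ext_pick : Ctx.Ext (inputCtx 5 fun x : {x : JobQuery × ℕ // x.2 < x.1.range} =>
    x.1.1.encode ++ [[(x.1.2 : ℚ)]]) (inputCtx 4 encode) fun x => x.1.1 where
  dom _ _ := trivial
  size x _ := by simp [inputCtx, inputSize]
  var := by
    refine ⟨id, fun b x _ i hi => ?_⟩
    have hb : b ≤ 4 := by
      by_contra hb
      simp [inputCtx, hb] at hi
    have e : (x.1.1.encode ++ [[(x.1.2 : ℚ)]]).getD b [] = x.1.1.encode.getD b [] :=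
      List.getD_append _ _ _ _ (by simp [encode]; omega)
    have hi' : i < (x.1.1.encode.getD b []).length + 1 := by simpa [inputCtx, hb] using hi
    constructor
    · change i < if b ≤ 5 then ((x.1.1.encode ++ [[(x.1.2 : ℚ)]]).getD b []).length + 1 else 0
      rw [if_pos (by omega), e]
      exact hi'
    · change ((x.1.1.encode ++ [[(x.1.2 : ℚ)]]).getD b []).getD i 0 =
        (x.1.1.encode.getD b []).getD i 0
      rw [e]

theorem pick_polyTimeComputable :
    PolyTimeComputable (fun x : {x : JobQuery × ℕ // x.2 < x.1.range} =>
      x.1.1.encode ++ [[(x.1.2 : ℚ)]]) fun x => ((pick x.1.1 x.1.2 : ℕ) : ℝ) := by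
  have hu := (inputCtx_pta (T := 5) (enc := fun x : {x : JobQuery × ℕ // x.2 < x.1.range} =>
    x.1.1.encode ++ [[(x.1.2 : ℚ)]]) (b := 5) (by norm_num)).app (idx := fun _ => 0)
    (Ctx.PT.natConst 0) fun x _ => Nat.succ_pos _
  refine polyTimeComputable_of_pt (Ctx.PT.pickIndex (hasSpeeds.weak ext_pick).pb
    (hasSpeeds.weak ext_pick).pt (share_pta.weak ext_pick) (u := fun x => x.1.2)
    (hu.congr fun x _ => by simp [encode])) fun x => ?_
  rw [Rat.cast_natCast, pick, dif_pos x.2]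

theorem fee_polyTimeComputable : PolyTimeComputable encode fun q =>
    (levelMechanism q.m q.two_le).fee (realVec q.speed) (realHistory q.hist) (realVec q.time)
      (q.size : ℝ) := by
  refine polyTimeComputable_of_pt (hasSizes.fee hasSpeeds (param (b := 1) (by norm_num)) hasTimes
    (param (b := 2) (by norm_num))) fun q => ?_
  have h := q.ratSpeeds.fee (by have := q.two_le; omega) q.ratList
    (fun j hj => q.sizes_pos (by simp at hj; omega)) (C := realVec q.time) (c := q.times)
    (fun i => by
      rw [times, List.getD_eq_getElem _ _ (by simp), List.getElem_ofFn]
      rfl) q.size_pos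
  change _ = levelFee (realVec q.speed) ((realHistory q.hist).map Prod.fst) (realVec q.time) _
  rw [map_fst_realHistory, h, List.length_map, List.length_map]
  rfl

end JobQuery

theorem levelMechanism_runsInPolyTime : RunsInPolyTime levelMechanism := by
  refine ⟨⟨JobQuery.range, JobQuery.pick, JobQuery.range_polyTimeComputable,
    JobQuery.pick_polyTimeComputable, fun q => ⟨?_, fun i => ?_⟩⟩,
    JobQuery.fee_polyTimeComputable, PayQuery.pay_polyTimeComputable⟩
  · exact sum_ratShare_pos (by have := q.two_le; omega) _ q.level_le
  · have h : ((Finset.range q.range).filter fun u => q.pick u = i) =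
        (Finset.range q.range).filter fun u =>
          pickIndex (ratShare q.m q.speeds q.level) q.m u = i :=
      Finset.filter_congr fun u hu => by
        rw [JobQuery.pick, dif_pos (Finset.mem_range.1 hu), Fin.ext_iff]
    rw [h, JobQuery.range, card_pickIndex i.2]
    exact q.fraction_eq_div i

end TwoSidedScheduling

theorem theorem1 :
    (∀ (m : ℕ) (hm : 2 ≤ m), (levelMechanism m hm).TwoSidedTruthful) ∧
    RunsInPolyTime levelMechanism ∧
    ∃ c : ℝ, 0 < c ∧
      ∀ (m : ℕ) (hm : 2 ≤ m) (n : ℕ) (s : Fin m → ℝ) (p : Fin n → ℝ),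
        (∀ i, 0 < s i) → (∀ j, 0 < p j) →
          (levelMechanism m hm).expect s p (makespan s p) ≤ c * Real.log m * opt s p ∧
          1 - 1 / (m : ℝ) ^ 2 ≤ (levelMechanism m hm).probOf s p
            {a | makespan s p a ≤ c * Real.log m * opt s p} :=
  ⟨fun _ hm => ⟨levelMechanism_machineTruthful hm, levelMechanism_jobTruthful hm⟩,
    levelMechanism_runsInPolyTime, 100, by norm_num, fun _ hm _ _ _ hs hp =>
      levelMechanism_competitive hm hs hp⟩
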